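/- **Definitions.** Let $V$ be a nonempty finite set, $n=|V|$, and let $\Pi$ be a nonempty set of orderings (linear orders) of $V$, read from left to right. The position of $v$ in $\sigma$ is the number of elements preceding $v$, plus one. *DFS-orderings.* Depth-first search on a graph $G=(V,E)$ starts with $\mathrm{label}(v)=0$ for all $v$; in iteration $i=1,\dots,n$ it visits an unvisited vertex $v$ with the largest label, puts $v$ at position $i$, and sets $\mathrm{label}(x)=i$ for every unvisited neighbour $x$ of $v$. The orderings that can arise are the DFS-orderings of $G$. A DFS-tree support of $\Pi$ is a tree $T$ with vertex set $V$ such that every $\sigma\in\Pi$ is a DFS-ordering of $T$. *Attachment digraph.* For $S\subseteq V$ and $x\in S$ let $B(\sigma,S,x)$ consist of the second element of $S$ in $\sigma$ alone if $x$ is the first element of $S$ in $\sigma$, and of all elements of $S$ preceding $x$ in $\sigma$ otherwise. Start with $S=V$ and no arcs. While $|S|\ge 3$, let $L$ be the set of the elements that are last in $S$ in some $\sigma\in\Pi$, add the arcs $(v,y)$ for all $v\in L$ and $y\in\bigcap_{\sigma\in\Pi}B(\sigma,S,v)$, and replace $S$ by $S\setminus L$. If finally $|S|=2$, add an arc in an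 arbitrary direction between the two elements of $S$. The result is an attachment digraph $D$; let $G$ be its underlying undirected graph. A vertex is forced if it has at most one outneighbour in $D$, and free otherwise. Let $V^\star$ be the set of forced vertices and $T^\star=G[V^\star]$. *Candidate sets.* Suppose that $T^\star$ is a tree. For $\sigma\in\Pi$ and a free vertex $v$, the guider of $v$ in $\sigma$ is the closest forced vertex to the left of $v$ in $\sigma$. Let $Q(\sigma,v)$ be the vertex set of the path in $T^\star$ between the guider of $v$ and $w$, where $w$ is the first vertex of $\sigma$ if no forced vertex is to the right of $v$ in $\sigma$, and otherwise $w$ is the parent, in $T^\star$ rooted at the first vertex of $\sigma$, of the closest forced vertex to the right of $v$. Let $Q(v)=\bigcap_{\sigma\in\Pi}Q(\sigma,v)$. *Purification rule.* If free vertices $x,v$ have the same guider $w$ in some $\sigma\in\Pi$, and $x$ precedes $v$ in $\sigma$, let $C$ be the set of the elements of $Q(v)$ that are closer to $w$ in $T^\star$ than every element of $Q(x)$, and $R$ the set of the elements of $Q(x)$ that are farther from $w$ in $T^\star$ than every element of $Q(v)$. If $C\cup R\ne\emptyset$, replace $Q(v)$ by $Q(v)\setminus C$ and $Q(x)$ by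 $Q(x)\setminus R$. **Algorithm A** (input $V,\Pi$). 1. Compute an attachment digraph $D$ of $\Pi$ and its underlying graph $G$. If $G$ is disconnected, answer "no". 2. If $V^\star=V$: return $T^\star$ if every $\sigma\in\Pi$ is a DFS-ordering of $T^\star$; otherwise answer "no". 3. If $T^\star$ is not a DFS-tree support of the set of restrictions of the orderings in $\Pi$ to $V^\star$, answer "no". 4. Compute $Q(v)$ for all free $v$, and apply the purification rule, in arbitrary order, until it no longer applies. If $Q(v)=\emptyset$ for some free $v$, answer "no". 5. Choose an arbitrary bijection $f:V\to\{1,\dots,n\}$. Attach each free vertex $v$ as a leaf to the vertex of $Q(v)$ at which $f$ is smallest, and return the resulting graph. **Theorem.** (i) Let $V$ be a nonempty finite set and $\Pi$ a nonempty set of orderings of $V$. Algorithm A has a terminating execution on $(V,\Pi)$, and the purification rule can be applied at most $|V|^2$ times, in whatever order it is applied. For all choices that the algorithm leaves open, the result is correct: if $\Pi$ admits a DFS-tree support, then the algorithm returns a DFS-tree support of $\Pi$; otherwise it answers "no". (ii) Algorithm A can be carried out in polynomial time: there are a program for a unit-cost random access machine (with addition and truncated subtraction as its only arithmetic operations) and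 a polynomial $p$ such that, for all $n,m\ge1$ and all lists of $m$ orderings of an $n$-element vertex set, given as an $m\times n$ table of positions, the program halts after at most $p(nm)$ time units with the result of an execution of Algorithm A on the set $\Pi$ of these orderings, that is, with the adjacency matrix of a DFS-tree support of $\Pi$ if $\Pi$ admits one, and with the answer "no" otherwise. In particular, it can be decided in polynomial time whether a set of orderings admits a DFS-tree support. -/

import Mathlib

/-! ## Orderings, depth-first search, and tree supports

An ordering of `V` is a `LinearOrder V`, read from left (smallest) to right (largest). -/

universe u

namespace GraphSearch

/-- The position of `v` in the ordering `σ`: the number of elements preceding `v`, plus one. -/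
noncomputable def pos {V : Type u} (σ : LinearOrder V) (v : V) : ℕ :=
  {w : V | σ.lt w v}.ncard + 1

open Classical in
/-- `dfsLabel G σ i x` is `label(x)` after the first `i` iterations of depth-first search on `G`
in which the vertices are visited in the order `σ`: all labels start at `0`, and iteration `i`
visits the vertex at position `i` and sets the label of each of its unvisited neighbours to `i`. -/
noncomputable def dfsLabel {V : Type u} (G : SimpleGraph V) (σ : LinearOrder V) : ℕ → V → ℕ
  | 0, _ => 0
  | i + 1, x =>
      if i + 1 < pos σ x ∧ ∃ v, pos σ v = i + 1 ∧ G.Adj v x then i + 1 else dfsLabel G σ i x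

/-- `σ` is produced by a depth-first search on `G`: the vertex visited in iteration `i + 1` has the
largest label among all vertices that are unvisited at that moment. -/
def IsDFSOrdering {V : Type u} (G : SimpleGraph V) (σ : LinearOrder V) : Prop :=
  ∀ (i : ℕ) (v : V), pos σ v = i + 1 →
    ∀ x : V, i + 1 ≤ pos σ x → dfsLabel G σ i x ≤ dfsLabel G σ i v

/-- `T` is a DFS-tree support of the set `Φ` of orderings. -/
def IsDFSTreeSupport {V : Type u} (Φ : Set (LinearOrder V)) (T : SimpleGraph V) : Prop :=
  T.IsTree ∧ ∀ σ ∈ Φ, IsDFSOrdering T σ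

/-- The restriction of an ordering to a subset. -/
@[reducible] def restrictOrder {V : Type u} (S : Set V) (σ : LinearOrder V) : LinearOrder S :=
  @Subtype.instLinearOrder V σ (fun v => v ∈ S)

/-! ## Attachment digraphs -/

/-- `x` is the first element of `S` in `σ`. -/
def IsFirst {V : Type u} (σ : LinearOrder V) (S : Set V) (x : V) : Prop :=
  x ∈ S ∧ ∀ y ∈ S, σ.le x y

/-- `x` is the last element of `S` in `σ`. -/
def IsLast {V : Type u} (σ : LinearOrder V) (S : Set V) (x : V) : Prop :=
  x ∈ S ∧ ∀ y ∈ S, σ.le y x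

/-- `y` is the second element of `S` in `σ`. -/
def IsSecond {V : Type u} (σ : LinearOrder V) (S : Set V) (y : V) : Prop :=
  ∃ x, IsFirst σ S x ∧ IsFirst σ (S \ {x}) y

/-- The set `B(σ, S, x)`: the second element of `S` if `x` is the first one, and the set of all
elements of `S` preceding `x` otherwise. -/
def blockers {V : Type u} (σ : LinearOrder V) (S : Set V) (x : V) : Set V :=
  {y | (IsFirst σ S x ∧ IsSecond σ S y) ∨ (¬ IsFirst σ S x ∧ y ∈ S ∧ σ.lt y x)}

/-- The set `L` of all elements of `S` that are last in `S` for some ordering in `Φ`. -/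
def bottoms {V : Type u} (Φ : Set (LinearOrder V)) (S : Set V) : Set V :=
  {v | ∃ σ ∈ Φ, IsLast σ S v}

/-- The arcs `(v, y)` with `v ∈ L` and `y ∈ B(v) = ⋂ σ ∈ Φ, B(σ, S, v)` that one pass of the
loop adds. -/
def newArcs {V : Type u} (Φ : Set (LinearOrder V)) (S : Set V) : Set (V × V) :=
  {a | a.1 ∈ bottoms Φ S ∧ ∀ σ ∈ Φ, a.2 ∈ blockers σ S a.1}

/-- `AttachmentLoop Φ S A A'`: the loop that builds the attachment digraph, started with working
set `S` and arc set `A`, ends with arc set `A'`. The direction of the final arc is arbitrary. -/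
inductive AttachmentLoop {V : Type u} (Φ : Set (LinearOrder V)) :
    Set V → Set (V × V) → Set (V × V) → Prop
  | step (S : Set V) (A A' : Set (V × V)) (hS : 3 ≤ S.ncard)
      (h : AttachmentLoop Φ (S \ bottoms Φ S) (A ∪ newArcs Φ S) A') : AttachmentLoop Φ S A A'
  | last (a b : V) (A : Set (V × V)) (hab : a ≠ b) : AttachmentLoop Φ {a, b} A (A ∪ {(a, b)})
  | done (S : Set V) (A : Set (V × V)) (hS : S.ncard ≤ 1) : AttachmentLoop Φ S A A

/-- `A` is the arc set of an attachment digraph of `Φ`. -/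
def IsAttachmentDigraph {V : Type u} (Φ : Set (LinearOrder V)) (A : Set (V × V)) : Prop :=
  AttachmentLoop Φ Set.univ ∅ A

/-- The underlying undirected graph of a digraph. -/
def underlyingGraph {V : Type u} (A : Set (V × V)) : SimpleGraph V :=
  SimpleGraph.fromRel (fun v y => (v, y) ∈ A)

/-- The set `V⋆` of forced vertices, those with at most one outneighbour. All other vertices are
free. -/
def forced {V : Type u} (A : Set (V × V)) : Set V :=
  {v | {y | (v, y) ∈ A}.Subsingleton}

/-- The graph `T⋆`, the subgraph of the attachment graph induced by the forced vertices. -/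
def starTree {V : Type u} (A : Set (V × V)) : SimpleGraph (forced A) :=
  (underlyingGraph A).induce (forced A)

/-! ## Candidate sets and the purification rule

`F` is the set of forced vertices, its complement `Fᶜ` the set of free vertices, and `T` a graph on
`F`. -/

/-- The vertices of the path between `a` and `b` (in a tree there is exactly one such path). -/
def pathVertices {W : Type u} (T : SimpleGraph W) (a b : W) : Set W :=
  {x | ∃ p : T.Walk a b, p.IsPath ∧ x ∈ p.support}

/-- `g` is the guider of `v` in `σ`: the closest forced vertex to the left of `v`. -/
def IsGuider {V : Type u} {F : Set V} (σ : LinearOrder V) (v : V) (g : F) : Prop :=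
  σ.lt g v ∧ ∀ x : F, σ.lt x v → σ.le x g

/-- `x` is the closest forced vertex to the right of `v` in `σ`. -/
def IsNextForced {V : Type u} {F : Set V} (σ : LinearOrder V) (v : V) (x : F) : Prop :=
  σ.lt v x ∧ ∀ y : F, σ.lt v y → σ.le x y

/-- `w` is the parent of `x` in the tree `T` rooted at the first vertex of `σ`. -/
def IsParent {V : Type u} {F : Set V} (T : SimpleGraph F) (σ : LinearOrder V) (x w : F) : Prop :=
  ∃ r : F, IsFirst σ Set.univ (r : V) ∧ T.Adj w x ∧ w ∈ pathVertices T r x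

/-- `w` is the first vertex of `σ` if no forced vertex is to the right of `v`, and otherwise the
parent of the closest forced vertex to the right of `v`. -/
def IsEndpoint {V : Type u} {F : Set V} (T : SimpleGraph F) (σ : LinearOrder V) (v : V) (w : F) :
    Prop :=
  ((¬ ∃ x : F, σ.lt v x) ∧ IsFirst σ Set.univ (w : V)) ∨
    ∃ x : F, IsNextForced σ v x ∧ IsParent T σ x w

/-- The set `Q(σ, v)`. -/
def candidatesIn {V : Type u} {F : Set V} (T : SimpleGraph F) (σ : LinearOrder V) (v : V) :
    Set F :=
  {x | ∃ g w : F, IsGuider σ v g ∧ IsEndpoint T σ v w ∧ x ∈ pathVertices T g w}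

/-- The initial candidate sets `Q(v) = ⋂ σ ∈ Φ, Q(σ, v)` of the free vertices. -/
def candidates {V : Type u} {F : Set V} (Φ : Set (LinearOrder V)) (T : SimpleGraph F)
    (v : ↥(Fᶜ)) : Set F :=
  {x | ∀ σ ∈ Φ, x ∈ candidatesIn T σ v}

/-- The vertices of `X` that are farther from `w` in `T` than every vertex of `Y`. -/
def farther {W : Type u} (T : SimpleGraph W) (w : W) (X Y : Set W) : Set W :=
  {x ∈ X | ∀ y ∈ Y, T.dist y w < T.dist x w}

/-- The vertices of `X` that are closer to `w` in `T` than every vertex of `Y`. -/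
def closer {W : Type u} (T : SimpleGraph W) (w : W) (X Y : Set W) : Set W :=
  {x ∈ X | ∀ y ∈ Y, T.dist x w < T.dist y w}

open Classical in
/-- One application of the purification rule turns the candidate sets `Q` into `Q'`. -/
def PurifyStep {V : Type u} {F : Set V} (Φ : Set (LinearOrder V)) (T : SimpleGraph F)
    (Q Q' : ↥(Fᶜ) → Set F) : Prop :=
  ∃ σ ∈ Φ, ∃ (x v : ↥(Fᶜ)) (w : F),
    σ.lt (x : V) v ∧ IsGuider σ (x : V) w ∧ IsGuider σ (v : V) w ∧
    (closer T w (Q v) (Q x) ∪ farther T w (Q x) (Q v)).Nonempty ∧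
    Q' = Function.update (Function.update Q v (Q v \ closer T w (Q v) (Q x)))
      x (Q x \ farther T w (Q x) (Q v))

/-- `Q` is obtained from the initial candidate sets by applying the purification rule, in some
order, until it no longer applies. -/
def IsPurified {V : Type u} {F : Set V} (Φ : Set (LinearOrder V)) (T : SimpleGraph F)
    (Q : ↥(Fᶜ) → Set F) : Prop :=
  Relation.ReflTransGen (PurifyStep Φ T) (candidates Φ T) Q ∧ ∀ Q', ¬ PurifyStep Φ T Q Q'

/-- The graph on `V` obtained from `T` by attaching each free vertex `v` to the vertex of `Q v` at
which the assignment function `f` is smallest. -/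
def assignParents {V : Type u} {F : Set V} {n : ℕ} (T : SimpleGraph F) (Q : ↥(Fᶜ) → Set F)
    (f : V ≃ Fin n) : SimpleGraph V :=
  T.spanningCoe ⊔ SimpleGraph.fromRel
    (fun v y => ∃ (v' : ↥(Fᶜ)) (y' : F), (v' : V) = v ∧ (y' : V) = y ∧
      y' ∈ Q v' ∧ ∀ z ∈ Q v', f y' ≤ f z)

/-! ## The algorithm -/

/-- `DFSTreeAlgorithm Φ r`: some execution of the algorithm on `Φ` returns `r`, where `none` stands
for the answer "no". The arbitrary choices are the direction of the last arc of the attachment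
digraph `A`, the order in which the purification rule is applied, and the assignment
function `f`. -/
inductive DFSTreeAlgorithm {V : Type u} (Φ : Set (LinearOrder V)) : Option (SimpleGraph V) → Prop
  | disconnected (A : Set (V × V)) (hA : IsAttachmentDigraph Φ A)
      (hc : ¬ (underlyingGraph A).Connected) : DFSTreeAlgorithm Φ none
  | allForced (A : Set (V × V)) (hA : IsAttachmentDigraph Φ A)
      (hc : (underlyingGraph A).Connected) (hF : forced A = Set.univ)
      (hT : ∀ σ ∈ Φ, IsDFSOrdering (starTree A).spanningCoe σ) :
      DFSTreeAlgorithm Φ (some (starTree A).spanningCoe)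
  | allForcedNo (A : Set (V × V)) (hA : IsAttachmentDigraph Φ A)
      (hc : (underlyingGraph A).Connected) (hF : forced A = Set.univ)
      (hT : ¬ ∀ σ ∈ Φ, IsDFSOrdering (starTree A).spanningCoe σ) : DFSTreeAlgorithm Φ none
  | restrictionNo (A : Set (V × V)) (hA : IsAttachmentDigraph Φ A)
      (hc : (underlyingGraph A).Connected) (hF : forced A ≠ Set.univ)
      (hR : ¬ IsDFSTreeSupport (restrictOrder (forced A) '' Φ) (starTree A)) :
      DFSTreeAlgorithm Φ none
  | noCandidate (A : Set (V × V)) (hA : IsAttachmentDigraph Φ A)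
      (hc : (underlyingGraph A).Connected) (hF : forced A ≠ Set.univ)
      (hR : IsDFSTreeSupport (restrictOrder (forced A) '' Φ) (starTree A))
      (Q : ↥((forced A)ᶜ) → Set (forced A)) (hQ : IsPurified Φ (starTree A) Q)
      (hE : ∃ v, Q v = ∅) : DFSTreeAlgorithm Φ none
  | assigned (A : Set (V × V)) (hA : IsAttachmentDigraph Φ A)
      (hc : (underlyingGraph A).Connected) (hF : forced A ≠ Set.univ)
      (hR : IsDFSTreeSupport (restrictOrder (forced A) '' Φ) (starTree A))
      (Q : ↥((forced A)ᶜ) → Set (forced A)) (hQ : IsPurified Φ (starTree A) Q)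
      (hE : ∀ v, (Q v).Nonempty) (f : V ≃ Fin (Nat.card V)) :
      DFSTreeAlgorithm Φ (some (assignParents (starTree A) Q f))

/-- `r` is a correct answer for `Φ`: a DFS-tree support if there is one, and "no" otherwise. -/
def IsCorrectAnswer {V : Type u} (Φ : Set (LinearOrder V)) (r : Option (SimpleGraph V)) : Prop :=
  ((∃ T, IsDFSTreeSupport Φ T) → ∃ T, r = some T ∧ IsDFSTreeSupport Φ T) ∧
    ((¬ ∃ T, IsDFSTreeSupport Φ T) → r = none)

/-! ## A random access machine with step count

The programs are structured programs over registers and arrays that hold natural numbers, with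
indirect addressing. The only arithmetic is addition and truncated subtraction, so that the length
of the numbers grows by at most a constant per time unit, and unit-cost time is polynomially
related to the time of Turing machines. -/

/-- The memory: registers `reg x`, and cells `arr a i j` of two-dimensional arrays `arr a`. -/
structure RAMState where
  reg : ℕ → ℕ
  arr : ℕ → ℕ → ℕ → ℕ

/-- Expressions: constants, registers, array cells, sums, and truncated differences. -/
inductive RAMExpr
  | const (k : ℕ)
  | reg (x : ℕ)
  | arr (a : ℕ) (i j : RAMExpr)
  | add (e₁ e₂ : RAMExpr)
  | sub (e₁ e₂ : RAMExpr)

/-- The value of an expression. -/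
def RAMExpr.eval (s : RAMState) : RAMExpr → ℕ
  | const k => k
  | reg x => s.reg x
  | arr a i j => s.arr a (i.eval s) (j.eval s)
  | add e₁ e₂ => e₁.eval s + e₂.eval s
  | sub e₁ e₂ => e₁.eval s - e₂.eval s

/-- The time needed to evaluate an expression: one unit for each operation in it. -/
def RAMExpr.cost : RAMExpr → ℕ
  | const _ => 1
  | reg _ => 1
  | arr _ i j => i.cost + j.cost + 1
  | add e₁ e₂ => e₁.cost + e₂.cost + 1
  | sub e₁ e₂ => e₁.cost + e₂.cost + 1

/-- Programs. A condition `e` counts as true if its value is not `0`. -/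
inductive RAMProgram
  | skip
  | assign (x : ℕ) (e : RAMExpr)
  | store (a : ℕ) (i j e : RAMExpr)
  | seq (c₁ c₂ : RAMProgram)
  | ite (e : RAMExpr) (c₁ c₂ : RAMProgram)
  | loop (e : RAMExpr) (c : RAMProgram)

/-- The memory after `reg x := k`. -/
def RAMState.setReg (s : RAMState) (x k : ℕ) : RAMState :=
  { s with reg := Function.update s.reg x k }

/-- The memory after `arr a i j := k`. -/
def RAMState.setArr (s : RAMState) (a i j k : ℕ) : RAMState :=
  { s with arr := fun a' i' j' => if a' = a ∧ i' = i ∧ j' = j then k else s.arr a' i' j' }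

/-- `Exec c s s' t`: started in memory `s`, the program `c` halts after exactly `t` time units with
memory `s'`. The program `loop e c` repeats `c` while `e` is true. -/
inductive RAMProgram.Exec : RAMProgram → RAMState → RAMState → ℕ → Prop
  | skip (s : RAMState) : Exec skip s s 1
  | assign (x : ℕ) (e : RAMExpr) (s : RAMState) :
      Exec (assign x e) s (s.setReg x (e.eval s)) (e.cost + 1)
  | store (a : ℕ) (i j e : RAMExpr) (s : RAMState) :
      Exec (store a i j e) s (s.setArr a (i.eval s) (j.eval s) (e.eval s))
        (i.cost + j.cost + e.cost + 1)
  | seq (c₁ c₂ : RAMProgram) (s s₁ s₂ : RAMState) (t₁ t₂ : ℕ)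
      (h₁ : Exec c₁ s s₁ t₁) (h₂ : Exec c₂ s₁ s₂ t₂) : Exec (seq c₁ c₂) s s₂ (t₁ + t₂)
  | iteTrue (e : RAMExpr) (c₁ c₂ : RAMProgram) (s s' : RAMState) (t : ℕ)
      (he : e.eval s ≠ 0) (h : Exec c₁ s s' t) : Exec (ite e c₁ c₂) s s' (e.cost + 1 + t)
  | iteFalse (e : RAMExpr) (c₁ c₂ : RAMProgram) (s s' : RAMState) (t : ℕ)
      (he : e.eval s = 0) (h : Exec c₂ s s' t) : Exec (ite e c₁ c₂) s s' (e.cost + 1 + t)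
  | loopTrue (e : RAMExpr) (c : RAMProgram) (s s₁ s₂ : RAMState) (t₁ t₂ : ℕ)
      (he : e.eval s ≠ 0) (h₁ : Exec c s s₁ t₁) (h₂ : Exec (loop e c) s₁ s₂ t₂) :
      Exec (loop e c) s s₂ (e.cost + 1 + t₁ + t₂)
  | loopFalse (e : RAMExpr) (c : RAMProgram) (s : RAMState)
      (he : e.eval s = 0) : Exec (loop e c) s s (e.cost + 1)

/-- Executions are deterministic. -/
theorem RAMProgram.Exec.unique {c : RAMProgram} {s s₁ s₂ : RAMState} {t₁ t₂ : ℕ}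
    (h₁ : c.Exec s s₁ t₁) (h₂ : c.Exec s s₂ t₂) : s₁ = s₂ ∧ t₁ = t₂ := by
  induction h₁ generalizing s₂ t₂ with
  | skip s => cases h₂; exact ⟨rfl, rfl⟩
  | assign x e s => cases h₂; exact ⟨rfl, rfl⟩
  | store a i j e s => cases h₂; exact ⟨rfl, rfl⟩
  | seq c₁ c₂ s s₁ s₂ t₁ t₂ _ _ ih₁ ih₂ =>
    cases h₂ with
    | seq _ _ _ _ _ _ _ k₁ k₂ =>
      obtain ⟨rfl, rfl⟩ := ih₁ k₁
      obtain ⟨rfl, rfl⟩ := ih₂ k₂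
      exact ⟨rfl, rfl⟩
  | iteTrue e c₁ c₂ s s' t he _ ih =>
    cases h₂ with
    | iteTrue _ _ _ _ _ _ _ k => obtain ⟨rfl, rfl⟩ := ih k; exact ⟨rfl, rfl⟩
    | iteFalse _ _ _ _ _ _ he' _ => exact absurd he' he
  | iteFalse e c₁ c₂ s s' t he _ ih =>
    cases h₂ with
    | iteTrue _ _ _ _ _ _ he' _ => exact absurd he he'
    | iteFalse _ _ _ _ _ _ _ k => obtain ⟨rfl, rfl⟩ := ih k; exact ⟨rfl, rfl⟩
  | loopTrue e c s s₁ s₂ t₁ t₂ he _ _ ih₁ ih₂ =>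
    cases h₂ with
    | loopTrue _ _ _ _ _ _ _ _ k₁ k₂ =>
      obtain ⟨rfl, rfl⟩ := ih₁ k₁
      obtain ⟨rfl, rfl⟩ := ih₂ k₂
      exact ⟨rfl, rfl⟩
    | loopFalse _ _ _ he' => exact absurd he' he
  | loopFalse e c s he =>
    cases h₂ with
    | loopTrue _ _ _ _ _ _ _ he' _ _ => exact absurd he he'
    | loopFalse _ _ _ _ => exact ⟨rfl, rfl⟩

/-- The input: registers `0` and `1` hold the number `n` of vertices and the number `m` of
orderings, the cell `(i, v)` of array `0` holds the position of the vertex `v` in the `i`-th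
ordering, and everything else is `0`. -/
noncomputable def inputState {n m : ℕ} (σ : Fin m → LinearOrder (Fin n)) : RAMState where
  reg := fun x => if x = 0 then n else if x = 1 then m else 0
  arr := fun a i v =>
    if h : a = 0 ∧ i < m ∧ v < n then pos (σ ⟨i, h.2.1⟩) (⟨v, h.2.2⟩ : Fin n) else 0

/-- The memory `s` represents the answer `r`: register `0` holds `0` for "no"; otherwise it holds
`1`, and array `1` holds the adjacency matrix of the returned graph. -/
def OutputState {n : ℕ} (s : RAMState) : Option (SimpleGraph (Fin n)) → Prop
  | none => s.reg 0 = 0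
  | some T => s.reg 0 = 1 ∧
      ∀ v w : Fin n, (T.Adj v w → s.arr 1 v w = 1) ∧ (¬ T.Adj v w → s.arr 1 v w = 0)

end GraphSearch

namespace GraphSearch

/-! ## Depth-first search orderings of trees in terms of parents -/

/-! A graph is a DFS-tree support iff it is "nested" in every ordering: each vertex but the first
has exactly one earlier neighbour, its parent, and the parent of a vertex lying between `p` and a
child of `p` never precedes `p` (`isNestedTree_iff`, `isDFSTreeSupport_iff`). All later arguments
use this local condition.

Let `T` be a support. The working set of the attachment loop stays closed under parents in every
ordering (`isParentClosed_diff_bottoms`), so a vertex that is last somewhere has a single neighbour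
in the working set, and this neighbour blocks it in every ordering. Hence every edge of `T` becomes
an arc (`Attach.mem_of_adj`), and the only arc out of a forced vertex is an edge of `T`
(`Attach.adj_of_mem`). So `T⋆` is the subgraph of `T` induced by the forced vertices
(`starTree_eq`), parents of forced vertices are forced, and a free vertex has the same parent in all
orderings.

In a nested tree the path from the guider towards the root consists of ancestors, and distance from
the guider reverses the ordering. Therefore `Q(σ, v)` consists exactly of the vertices to which `v`
can be attached as a leaf without destroying nestedness of `σ` (`mem_candidatesIn_iff`). What
remains is a compatibility condition between free vertices with a common guider, which purification
handles. A purified family is the largest family of candidate sets to which the rule does not apply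
(`IsPurified.le_of_isConsistent`), whatever the order of application, and its sets are closed under
paths (`IsPurified.pathVertices_subset`).

Soundness: if `x` precedes `v` under the same guider but `v` were attached later than `x`,
consistency and path-closure would put both parents into both sets, so both minimise `f` and
coincide (`isNestedTree_assignParents`). Completeness: in a support the free vertices need not be
leaves, but sending each to its first forced ancestor gives a consistent family of nonempty
candidate sets, which survives purification (`candidates_nonempty_of_support`).

For the running time, every stage is an iteration of relations defined by fixed first-order
formulas, and nested loops evaluate a fixed formula in polynomial time (`Formula.exec_compile`). The
program skips all intermediate tests and only checks its result at the end. If a support exists, the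
computed graph is the output of a genuine execution (`algorithm_relationalResult`); if the check
fails, no support exists, and by correctness an execution answers "no". -/

theorem le_dfsLabel_iff {V : Type u} (G : SimpleGraph V) (σ : LinearOrder V) (k i : ℕ) (x : V)
    (hx : i < pos σ x) :
    k ≤ dfsLabel G σ i x ↔ k = 0 ∨ ∃ u, G.Adj u x ∧ k ≤ pos σ u ∧ pos σ u ≤ i := by
  induction i with
  | zero => simp [dfsLabel, pos]
  | succ i ih =>
    unfold dfsLabel
    split_ifs with h
    · obtain ⟨-, v, hv, hvx⟩ := h
      constructor
      · exact fun hk => Or.inr ⟨v, hvx, by omega, by omega⟩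
      · rintro (rfl | ⟨u, -, h1, h2⟩) <;> omega
    · rw [ih (by omega)]
      refine or_congr_right (exists_congr fun u => and_congr_right fun hu => and_congr_right
        fun _ => ⟨fun h' => by omega, fun h' => ?_⟩)
      by_contra h''
      exact h ⟨hx, u, by omega, hu⟩

section Positions

variable {V : Type u} [Finite V]

theorem pos_lt_pos_of_lt (σ : LinearOrder V) {a b : V} (h : σ.lt a b) : pos σ a < pos σ b := by
  refine Nat.succ_lt_succ (Set.ncard_lt_ncard ?_ (Set.toFinite _))
  refine ⟨fun w hw => lt_trans hw h, fun hsub => ?_⟩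
  exact lt_irrefl a (hsub (show a ∈ {w | σ.lt w b} from h))

theorem pos_lt_pos_iff (σ : LinearOrder V) {a b : V} : pos σ a < pos σ b ↔ σ.lt a b := by
  refine ⟨fun h => ?_, pos_lt_pos_of_lt σ⟩
  by_contra hab
  rcases eq_or_lt_of_le (not_lt.1 hab) with rfl | h'
  · exact lt_irrefl _ h
  · exact lt_asymm h (pos_lt_pos_of_lt σ h')

theorem pos_le_pos_iff (σ : LinearOrder V) {a b : V} : pos σ a ≤ pos σ b ↔ σ.le a b := by
  rw [← not_lt, pos_lt_pos_iff, not_lt]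

/-- Depth-first search orderings are the orderings in which the interval between two adjacent
vertices contains only vertices with an earlier neighbour in that interval. -/
theorem isDFSOrdering_iff (G : SimpleGraph V) (σ : LinearOrder V) :
    IsDFSOrdering G σ ↔ ∀ p b c, σ.lt p b → σ.lt b c → G.Adj p c →
      ∃ q, σ.le p q ∧ σ.lt q b ∧ G.Adj q b := by
  constructor
  · intro h p b c hpb hbc hpc
    obtain ⟨i, hi⟩ : ∃ i, pos σ b = i + 1 := ⟨_, rfl⟩
    have hpb' := (pos_lt_pos_iff σ).2 hpb
    have hbc' := (pos_lt_pos_iff σ).2 hbc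
    have h1 := h i b hi c (by omega)
    have h2 := ((le_dfsLabel_iff G σ (pos σ p) i c (by omega)).2
      (Or.inr ⟨p, hpc, le_rfl, by omega⟩)).trans h1
    rcases (le_dfsLabel_iff G σ _ i b (by omega)).1 h2 with h3 | ⟨u, hu, h3, h4⟩
    · simp [pos] at h3
    · exact ⟨u, (pos_le_pos_iff σ).1 h3, (pos_lt_pos_iff σ).1 (by omega), hu⟩
  · intro h i b hi c hc
    rcases (le_dfsLabel_iff G σ _ i c (by omega)).1 le_rfl with h3 | ⟨p, hp, h3, h4⟩
    · omega
    · refine h3.trans ((le_dfsLabel_iff G σ _ i b (by omega)).2 (Or.inr ?_))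
      have hpb : σ.lt p b := (pos_lt_pos_iff σ).1 (by omega)
      rcases eq_or_lt_of_le ((pos_le_pos_iff σ).1 (hi.symm ▸ hc : pos σ b ≤ pos σ c)) with rfl | hbc
      · exact ⟨p, hp, le_rfl, h4⟩
      · obtain ⟨q, h5, h6, h7⟩ := h p b c hpb hbc hp
        have := (pos_lt_pos_iff σ).2 h6
        exact ⟨q, h7, (pos_le_pos_iff σ).2 h5, by omega⟩

end Positions

/-- Every vertex but the first has exactly one earlier neighbour, its parent, and no vertex between
the parent of `c` and `c` has a parent that precedes the parent of `c`. -/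
structure IsNestedTree {V : Type u} (σ : LinearOrder V) (T : SimpleGraph V) : Prop where
  exists_parent : ∀ a b, σ.lt a b → ∃ p, σ.lt p b ∧ T.Adj p b
  parent_unique : ∀ p q b, σ.lt p b → σ.lt q b → T.Adj p b → T.Adj q b → p = q
  nested : ∀ p b c, σ.lt p b → σ.lt b c → T.Adj p c → ∃ q, σ.le p q ∧ σ.lt q b ∧ T.Adj q b

theorem exists_isFirst_univ {V : Type u} [Finite V] [Nonempty V] (σ : LinearOrder V) :
    ∃ r, IsFirst σ Set.univ r := by
  obtain ⟨r, hr⟩ := Finite.exists_min (α := V) (fun x => x)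
  exact ⟨r, trivial, fun y _ => hr y⟩

/-- A finite connected graph is a tree if its edges can be oriented such that every vertex has
outdegree at most one and some vertex has outdegree zero. -/
theorem isTree_of_connected_of_orientation {V : Type u} [Finite V] {T : SimpleGraph V}
    (hT : T.Connected) (P : V → V → Prop) (r : V) (hr : ∀ y, ¬ P r y)
    (huniq : ∀ v y z, P v y → P v z → y = z) (hadj : ∀ v y, T.Adj v y → P v y ∨ P y v) :
    T.IsTree := by
  have hex : ∀ e : T.edgeSet, ∃ v y, (e : Sym2 V) = s(v, y) ∧ P v y := by
    rintro ⟨e, he⟩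
    induction e with
    | _ v y =>
      rcases hadj v y he with h | h
      · exact ⟨v, y, rfl, h⟩
      · exact ⟨y, v, Sym2.eq_swap, h⟩
  choose v y he hP using hex
  -- An edge is determined by the source of its orientation, and this source is never `r`. Hence
  -- there are at most `|V| - 1` edges, while connectedness gives at least that many.
  have hinj : Function.Injective (fun e => (⟨v e, fun h => hr (y e) (h ▸ hP e)⟩ : {b // b ≠ r})) := by
    intro e e' h
    have h1 : v e = v e' := congrArg Subtype.val h
    have h2 : y e = y e' := huniq (v e) _ _ (hP e) (h1 ▸ hP e')
    exact Subtype.ext (by rw [he, he, h1, h2])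
  have h1 := Nat.card_le_card_of_injective _ hinj
  have h2 := hT.card_vert_le_card_edgeSet_add_one
  have h3 : Nat.card {b // b ≠ r} + 1 = Nat.card V := by
    classical
    have := Fintype.ofFinite V
    have : 0 < Fintype.card V := Fintype.card_pos_iff.2 ⟨r⟩
    rw [Nat.card_eq_fintype_card, Nat.card_eq_fintype_card, Fintype.card_subtype_compl,
      Fintype.card_subtype_eq]
    omega
  exact SimpleGraph.isTree_iff_connected_and_card.2 ⟨hT, by omega⟩

/-- Repeatedly passing to an earlier neighbour reaches the first vertex, and since positions drop
the walk is a path. Only existence of parents is assumed, so that the lemma can serve to prove their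
uniqueness in a tree. -/
theorem exists_path_to_first {V : Type u} [Finite V] {σ : LinearOrder V} {T : SimpleGraph V}
    (hp : ∀ a b, σ.lt a b → ∃ p, σ.lt p b ∧ T.Adj p b) {r : V} (hr : IsFirst σ Set.univ r) (x : V) :
    ∃ w : T.Walk x r, w.IsPath ∧ ∀ y ∈ w.support, σ.le y x := by
  induction x using WellFoundedLT.induction with
  | ind x ih =>
    by_cases hx : x = r
    · subst hx
      exact ⟨.nil, by simp, by simp⟩
    · obtain ⟨p, hpx, hadj⟩ := hp r x (lt_of_le_of_ne (hr.2 x trivial) (Ne.symm hx))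
      obtain ⟨w, hw, hle⟩ := ih p hpx
      refine ⟨.cons hadj.symm w, ?_, ?_⟩
      · rw [SimpleGraph.Walk.cons_isPath_iff]
        exact ⟨hw, fun hmem => absurd (hle x hmem) (not_le.2 hpx)⟩
      · intro y hy
        rw [SimpleGraph.Walk.support_cons, List.mem_cons] at hy
        rcases hy with rfl | hy
        · exact le_rfl
        · exact (hle y hy).trans hpx.le

theorem IsNestedTree.isTree {V : Type u} [Finite V] [Nonempty V] {σ : LinearOrder V}
    {T : SimpleGraph V} (h : IsNestedTree σ T) : T.IsTree := by
  obtain ⟨r, hr⟩ := exists_isFirst_univ σ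
  have hconn : T.Connected := by
    rw [SimpleGraph.connected_iff_exists_forall_reachable]
    refine ⟨r, fun x => ?_⟩
    obtain ⟨w, -⟩ := exists_path_to_first h.exists_parent hr x
    exact w.reachable.symm
  refine isTree_of_connected_of_orientation hconn (fun v y => σ.lt y v ∧ T.Adj y v) r
    (fun y hy => absurd (hr.2 y trivial) (not_le.2 hy.1))
    (fun v y z hy hz => h.parent_unique y z v hy.1 hz.1 hy.2 hz.2) (fun v y hvy => ?_)
  rcases lt_or_gt_of_ne hvy.ne with h' | h'
  · exact Or.inr ⟨h', hvy⟩
  · exact Or.inl ⟨h', hvy.symm⟩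

/-- The nesting condition is the interval form of a DFS-ordering; the point is that in a tree it
forces parents to exist and to be unique. -/
theorem isNestedTree_iff {V : Type u} [Finite V] [Nonempty V] (σ : LinearOrder V)
    (T : SimpleGraph V) : IsNestedTree σ T ↔ T.IsTree ∧ IsDFSOrdering T σ := by
  rw [isDFSOrdering_iff]
  refine ⟨fun h => ⟨h.isTree, h.nested⟩, fun ⟨hT, hn⟩ => ?_⟩
  have hp : ∀ a b, σ.lt a b → ∃ p, σ.lt p b ∧ T.Adj p b := by
    intro a b hab
    obtain ⟨w⟩ := hT.connected.preconnected a b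
    -- A walk from `a` to `b` must leave the set of vertices before `b`. The leaving edge either
    -- ends in `b` or jumps over `b`, and in the second case nesting supplies an earlier neighbour
    -- of `b`.
    obtain ⟨d, -, h1, h2⟩ := w.exists_boundary_dart {x | σ.lt x b} hab (lt_irrefl b)
    have h1' : σ.lt d.fst b := h1
    rcases eq_or_lt_of_le (not_lt.1 h2 : σ.le b d.snd) with h3 | h3
    · exact ⟨d.fst, h1, by rw [h3]; exact d.adj⟩
    · obtain ⟨q, -, hq, hqb⟩ := hn d.fst b d.snd h1' h3 d.adj
      exact ⟨q, hq, hqb⟩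
  refine ⟨hp, fun p q b hpb hqb hp' hq' => ?_, hn⟩
  obtain ⟨r, hr⟩ := exists_isFirst_univ σ
  obtain ⟨w, hw, hwle⟩ := exists_path_to_first hp hr p
  obtain ⟨w', hw', hwle'⟩ := exists_path_to_first hp hr q
  have h1 : (SimpleGraph.Walk.cons hp'.symm w).IsPath := by
    rw [SimpleGraph.Walk.cons_isPath_iff]
    exact ⟨hw, fun hmem => absurd (hwle b hmem) (not_le.2 hpb)⟩
  have h2 : (SimpleGraph.Walk.cons hq'.symm w').IsPath := by
    rw [SimpleGraph.Walk.cons_isPath_iff]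
    exact ⟨hw', fun hmem => absurd (hwle' b hmem) (not_le.2 hqb)⟩
  have h3 := (hT.existsUnique_path b r).unique h1 h2
  -- Two earlier neighbours of `b` would give two paths from `b` to the first vertex; comparing
  -- their second vertices yields `p = q`.
  have h4 := congrArg (fun w => w.getVert 1) h3
  simpa using h4

theorem isDFSTreeSupport_iff {V : Type u} [Finite V] [Nonempty V] {Φ : Set (LinearOrder V)}
    (hΦ : Φ.Nonempty) (T : SimpleGraph V) :
    IsDFSTreeSupport Φ T ↔ ∀ σ ∈ Φ, IsNestedTree σ T := by
  constructor
  · exact fun h σ hσ => (isNestedTree_iff σ T).2 ⟨h.1, h.2 σ hσ⟩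
  · intro h
    obtain ⟨σ, hσ⟩ := hΦ
    exact ⟨(h σ hσ).isTree, fun τ hτ => ((isNestedTree_iff τ T).1 (h τ hτ)).2⟩

/-! ## Structure of attachment digraphs -/

/-- `Attach Φ S X`: the loop that builds the attachment digraph, started with working set `S`,
adds exactly the arcs in `X`. -/
inductive Attach {V : Type u} (Φ : Set (LinearOrder V)) : Set V → Set (V × V) → Prop
  | step (S : Set V) (X : Set (V × V)) (hS : 3 ≤ S.ncard) (h : Attach Φ (S \ bottoms Φ S) X) :
      Attach Φ S (newArcs Φ S ∪ X)
  | last (a b : V) (hab : a ≠ b) : Attach Φ {a, b} {(a, b)}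
  | done (S : Set V) (hS : S.ncard ≤ 1) : Attach Φ S ∅

section Attach

variable {V : Type u} {Φ : Set (LinearOrder V)}

/-- The accumulated arcs never influence the loop, so they can be split off. Inductions then speak
only of the arcs added from the working set `S` on. -/
theorem attachmentLoop_iff {S : Set V} {A A' : Set (V × V)} :
    AttachmentLoop Φ S A A' ↔ ∃ X, Attach Φ S X ∧ A' = A ∪ X := by
  constructor
  · intro h
    induction h with
    | step S A A' hS _ ih =>
      obtain ⟨X, hX, rfl⟩ := ih
      exact ⟨_, .step S X hS hX, Set.union_assoc _ _ _⟩
    | last a b A hab => exact ⟨_, .last a b hab, rfl⟩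
    | done S A hS => exact ⟨_, .done S hS, by simp⟩
  · rintro ⟨X, hX, rfl⟩
    induction hX generalizing A with
    | step S X hS _ ih =>
      refine .step S A _ hS ?_
      rw [← Set.union_assoc]
      exact ih
    | last a b hab => exact .last a b A hab
    | done S hS => rw [Set.union_empty]; exact .done S A hS

theorem isAttachmentDigraph_iff {A : Set (V × V)} :
    IsAttachmentDigraph Φ A ↔ Attach Φ Set.univ A := by
  simp [IsAttachmentDigraph, attachmentLoop_iff]

theorem exists_isFirst [Finite V] (σ : LinearOrder V) {S : Set V} (hS : S.Nonempty) :
    ∃ r, IsFirst σ S r := by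
  obtain ⟨r, hr, h⟩ := Set.exists_min_image S id (Set.toFinite S) hS
  exact ⟨r, hr, h⟩

theorem exists_isLast [Finite V] (σ : LinearOrder V) {S : Set V} (hS : S.Nonempty) :
    ∃ r, IsLast σ S r := by
  obtain ⟨r, hr, h⟩ := Set.exists_max_image S id (Set.toFinite S) hS
  exact ⟨r, hr, h⟩

theorem bottoms_subset (S : Set V) : bottoms Φ S ⊆ S := fun _ ⟨_, _, h⟩ => h.1

theorem ncard_diff_bottoms_lt [Finite V] (hΦ : Φ.Nonempty) {S : Set V} (hS : S.Nonempty) :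
    (S \ bottoms Φ S).ncard < S.ncard := by
  obtain ⟨σ, hσ⟩ := hΦ
  obtain ⟨r, hr⟩ := exists_isLast σ hS
  refine Set.ncard_lt_ncard ⟨Set.sdiff_subset, fun h => ?_⟩ (Set.toFinite _)
  exact (h hr.1).2 ⟨σ, hσ, hr⟩

theorem exists_attach [Finite V] (hΦ : Φ.Nonempty) (S : Set V) : ∃ X, Attach Φ S X := by
  induction hn : S.ncard using Nat.strong_induction_on generalizing S with
  | _ n ih =>
    subst hn
    by_cases h3 : 3 ≤ S.ncard
    · have hne : S.Nonempty := Set.nonempty_of_ncard_ne_zero (by omega)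
      obtain ⟨X, hX⟩ := ih _ (ncard_diff_bottoms_lt hΦ hne) _ rfl
      exact ⟨_, .step S X h3 hX⟩
    · by_cases h2 : S.ncard = 2
      · obtain ⟨a, b, hab, rfl⟩ := Set.ncard_eq_two.1 h2
        exact ⟨_, .last a b hab⟩
      · exact ⟨_, .done S (by omega)⟩

theorem blockers_subset (σ : LinearOrder V) (S : Set V) (x : V) : blockers σ S x ⊆ S := by
  rintro y (⟨_, z, _, hy⟩ | ⟨_, hy, _⟩)
  · exact hy.1.1
  · exact hy

theorem IsFirst.unique {σ : LinearOrder V} {S : Set V} {x y : V} (hx : IsFirst σ S x)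
    (hy : IsFirst σ S y) : x = y :=
  le_antisymm (hx.2 y hy.1) (hy.2 x hx.1)

theorem IsSecond.unique {σ : LinearOrder V} {S : Set V} {x y : V} (hx : IsSecond σ S x)
    (hy : IsSecond σ S y) : x = y := by
  obtain ⟨a, ha, hx⟩ := hx
  obtain ⟨b, hb, hy⟩ := hy
  obtain rfl := ha.unique hb
  exact hx.unique hy

theorem newArcs_subset (hΦ : Φ.Nonempty) {S : Set V} {v y : V} (h : (v, y) ∈ newArcs Φ S) :
    v ∈ S ∧ y ∈ S := by
  obtain ⟨σ, hσ⟩ := hΦ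
  exact ⟨bottoms_subset S h.1, blockers_subset σ S v (h.2 σ hσ)⟩

theorem Attach.mem (hΦ : Φ.Nonempty) {S : Set V} {X : Set (V × V)} (h : Attach Φ S X) :
    ∀ v y, (v, y) ∈ X → v ∈ S ∧ y ∈ S := by
  induction h with
  | step S X hS _ ih =>
    rintro v y (hvy | hvy)
    · exact newArcs_subset hΦ hvy
    · exact ⟨(ih v y hvy).1.1, (ih v y hvy).2.1⟩
  | last a b hab =>
    rintro v y hvy
    obtain ⟨rfl, rfl⟩ := Prod.mk.inj (Set.mem_singleton_iff.1 hvy)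
    simp
  | done S hS => simp

/-- Two different outneighbours of a vertex precede it in every ordering. -/
theorem Attach.lt_of_ne (hΦ : Φ.Nonempty) {S : Set V} {X : Set (V × V)} (h : Attach Φ S X)
    {σ : LinearOrder V} (hσ : σ ∈ Φ) {v y z : V} (hy : (v, y) ∈ X) (hz : (v, z) ∈ X)
    (hyz : y ≠ z) : σ.lt y v := by
  induction h with
  | step S X hS hX ih =>
    have hmem := hX.mem hΦ
    rcases hy with hy | hy <;> rcases hz with hz | hz
    · rcases hy.2 σ hσ with ⟨h1, h2⟩ | ⟨h1, h2, h3⟩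
      · rcases hz.2 σ hσ with ⟨h1', h2'⟩ | ⟨h1', h2', h3'⟩
        · exact absurd (h2.unique h2') hyz
        · exact absurd h1 h1'
      · exact h3
    · exact absurd hy.1 (hmem _ _ hz).1.2
    · exact absurd hz.1 (hmem _ _ hy).1.2
    · exact ih hy hz
  | last a b hab =>
    have h1 := (Prod.mk.inj (Set.mem_singleton_iff.1 hy)).2
    have h2 := (Prod.mk.inj (Set.mem_singleton_iff.1 hz)).2
    exact absurd (h1.trans h2.symm) hyz
  | done S hS => exact absurd hy (Set.notMem_empty _)

/-- The outneighbours of forced vertices are forced. -/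
theorem Attach.forced_of_arc (hΦ : Φ.Nonempty) {S : Set V} {X : Set (V × V)} (h : Attach Φ S X) :
    ∀ u v, (u, v) ∈ X → u ∈ forced X → v ∈ forced X := by
  induction h with
  | step S X hS hX ih =>
    have hmem := hX.mem hΦ
    have hst := Attach.step S X hS hX
    rintro u v (huv | huv) hu
    · by_contra hv
      simp only [forced, Set.mem_ofPred_eq, Set.not_subsingleton_iff] at hv
      obtain ⟨y, hy, z, hz, hyz⟩ := hv
      simp only [Set.mem_ofPred_eq] at hy hz
      have hyS := (hst.mem hΦ v y hy).2
      have hzS := (hst.mem hΦ v z hz).2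
      -- Whatever precedes `v` in every ordering also precedes `u`, and so blocks it. Two
      -- outneighbours of `v` would thus be two outneighbours of the forced vertex `u`.
      have key : ∀ w ∈ S, (∀ σ ∈ Φ, σ.lt w v) → (u, w) ∈ newArcs Φ S := by
        refine fun w hw hwv => ⟨huv.1, fun σ hσ => ?_⟩
        -- If `u` is first in `S`, then `v` is second and only `u` precedes it, which leaves no room
        -- for both `y` and `z`.
        rcases huv.2 σ hσ with ⟨h1, h2⟩ | ⟨h1, h2, h3⟩
        · exfalso
          obtain ⟨u', hu', h2⟩ := h2
          obtain rfl := h1.unique hu'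
          have hy1 := hst.lt_of_ne hΦ hσ hy hz hyz
          have hz1 := hst.lt_of_ne hΦ hσ hz hy hyz.symm
          have : ∀ w ∈ S, σ.lt w v → w = u := by
            intro w hw hwv
            by_contra hne
            exact absurd (h2.2 w ⟨hw, hne⟩) (not_le.2 hwv)
          exact hyz ((this y hyS hy1).trans (this z hzS hz1).symm)
        · exact Or.inr ⟨h1, hw, lt_trans (hwv σ hσ) h3⟩
      refine hyz (hu (Or.inl (key y hyS fun σ hσ => ?_)) (Or.inl (key z hzS fun σ hσ => ?_)))
      · exact hst.lt_of_ne hΦ hσ hy hz hyz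
      · exact hst.lt_of_ne hΦ hσ hz hy hyz.symm
    · have h1 := ih u v huv (hu.anti fun y hy => Or.inr hy)
      -- The vertex `v` survives this pass, so all its arcs are added in later passes.
      have hv := (hmem u v huv).2
      intro y hy z hz
      rcases hy with hy | hy
      · exact absurd hy.1 hv.2
      rcases hz with hz | hz
      · exact absurd hz.1 hv.2
      exact h1 hy hz
  | last a b hab =>
    intro u v huv _ y hy z hz
    have h1 := (Prod.mk.inj (Set.mem_singleton_iff.1 hy)).2
    have h2 := (Prod.mk.inj (Set.mem_singleton_iff.1 hz)).2
    exact h1.trans h2.symm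
  | done S hS => simp

/-- A target precedes the source or is the second element after it. In the second case being also
last would leave only two elements, which is where `3 ≤ S.ncard` enters. -/
theorem newArcs_source_ne_target {S : Set V} (hS : 3 ≤ S.ncard) {v y : V}
    (h : (v, y) ∈ newArcs Φ S) : y ∉ bottoms Φ S := by
  rintro ⟨σ, hσ, hy⟩
  have hv := bottoms_subset S h.1
  rcases h.2 σ hσ with ⟨h1, z, hz, h2⟩ | ⟨h1, h2, h3⟩
  · obtain rfl := h1.unique hz
    have hsub : S ⊆ {v, y} := by
      intro w hw
      by_cases hwv : w = v
      · exact Or.inl hwv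
      · exact Or.inr (le_antisymm (hy.2 w hw) (h2.2 w ⟨hw, hwv⟩))
    have := (Set.ncard_le_ncard hsub (Set.toFinite _)).trans (Set.ncard_insert_le v {y})
    rw [Set.ncard_singleton] at this
    omega
  · exact absurd (hy.2 v hv) (not_le.2 h3)

/-- A sink among the surviving vertices stays a sink. If nothing survives a pass, that pass adds no
arcs, because targets survive. The sink serves as the root when edges are counted. -/
theorem Attach.exists_sink (hΦ : Φ.Nonempty) {S : Set V} {X : Set (V × V)} (h : Attach Φ S X)
    (hS : S.Nonempty) : ∃ r ∈ S, ∀ y, (r, y) ∉ X := by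
  induction h with
  | step S X h3 hX ih =>
    have hmem := hX.mem hΦ
    by_cases hne : (S \ bottoms Φ S).Nonempty
    · obtain ⟨r, hr, h⟩ := ih hne
      refine ⟨r, hr.1, fun y hy => ?_⟩
      rcases hy with hy | hy
      · exact hr.2 hy.1
      · exact h y hy
    · obtain ⟨r, hr⟩ := hS
      refine ⟨r, hr, fun y hy => ?_⟩
      rcases hy with hy | hy
      · exact hne ⟨y, (newArcs_subset hΦ hy).2, newArcs_source_ne_target h3 hy⟩
      · exact hne ⟨r, (hmem r y hy).1⟩
  | last a b hab =>
    refine ⟨b, by simp, fun y hy => hab ?_⟩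
    exact ((Prod.mk.inj (Set.mem_singleton_iff.1 hy)).1).symm
  | done S _ => exact ⟨hS.some, hS.some_mem, fun y => Set.notMem_empty _⟩

/-- Every vertex of `S` but the first has an earlier neighbour in `S`. -/
def IsParentClosed (σ : LinearOrder V) (T : SimpleGraph V) (S : Set V) : Prop :=
  ∀ a ∈ S, ∀ v ∈ S, σ.lt a v → ∃ u ∈ S, σ.lt u v ∧ T.Adj u v

/-- The last element of `S` in some ordering has exactly one neighbour in `S`, and this neighbour
is the target of one of the arcs that are added. -/
theorem neighbor_of_mem_bottoms {T : SimpleGraph V} (hT : ∀ σ ∈ Φ, IsNestedTree σ T) {S : Set V}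
    (hK : ∀ σ ∈ Φ, IsParentClosed σ T S) {v : V} (hv : v ∈ bottoms Φ S)
    (hS : ∃ a ∈ S, a ≠ v) : ∃ y ∈ S, T.Adj y v ∧ ∀ z ∈ S, T.Adj z v → z = y := by
  obtain ⟨σ, hσ, hvS, hv⟩ := hv
  obtain ⟨a, ha, hav⟩ := hS
  obtain ⟨u, hu, huv, hadj⟩ := hK σ hσ a ha v hvS (lt_of_le_of_ne (hv a ha) hav)
  refine ⟨u, hu, hadj, fun z hz hzv => (hT σ hσ).parent_unique z u v ?_ huv hzv hadj⟩
  exact lt_of_le_of_ne (hv z hz) hzv.ne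

/-- If the first element of `S` has only one neighbour in `S`, this neighbour is the second
element of `S`. -/
theorem IsParentClosed.second [Finite V] {T : SimpleGraph V} {σ : LinearOrder V} {S : Set V}
    (hK : IsParentClosed σ T S) {u y : V} (hu : IsFirst σ S u) (hy : y ∈ S) (hadj : T.Adj y u)
    (huniq : ∀ z ∈ S, T.Adj z u → z = y) : IsSecond σ S y := by
  obtain ⟨z, hz⟩ := exists_isFirst σ (S := S \ {u}) ⟨y, hy, hadj.ne⟩
  obtain ⟨p, hp, hpz, hpadj⟩ := hK u hu.1 z hz.1.1
    (lt_of_le_of_ne (hu.2 z hz.1.1) (Ne.symm hz.1.2))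
  have hpu : p = u := by
    by_contra hpu
    exact absurd (hz.2 p ⟨hp, hpu⟩) (not_le.2 hpz)
  subst hpu
  obtain rfl := huniq z hz.1.1 hpadj.symm
  exact ⟨p, hu, hz⟩

/-- Suppose the parent `u` of a surviving `v` is removed. Being last somewhere, `u` has no neighbour
in `S` except `v`, which comes later here; so `u` is first in `S` and `v` second. Then no surviving
vertex precedes `v`, and no parent is required. -/
theorem isParentClosed_diff_bottoms [Finite V] {T : SimpleGraph V}
    (hT : ∀ σ ∈ Φ, IsNestedTree σ T) {S : Set V} (hK : ∀ σ ∈ Φ, IsParentClosed σ T S) :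
    ∀ σ ∈ Φ, IsParentClosed σ T (S \ bottoms Φ S) := by
  intro σ hσ a ha v hv hav
  obtain ⟨u, hu, huv, hadj⟩ := hK σ hσ a ha.1 v hv.1 hav
  by_cases hub : u ∈ bottoms Φ S
  · exfalso
    obtain ⟨y, hy, hyu, huniq⟩ := neighbor_of_mem_bottoms hT hK hub ⟨v, hv.1, hadj.ne'⟩
    obtain rfl := huniq v hv.1 hadj.symm
    have hfirst : ∀ w ∈ S, σ.le u w := by
      intro w hw
      by_contra hwu
      obtain ⟨p, hp, hpu, hpadj⟩ := hK σ hσ w hw u hu (not_le.1 hwu)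
      obtain rfl := huniq p hp hpadj
      exact lt_asymm hpu huv
    obtain ⟨u', hu', h⟩ := (hK σ hσ).second ⟨hu, hfirst⟩ hy hyu huniq
    obtain rfl := hu'.unique ⟨hu, hfirst⟩
    exact absurd (h.2 a ⟨ha.1, fun h => ha.2 (h ▸ hub)⟩) (not_le.2 hav)
  · exact ⟨u, ⟨hu, hub⟩, huv, hadj⟩

/-- In each ordering the single remaining neighbour of `u` is its parent, or `u` is first and the
neighbour is second. Either way it is a blocker; this explains the special case in the definition of
`blockers`. -/
theorem mem_newArcs_of_adj [Finite V] {T : SimpleGraph V}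
    (hT : ∀ σ ∈ Φ, IsNestedTree σ T) {S : Set V} (hK : ∀ σ ∈ Φ, IsParentClosed σ T S) {u v : V}
    (hu : u ∈ bottoms Φ S) (hv : v ∈ S) (hadj : T.Adj v u) : (u, v) ∈ newArcs Φ S := by
  obtain ⟨y, hy, hyu, huniq⟩ := neighbor_of_mem_bottoms hT hK hu ⟨v, hv, hadj.ne⟩
  obtain rfl := huniq v hv hadj
  have huS := bottoms_subset S hu
  refine ⟨hu, fun σ hσ => ?_⟩
  by_cases hfirst : IsFirst σ S u
  · exact Or.inl ⟨hfirst, (hK σ hσ).second hfirst hv hadj huniq⟩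
  · obtain ⟨w, hw, hwu⟩ : ∃ w ∈ S, σ.lt w u := by
      by_contra! hcon
      exact hfirst ⟨huS, fun w hw => hcon w hw⟩
    obtain ⟨p, hp, hpu, hpadj⟩ := hK σ hσ w hw u huS hwu
    obtain rfl := huniq p hp hpadj
    exact Or.inr ⟨hfirst, hv, hpu⟩

/-- An edge of `T` becomes an arc in the pass that first removes one of its endpoints, or as the
final arc. -/
theorem Attach.mem_of_adj [Finite V] {T : SimpleGraph V} (hT : ∀ σ ∈ Φ, IsNestedTree σ T)
    {S : Set V} {X : Set (V × V)} (h : Attach Φ S X) (hK : ∀ σ ∈ Φ, IsParentClosed σ T S) :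
    ∀ u ∈ S, ∀ v ∈ S, T.Adj u v → (u, v) ∈ X ∨ (v, u) ∈ X := by
  induction h with
  | step S X h3 hX ih =>
    intro u hu v hv hadj
    by_cases hub : u ∈ bottoms Φ S
    · exact Or.inl (Or.inl (mem_newArcs_of_adj hT hK hub hv hadj.symm))
    by_cases hvb : v ∈ bottoms Φ S
    · exact Or.inr (Or.inl (mem_newArcs_of_adj hT hK hvb hu hadj))
    rcases ih (isParentClosed_diff_bottoms hT hK) u ⟨hu, hub⟩ v ⟨hv, hvb⟩ hadj with h | h
    · exact Or.inl (Or.inr h)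
    · exact Or.inr (Or.inr h)
  | last a b hab =>
    rintro u (rfl | rfl) v (rfl | rfl) hadj
    · exact absurd rfl hadj.ne
    · exact Or.inl rfl
    · exact Or.inr rfl
    · exact absurd rfl hadj.ne
  | done S hS =>
    intro u hu v hv hadj
    exact absurd ((Set.ncard_le_one_iff (Set.toFinite S)).1 hS hu hv) hadj.ne

/-- A removed vertex always has an arc to its neighbour in `T`. If it has only one arc, this is the
one. -/
theorem Attach.adj_of_mem [Finite V] (hΦ : Φ.Nonempty) {T : SimpleGraph V}
    (hT : ∀ σ ∈ Φ, IsNestedTree σ T) {S : Set V} {X : Set (V × V)} (h : Attach Φ S X)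
    (hK : ∀ σ ∈ Φ, IsParentClosed σ T S) : ∀ u y, (u, y) ∈ X → u ∈ forced X → T.Adj u y := by
  induction h with
  | step S X h3 hX ih =>
    rintro u y (huy | huy) hu
    · have : ∃ a ∈ S, a ≠ u := by
        by_contra! hcon
        have := (Set.ncard_le_one_iff (Set.toFinite S)).2
          (fun {a b} ha hb => (hcon a ha).trans (hcon b hb).symm)
        omega
      obtain ⟨z, hz, hzu, -⟩ := neighbor_of_mem_bottoms hT hK huy.1 this
      have hz' := mem_newArcs_of_adj hT hK huy.1 hz hzu
      obtain rfl := hu (Or.inl hz') (Or.inl huy)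
      exact hzu.symm
    · exact ih (isParentClosed_diff_bottoms hT hK) u y huy (hu.anti fun y hy => Or.inr hy)
  | last a b hab =>
    intro u y huy _
    obtain ⟨rfl, rfl⟩ := Prod.mk.inj (Set.mem_singleton_iff.1 huy)
    obtain ⟨σ, hσ⟩ := hΦ
    rcases lt_or_gt_of_ne hab with h | h
    -- For two remaining vertices, the later one has its parent among them, so they are adjacent in
    -- `T` in whichever direction the final arc was drawn.
    · obtain ⟨p, rfl | rfl, hp, hadj⟩ := hK σ hσ u (by simp) y (by simp) h
      · exact hadj
      · exact absurd rfl hadj.ne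
    · obtain ⟨p, rfl | rfl, hp, hadj⟩ := hK σ hσ y (by simp) u (by simp) h
      · exact absurd rfl hadj.ne
      · exact hadj.symm
  | done S hS => simp

end Attach

/-! ## The attachment graph -/

section AttachmentGraph

variable {V : Type u} {Φ : Set (LinearOrder V)} {A : Set (V × V)}

theorem exists_isAttachmentDigraph [Finite V] (hΦ : Φ.Nonempty) :
    ∃ A, IsAttachmentDigraph Φ A := by
  simpa [isAttachmentDigraph_iff] using exists_attach hΦ Set.univ

/-- In every ordering, a free vertex is preceded by a vertex. -/
theorem exists_lt_of_free (hΦ : Φ.Nonempty) (hA : IsAttachmentDigraph Φ A) {v : V}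
    (hv : v ∉ forced A) {σ : LinearOrder V} (hσ : σ ∈ Φ) : ∃ y, σ.lt y v := by
  simp only [forced, Set.mem_ofPred_eq, Set.not_subsingleton_iff] at hv
  obtain ⟨y, hy, z, hz, hyz⟩ := hv
  exact ⟨y, (isAttachmentDigraph_iff.1 hA).lt_of_ne hΦ hσ hy hz hyz⟩

theorem IsFirst.mem_forced (hΦ : Φ.Nonempty) (hA : IsAttachmentDigraph Φ A) {σ : LinearOrder V}
    (hσ : σ ∈ Φ) {r : V} (hr : IsFirst σ Set.univ r) : r ∈ forced A := by
  by_contra h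
  obtain ⟨y, hy⟩ := exists_lt_of_free hΦ hA h hσ
  exact absurd (hr.2 y trivial) (not_le.2 hy)

/-- The target of an arc out of a free vertex precedes the vertex in every ordering. -/
theorem lt_of_arc_of_free (hΦ : Φ.Nonempty) (hA : IsAttachmentDigraph Φ A) {v y : V}
    (hv : v ∉ forced A) (hy : (v, y) ∈ A) {σ : LinearOrder V} (hσ : σ ∈ Φ) : σ.lt y v := by
  simp only [forced, Set.mem_ofPred_eq, Set.not_subsingleton_iff] at hv
  obtain ⟨a, ha, b, hb, hab⟩ := hv
  have h := isAttachmentDigraph_iff.1 hA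
  by_cases hya : y = a
  · subst hya
    exact h.lt_of_ne hΦ hσ ha hb hab
  · exact h.lt_of_ne hΦ hσ hy ha hya

/-- When all vertices are forced, the arcs orient the graph with outdegree at most one, and the sink
has outdegree zero. No support is assumed: this is the soundness of the all-forced branch. -/
theorem isTree_of_forced_eq_univ [Finite V] [Nonempty V] (hΦ : Φ.Nonempty)
    (hA : IsAttachmentDigraph Φ A) (hc : (underlyingGraph A).Connected)
    (hF : forced A = Set.univ) : (underlyingGraph A).IsTree := by
  obtain ⟨r, -, hr⟩ := (isAttachmentDigraph_iff.1 hA).exists_sink hΦ Set.univ_nonempty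
  refine isTree_of_connected_of_orientation hc (fun v y => (v, y) ∈ A) r hr
    (fun v y z hy hz => ?_) (fun v y h => ?_)
  · have hv : v ∈ forced A := hF ▸ Set.mem_univ v
    exact hv hy hz
  · simpa [underlyingGraph] using (SimpleGraph.fromRel_adj _ _ _ |>.1 h).2

/-! ### Consequences of the existence of a support -/

section Support

theorem isParentClosed_univ {T : SimpleGraph V} (hT : ∀ σ ∈ Φ, IsNestedTree σ T) : ∀ σ ∈ Φ, IsParentClosed σ T Set.univ := by
  intro σ hσ a _ v _ hav
  obtain ⟨p, hp, hadj⟩ := (hT σ hσ).exists_parent a v hav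
  exact ⟨p, trivial, hp, hadj⟩

variable [Finite V] {T : SimpleGraph V} (hΦ : Φ.Nonempty)
  (hT : ∀ σ ∈ Φ, IsNestedTree σ T) (hA : IsAttachmentDigraph Φ A)

include hT hA in
theorem arc_of_adj {u v : V} (h : T.Adj u v) : (u, v) ∈ A ∨ (v, u) ∈ A :=
  (isAttachmentDigraph_iff.1 hA).mem_of_adj hT (isParentClosed_univ hT) u trivial v trivial h

include hT hA in
theorem le_underlyingGraph : T ≤ underlyingGraph A :=
  fun _ _ h => (SimpleGraph.fromRel_adj _ _ _).2 ⟨h.ne, arc_of_adj hT hA h⟩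

include hΦ hT hA in
theorem connected_underlyingGraph [Nonempty V] : (underlyingGraph A).Connected := by
  obtain ⟨σ, hσ⟩ := hΦ
  exact (hT σ hσ).isTree.connected.mono (le_underlyingGraph hT hA)

include hΦ hT hA in
-- An edge between forced vertices comes from an arc out of a forced vertex, hence lies in `T`;
-- conversely all edges of `T` lie in the attachment graph. In particular, all supports agree on the
-- forced vertices.
theorem starTree_eq : starTree A = T.induce (forced A) := by
  ext u v
  have hX := isAttachmentDigraph_iff.1 hA
  have hK := isParentClosed_univ hT
  constructor
  · intro h
    rcases (SimpleGraph.fromRel_adj (fun v y => (v, y) ∈ A) (u : V) v).1 h with ⟨-, h | h⟩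
    · exact hX.adj_of_mem hΦ hT hK _ _ h u.2
    · exact (hX.adj_of_mem hΦ hT hK _ _ h v.2).symm
  · exact fun h => le_underlyingGraph hT hA h

include hΦ hT hA in
/-- Parents of forced vertices are forced. -/
theorem mem_forced_of_parent {σ : LinearOrder V} (hσ : σ ∈ Φ) {u v : V} (huv : σ.lt u v)
    (hadj : T.Adj u v) (hv : v ∈ forced A) : u ∈ forced A := by
  have hX := isAttachmentDigraph_iff.1 hA
  rcases arc_of_adj hT hA hadj with h | h
  · by_contra hu
    exact lt_asymm huv (lt_of_arc_of_free hΦ hA hu h hσ)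
  · exact hX.forced_of_arc hΦ v u h hv

include hΦ hT hA in
/-- The parent of a free vertex is the same in all orderings. -/
theorem lt_of_parent_of_free {σ τ : LinearOrder V} (hσ : σ ∈ Φ) (hτ : τ ∈ Φ) {u v : V}
    (huv : σ.lt u v) (hadj : T.Adj u v) (hv : v ∉ forced A) : τ.lt u v := by
  have hX := isAttachmentDigraph_iff.1 hA
  rcases arc_of_adj hT hA hadj with h | h
  · exfalso
    by_cases hu : u ∈ forced A
    · exact hv (hX.forced_of_arc hΦ u v h hu)
    · exact @lt_asymm V σ.toPreorder _ _ huv (lt_of_arc_of_free hΦ hA hu h hσ)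
  · exact lt_of_arc_of_free hΦ hA hv h hτ

include hΦ hT hA in
-- Restricting a nested tree to a set closed under parents keeps it nested.
theorem isNestedTree_starTree {σ : LinearOrder V} (hσ : σ ∈ Φ) :
    IsNestedTree (restrictOrder (forced A) σ) (starTree A) := by
  rw [starTree_eq hΦ hT hA]
  refine ⟨fun a b hab => ?_, fun p q b hp hq hpa hqa => ?_, fun p b c hpb hbc hpc => ?_⟩
  · obtain ⟨p, hp, hadj⟩ := (hT σ hσ).exists_parent a b hab
    exact ⟨⟨p, mem_forced_of_parent hΦ hT hA hσ hp hadj b.2⟩, hp, hadj⟩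
  · exact Subtype.ext ((hT σ hσ).parent_unique p q b (show σ.lt p b from hp)
      (show σ.lt q b from hq) hpa hqa)
  · obtain ⟨q, hpq, hqb, hadj⟩ := (hT σ hσ).nested p b c hpb hbc hpc
    exact ⟨⟨q, mem_forced_of_parent hΦ hT hA hσ hqb hadj b.2⟩, hpq, hqb, hadj⟩

end Support

end AttachmentGraph

/-! ## Ancestors, paths and distances in nested trees -/

/-- In a nested tree, `q` is an ancestor of `g`, or equal to it. -/
def IsAncestor {W : Type u} (σ : LinearOrder W) (T : SimpleGraph W) (q g : W) : Prop :=
  σ.le q g ∧ ∀ p b, σ.lt q b → σ.le b g → σ.lt p b → T.Adj p b → σ.le q p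

section Ancestors

variable {W : Type u} {σ : LinearOrder W} {T : SimpleGraph W}

theorem IsAncestor.refl (g : W) : IsAncestor σ T g g :=
  ⟨le_rfl, fun _ _ h h' => absurd h (not_lt.2 h')⟩

/-- Ancestry is a condition on an interval of the ordering: after `a` and up to `c`, no parent
precedes `a`. The interval is split at `b`. -/
theorem IsAncestor.trans {a b c : W} (h : IsAncestor σ T a b) (h' : IsAncestor σ T b c) :
    IsAncestor σ T a c := by
  refine ⟨h.1.trans h'.1, fun p d had hdc hpd hadj => ?_⟩
  rcases le_or_gt d b with hdb | hdb
  · exact h.2 p d had hdb hpd hadj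
  · exact h.1.trans (h'.2 p d hdb hdc hpd hadj)

theorem IsAncestor.of_le {a b c : W} (h : IsAncestor σ T a c) (hab : σ.le a b) (hbc : σ.le b c) :
    IsAncestor σ T a b :=
  ⟨hab, fun p d had hdb => h.2 p d had (hdb.trans hbc)⟩

theorem IsNestedTree.isAncestor_parent (h : IsNestedTree σ T) {p c : W} (hpc : σ.lt p c)
    (hadj : T.Adj p c) : IsAncestor σ T p c := by
  refine ⟨hpc.le, fun q b hpb hbc hqb hqadj => ?_⟩
  rcases eq_or_lt_of_le hbc with rfl | hbc
  · exact (h.parent_unique p q b hpc hqb hadj hqadj).le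
  · obtain ⟨q', h1, h2, h3⟩ := h.nested p b c hpb hbc hadj
    obtain rfl := h.parent_unique q q' b hqb h2 hqadj h3
    exact h1

/-- Climb from `g` through parents. The interval condition at `g` itself keeps each parent at or
after `w`, so the climb cannot jump over `w`, and it meets precisely the ancestors of `g` from `w`
on. -/
theorem IsNestedTree.exists_path_of_isAncestor [Finite W] (h : IsNestedTree σ T) {w g : W}
    (hw : IsAncestor σ T w g) :
    ∃ p : T.Walk g w, p.IsPath ∧ ∀ q, q ∈ p.support ↔ σ.le w q ∧ IsAncestor σ T q g := by
  induction g using WellFoundedLT.induction with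
  | ind g ih =>
    rcases eq_or_lt_of_le hw.1 with rfl | hlt
    · refine ⟨.nil, by simp, fun q => ?_⟩
      rw [SimpleGraph.Walk.support_nil, List.mem_singleton]
      exact ⟨fun hq => hq ▸ ⟨le_rfl, .refl _⟩, fun hq => le_antisymm hq.2.1 hq.1⟩
    · obtain ⟨p, hpg, hadj⟩ := h.exists_parent w g hlt
      have hwp := hw.2 p g hlt le_rfl hpg hadj
      obtain ⟨P, hP, hsupp⟩ := ih p hpg (hw.of_le hwp hpg.le)
      refine ⟨.cons hadj.symm P, ?_, fun q => ?_⟩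
      · rw [SimpleGraph.Walk.cons_isPath_iff, hsupp]
        exact ⟨hP, fun hmem => absurd hmem.2.1 (not_le.2 hpg)⟩
      · rw [SimpleGraph.Walk.support_cons, List.mem_cons, hsupp]
        constructor
        · rintro (rfl | ⟨h1, h2⟩)
          · exact ⟨hw.1, .refl _⟩
          · exact ⟨h1, h2.trans (h.isAncestor_parent hpg hadj)⟩
        · rintro ⟨h1, h2⟩
          rcases eq_or_lt_of_le h2.1 with rfl | hq
          · exact Or.inl rfl
          · exact Or.inr ⟨h1, h2.of_le (h2.2 p g hq le_rfl hpg hadj) hpg.le⟩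

theorem pathVertices_comm (T : SimpleGraph W) (a b : W) :
    pathVertices T a b = pathVertices T b a := by
  have key : ∀ a b, pathVertices T a b ⊆ pathVertices T b a := by
    rintro a b x ⟨p, hp, hx⟩
    exact ⟨p.reverse, hp.reverse, by simpa using hx⟩
  exact (key a b).antisymm (key b a)

theorem IsNestedTree.mem_pathVertices [Finite W] (h : IsNestedTree σ T) {w g q : W}
    (hw : IsAncestor σ T w g) : q ∈ pathVertices T g w ↔ σ.le w q ∧ IsAncestor σ T q g := by
  obtain ⟨p, hp, hsupp⟩ := h.exists_path_of_isAncestor hw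
  have : Nonempty W := ⟨w⟩
  rw [← hsupp]
  refine ⟨fun ⟨p', hp', hq⟩ => ?_, fun hq => ⟨p, hp, hq⟩⟩
  rwa [(h.isTree.existsUnique_path g w).unique hp hp']

/-- The later ancestor lies on the path from `g` to the earlier one. This translates "closer to the
guider" in the purification rule into "later in the ordering". -/
theorem IsNestedTree.dist_lt [Finite W] (h : IsNestedTree σ T) {q q' g : W}
    (hq : IsAncestor σ T q g) (hq' : IsAncestor σ T q' g) (hlt : σ.lt q q') :
    T.dist q' g < T.dist q g := by
  have : Nonempty W := ⟨q⟩
  have hT := h.isTree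
  obtain ⟨p, hp, hlen⟩ := hT.connected.exists_path_of_dist g q
  obtain ⟨p', hp', hsupp⟩ := h.exists_path_of_isAncestor hq
  obtain rfl := (hT.existsUnique_path g q).unique hp hp'
  have hmem : q' ∈ p.support := (hsupp q').2 ⟨hlt.le, hq'⟩
  classical
  have h1 := SimpleGraph.dist_le (p.takeUntil q' hmem)
  have h2 := congrArg SimpleGraph.Walk.length (p.take_spec hmem)
  rw [SimpleGraph.Walk.length_append] at h2
  have h3 := SimpleGraph.dist_le (p.dropUntil q' hmem)
  have h4 := hT.connected.pos_dist_of_ne hlt.ne'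
  rw [SimpleGraph.dist_comm, T.dist_comm (u := q)]
  omega

theorem IsNestedTree.dist_le_iff [Finite W] (h : IsNestedTree σ T) {q q' g : W}
    (hq : IsAncestor σ T q g) (hq' : IsAncestor σ T q' g) :
    T.dist q' g ≤ T.dist q g ↔ σ.le q q' := by
  constructor
  · intro hle
    by_contra hlt
    exact absurd (h.dist_lt hq' hq (not_le.1 hlt)) (not_lt.2 hle)
  · intro hle
    rcases eq_or_lt_of_le hle with rfl | hlt
    · exact le_rfl
    · exact (h.dist_lt hq hq' hlt).le

end Ancestors

/-! ## Candidate sets in terms of the ordering -/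

/-- If the vertex `v` is attached to `q`, then the ordering `σ` remains nested. -/
structure IsCandidate {V : Type u} {F : Set V} (σ : LinearOrder V) (T : SimpleGraph F) (v : V)
    (q : F) : Prop where
  lt : σ.lt q v
  parent_le : ∀ p c : F, T.Adj p c → σ.lt p v → σ.lt v c → σ.le p q
  le_parent : ∀ p b : F, T.Adj p b → σ.lt q b → σ.lt b v → σ.lt p b → σ.le q p

section Candidates

variable {V : Type u} {F : Set V} {σ : LinearOrder V} {T : SimpleGraph F}

theorem exists_isGuider [Finite V] {v : V} {q : F} (h : σ.lt q v) : ∃ g : F, IsGuider σ v g := by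
  obtain ⟨g, hg, hmax⟩ := Set.exists_max_image {x : F | σ.lt x v} (fun x => (x : V))
    (Set.toFinite _) ⟨q, h⟩
  exact ⟨g, hg, hmax⟩

theorem exists_isNextForced [Finite V] {v : V} {c : F} (h : σ.lt v c) :
    ∃ x : F, IsNextForced σ v x := by
  obtain ⟨g, hg, hmin⟩ := Set.exists_min_image {x : F | σ.lt v x} (fun x => (x : V))
    (Set.toFinite _) ⟨c, h⟩
  exact ⟨g, hg, hmin⟩

/-- The path from the root to `x` consists of the ancestors of `x`, so the rooted parent is the
earlier neighbour. -/
theorem isParent_iff [Finite V] (hT : IsNestedTree (restrictOrder F σ) T) {r : F}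
    (hr : IsFirst σ Set.univ (r : V)) {x w : F} :
    IsParent T σ x w ↔ σ.lt w x ∧ T.Adj w x := by
  have hrx : IsAncestor (restrictOrder F σ) T r x := ⟨hr.2 x trivial, fun p _ _ _ _ _ => hr.2 p trivial⟩
  constructor
  · rintro ⟨r', hr', hadj, hmem⟩
    obtain rfl : r = r' := Subtype.ext (hr.unique hr')
    rw [pathVertices_comm, hT.mem_pathVertices hrx] at hmem
    exact ⟨lt_of_le_of_ne hmem.2.1 (fun h => hadj.ne (Subtype.ext h)), hadj⟩
  · rintro ⟨hlt, hadj⟩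
    refine ⟨r, hr, hadj, ?_⟩
    rw [pathVertices_comm, hT.mem_pathVertices hrx]
    exact ⟨hr.2 w trivial, hT.isAncestor_parent hlt hadj⟩

theorem IsNextForced.lt_of_lt {v : V} (hv : v ∉ F) {x w : F} (hx : IsNextForced σ v x)
    (h : σ.lt w x) : σ.lt w v := by
  rcases lt_trichotomy (w : V) v with h' | h' | h'
  · exact h'
  · exact absurd (h' ▸ w.2) hv
  · exact absurd (hx.2 w h') (not_le.2 h)

/-- Either `w` is the root, or `w` is the parent of the next forced vertex `x` and the guider lies
between `w` and `x`. -/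
theorem IsEndpoint.isAncestor [Finite V] (hT : IsNestedTree (restrictOrder F σ) T) {r : F}
    (hr : IsFirst σ Set.univ (r : V)) {v : V} (hv : v ∉ F) {g w : F} (hg : IsGuider σ v g)
    (hw : IsEndpoint T σ v w) : IsAncestor (restrictOrder F σ) T w g := by
  rcases hw with ⟨-, hw⟩ | ⟨x, hx, hw⟩
  · exact ⟨hw.2 g trivial, fun p _ _ _ _ _ => hw.2 p trivial⟩
  · rw [isParent_iff hT hr] at hw
    have h1 := hT.isAncestor_parent hw.1 hw.2
    exact h1.of_le (hg.2 w (hx.lt_of_lt hv hw.1)) (show σ.lt (g : V) x from lt_trans hg.1 hx.1).le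

/-- The guider end of the path encodes `le_parent`: no forced vertex after `q` and before `v` has a
parent before `q`. The other end encodes `parent_le`: among edges passing over `v`, the one to the
next forced vertex has the latest parent. -/
theorem mem_candidatesIn_iff [Finite V] (hT : IsNestedTree (restrictOrder F σ) T) {r : F}
    (hr : IsFirst σ Set.univ (r : V)) {v : V} (hv : v ∉ F) {q : F} :
    q ∈ candidatesIn T σ v ↔ IsCandidate σ T v q := by
  constructor
  · rintro ⟨g, w, hg, hw, hq⟩
    rw [hT.mem_pathVertices (hw.isAncestor hT hr hv hg)] at hq
    have hqg : σ.le q g := hq.2.1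
    refine ⟨lt_of_le_of_lt hqg hg.1, fun p c hadj hpv hvc => ?_, fun p b hadj hqb hbv hpb => ?_⟩
    · rcases hw with ⟨hw, -⟩ | ⟨x, hx, hw⟩
      · exact absurd ⟨c, hvc⟩ hw
      · rw [isParent_iff hT hr] at hw
        -- The next forced vertex `x` lies after `p` and no later than `c`, so nesting of the edge
        -- from `p` to `c` places the parent `w` of `x` at or after `p`.
        have h1 : σ.le p w := (hT.isAncestor_parent
          (show σ.lt (p : V) c from lt_trans hpv hvc) hadj).2 w x
          (show σ.lt (p : V) x from lt_trans hpv hx.1) (hx.2 c hvc) hw.1 hw.2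
        exact h1.trans hq.1
    · exact hq.2.2 p b hqb (hg.2 b hbv) hpb hadj
  · rintro ⟨hqv, h1, h2⟩
    obtain ⟨g, hg⟩ := exists_isGuider hqv
    have hqg : IsAncestor (restrictOrder F σ) T q g :=
      ⟨hg.2 q hqv, fun p b hqb hbg hpb hadj => h2 p b hadj hqb (lt_of_le_of_lt hbg hg.1) hpb⟩
    have key : ∃ w : F, IsEndpoint T σ v w ∧ σ.le w q := by
      by_cases hc : ∃ c : F, σ.lt v c
      · obtain ⟨c, hc⟩ := hc
        obtain ⟨x, hx⟩ := exists_isNextForced hc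
        obtain ⟨w, hwx, hadj⟩ := hT.exists_parent q x
          (show σ.lt (q : V) x from lt_trans hqv hx.1)
        exact ⟨w, Or.inr ⟨x, hx, (isParent_iff hT hr).2 ⟨hwx, hadj⟩⟩,
          h1 w x hadj (hx.lt_of_lt hv hwx) hx.1⟩
      · exact ⟨r, Or.inl ⟨hc, hr⟩, hr.2 q trivial⟩
    obtain ⟨w, hw, hwq⟩ := key
    exact ⟨g, w, hg, hw, (hT.mem_pathVertices (hw.isAncestor hT hr hv hg)).2 ⟨hwq, hqg⟩⟩

theorem IsCandidate.isAncestor {v : V} {q g : F} (h : IsCandidate σ T v q) (hg : IsGuider σ v g) :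
    IsAncestor (restrictOrder F σ) T q g :=
  ⟨hg.2 q h.lt, fun p b hqb hbg hpb hadj =>
    h.le_parent p b hadj hqb (lt_of_le_of_lt hbg hg.1) hpb⟩

theorem IsCandidate.dist_le_iff [Finite V] (hT : IsNestedTree (restrictOrder F σ) T) {v v' : V}
    {q q' g : F} (hq : IsCandidate σ T v q) (hg : IsGuider σ v g) (hq' : IsCandidate σ T v' q')
    (hg' : IsGuider σ v' g) : T.dist q' g ≤ T.dist q g ↔ σ.le q q' :=
  hT.dist_le_iff (hq.isAncestor hg) (hq'.isAncestor hg')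

/-- The vertices on the path between two candidates are the candidates between them. -/
theorem IsCandidate.mem_pathVertices_iff [Finite V] (hT : IsNestedTree (restrictOrder F σ) T)
    {v : V} {a b c : F} (ha : IsCandidate σ T v a) (hb : IsCandidate σ T v b)
    (hab : σ.le a b) : c ∈ pathVertices T a b ↔ σ.le a c ∧ σ.le c b ∧ IsCandidate σ T v c := by
  obtain ⟨g, hg⟩ := exists_isGuider ha.lt
  have hag := ha.isAncestor hg
  have hbg := hb.isAncestor hg
  have h1 : IsAncestor (restrictOrder F σ) T a b := hag.of_le hab hbg.1
  rw [pathVertices_comm, hT.mem_pathVertices h1]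
  constructor
  · rintro ⟨hac, hcb⟩
    have hcg := hcb.trans hbg
    refine ⟨hac, hcb.1, lt_of_le_of_lt hcg.1 hg.1, fun p d hadj hpv hvd => ?_,
      fun p d hadj hcd hdv hpd => hcg.2 p d hcd (hg.2 d hdv) hpd hadj⟩
    exact (ha.parent_le p d hadj hpv hvd).trans hac
  · rintro ⟨hac, hcb, hc⟩
    exact ⟨hac, (hc.isAncestor hg).of_le hcb hbg.1⟩

end Candidates

/-! ## Purification -/

/-- The purification rule does not apply to the family `Q`. -/
def IsConsistent {V : Type u} {F : Set V} (Φ : Set (LinearOrder V)) (T : SimpleGraph F)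
    (Q : ↥(Fᶜ) → Set F) : Prop :=
  ∀ σ ∈ Φ, ∀ (x v : ↥(Fᶜ)) (w : F), σ.lt (x : V) v → IsGuider σ (x : V) w → IsGuider σ (v : V) w →
    (∀ q ∈ Q v, ∃ y ∈ Q x, T.dist y w ≤ T.dist q w) ∧
      ∀ q ∈ Q x, ∃ y ∈ Q v, T.dist q w ≤ T.dist y w

section Purification

variable {V : Type u} {F : Set V} {Φ : Set (LinearOrder V)} {T : SimpleGraph F}
  {Q Q' K : ↥(Fᶜ) → Set F}

theorem isConsistent_iff : IsConsistent Φ T Q ↔ ∀ Q', ¬ PurifyStep Φ T Q Q' := by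
  constructor
  · rintro h Q' ⟨σ, hσ, x, v, w, hxv, hx, hv, ⟨q, hq | hq⟩, -⟩
    · obtain ⟨y, hy, hle⟩ := (h σ hσ x v w hxv hx hv).1 q hq.1
      exact absurd (hq.2 y hy) (not_lt.2 hle)
    · obtain ⟨y, hy, hle⟩ := (h σ hσ x v w hxv hx hv).2 q hq.1
      exact absurd (hq.2 y hy) (not_lt.2 hle)
  · intro h σ hσ x v w hxv hx hv
    constructor
    · intro q hq
      by_contra! hcon
      exact h _ ⟨σ, hσ, x, v, w, hxv, hx, hv, ⟨q, Or.inl ⟨hq, hcon⟩⟩, rfl⟩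
    · intro q hq
      by_contra! hcon
      exact h _ ⟨σ, hσ, x, v, w, hxv, hx, hv, ⟨q, Or.inr ⟨hq, hcon⟩⟩, rfl⟩

theorem PurifyStep.le (h : PurifyStep Φ T Q Q') (v : ↥(Fᶜ)) : Q' v ⊆ Q v := by
  classical
  obtain ⟨σ, -, x, v', w, -, -, -, -, rfl⟩ := h
  simp only [Function.update_apply]
  split_ifs with h1 h2
  · subst h1; exact Set.sdiff_subset
  · subst h2; exact Set.sdiff_subset
  · exact subset_rfl

theorem PurifyStep.exists_notMem (h : PurifyStep Φ T Q Q') : ∃ v, ∃ q ∈ Q v, q ∉ Q' v := by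
  classical
  obtain ⟨σ, -, x, v, w, hxv, -, -, ⟨q, hq | hq⟩, rfl⟩ := h
  · refine ⟨v, q, hq.1, ?_⟩
    -- Since `v` and `x` differ, the update at `x` does not overwrite the reduced set at `v`.
    have hne : v ≠ x := fun h => hxv.ne' (congrArg Subtype.val h)
    simp [hne, hq]
  · exact ⟨x, q, hq.1, by simp [hq]⟩

/-- The number of pairs of a free vertex and one of its candidates. -/
noncomputable def totalSize (Q : ↥(Fᶜ) → Set F) : ℕ :=
  {p : ↥(Fᶜ) × F | p.2 ∈ Q p.1}.ncard

theorem PurifyStep.totalSize_lt [Finite V] (h : PurifyStep Φ T Q Q') :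
    totalSize Q' < totalSize Q := by
  obtain ⟨v, q, hq, hq'⟩ := h.exists_notMem
  refine Set.ncard_lt_ncard ⟨fun p hp => h.le p.1 hp, fun hsub => ?_⟩ (Set.toFinite _)
  exact hq' (hsub (show (v, q) ∈ {p : ↥(Fᶜ) × F | p.2 ∈ Q p.1} from hq))

theorem totalSize_le [Finite V] (Q : ↥(Fᶜ) → Set F) : totalSize Q ≤ Nat.card V ^ 2 := by
  calc totalSize Q ≤ (Set.univ : Set (↥(Fᶜ) × F)).ncard :=
        Set.ncard_le_ncard (Set.subset_univ _) (Set.toFinite _)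
    _ = Nat.card ↥(Fᶜ) * Nat.card F := by rw [Set.ncard_univ, Nat.card_prod]
    _ ≤ Nat.card V * Nat.card V :=
        Nat.mul_le_mul (Finite.card_subtype_le _) (Finite.card_subtype_le _)
    _ = Nat.card V ^ 2 := (sq _).symm

/-- Consistency of `K` gives every element of `K` a witness in the other set of `K`, which lies in
`Q` as well. The element is therefore not among those that the rule discards. -/
theorem IsConsistent.le_of_purifyStep (hK : IsConsistent Φ T K) (hKQ : ∀ v, K v ⊆ Q v)
    (h : PurifyStep Φ T Q Q') (v : ↥(Fᶜ)) : K v ⊆ Q' v := by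
  classical
  obtain ⟨σ, hσ, x, v', w, hxv, hx, hv, -, rfl⟩ := h
  have hc := hK σ hσ x v' w hxv hx hv
  simp only [Function.update_apply]
  split_ifs with h1 h2
  · subst h1
    refine fun q hq => ⟨hKQ _ hq, fun hq' => ?_⟩
    obtain ⟨y, hy, hle⟩ := hc.2 q hq
    exact absurd (hq'.2 y (hKQ _ hy)) (not_lt.2 hle)
  · subst h2
    refine fun q hq => ⟨hKQ _ hq, fun hq' => ?_⟩
    obtain ⟨y, hy, hle⟩ := hc.1 q hq
    exact absurd (hq'.2 y (hKQ _ hy)) (not_lt.2 hle)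
  · exact hKQ v

theorem IsPurified.isConsistent (h : IsPurified Φ T Q) : IsConsistent Φ T Q :=
  isConsistent_iff.2 h.2

theorem IsPurified.le_candidates (h : IsPurified Φ T Q) (v : ↥(Fᶜ)) : Q v ⊆ candidates Φ T v := by
  obtain ⟨h, -⟩ := h
  induction h with
  | refl => exact subset_rfl
  | tail _ hs ih => exact (hs.le v).trans ih

/-- The purified family is the largest consistent family of candidates. -/
theorem IsPurified.le_of_isConsistent (h : IsPurified Φ T Q) (hK : IsConsistent Φ T K)
    (hle : ∀ v, K v ⊆ candidates Φ T v) (v : ↥(Fᶜ)) : K v ⊆ Q v := by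
  obtain ⟨h, -⟩ := h
  induction h generalizing v with
  | refl => exact hle v
  | tail _ hs ih => exact hK.le_of_purifyStep ih hs v

theorem exists_isPurified [Finite V] (Φ : Set (LinearOrder V)) (T : SimpleGraph F) :
    ∃ Q, IsPurified Φ T Q := by
  have key : ∀ n (Q : ↥(Fᶜ) → Set F), totalSize Q = n →
      ∃ Q', Relation.ReflTransGen (PurifyStep Φ T) Q Q' ∧ ∀ Q'', ¬ PurifyStep Φ T Q' Q'' := by
    intro n
    induction n using Nat.strong_induction_on with
    | _ n ih =>
      rintro Q rfl
      by_cases h : ∃ Q', PurifyStep Φ T Q Q'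
      · obtain ⟨Q', h⟩ := h
        obtain ⟨Q'', h1, h2⟩ := ih _ h.totalSize_lt Q' rfl
        exact ⟨Q'', .head h h1, h2⟩
      · exact ⟨Q, .refl, not_exists.1 h⟩
  exact key _ _ rfl

theorem purifyStep_count_le [Finite V] (k : ℕ) (Q : ℕ → ↥(Fᶜ) → Set F)
    (h : ∀ i < k, PurifyStep Φ T (Q i) (Q (i + 1))) : k ≤ Nat.card V ^ 2 := by
  have key : ∀ i ≤ k, totalSize (Q i) + i ≤ totalSize (Q 0) := by
    intro i hi
    induction i with
    | zero => simp
    | succ i ih =>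
      have h1 := ih (by omega)
      have h2 := (h i (by omega)).totalSize_lt
      omega
  have h1 := key k le_rfl
  have h2 := totalSize_le (Q 0)
  omega

/-- The vertices on paths between elements of the sets of a family. -/
def pathHull (T : SimpleGraph F) (Q : ↥(Fᶜ) → Set F) (v : ↥(Fᶜ)) : Set F :=
  {c | ∃ a ∈ Q v, ∃ b ∈ Q v, c ∈ pathVertices T a b}

theorem subset_pathHull (T : SimpleGraph F) (Q : ↥(Fᶜ) → Set F) (v : ↥(Fᶜ)) :
    Q v ⊆ pathHull T Q v :=
  fun q hq => ⟨q, hq, q, hq, .nil, by simp, by simp⟩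

section Nested

variable [Finite V] (hT : ∀ σ ∈ Φ, IsNestedTree (restrictOrder F σ) T)
  (hr : ∀ σ ∈ Φ, ∃ r : F, IsFirst σ Set.univ (r : V))

include hT hr in
theorem mem_candidates_iff {v : ↥(Fᶜ)} {q : F} :
    q ∈ candidates Φ T v ↔ ∀ σ ∈ Φ, IsCandidate σ T v q := by
  refine forall₂_congr fun σ hσ => ?_
  obtain ⟨r, hr⟩ := hr σ hσ
  exact mem_candidatesIn_iff (hT σ hσ) hr v.2

include hT hr in
/-- For families of candidates, consistency can be expressed by the orderings. -/
theorem isConsistent_iff_order (hle : ∀ v, Q v ⊆ candidates Φ T v) :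
    IsConsistent Φ T Q ↔ ∀ σ ∈ Φ, ∀ (x v : ↥(Fᶜ)) (w : F), σ.lt (x : V) v →
      IsGuider σ (x : V) w → IsGuider σ (v : V) w →
        (∀ q ∈ Q v, ∃ y ∈ Q x, σ.le (q : V) y) ∧ ∀ q ∈ Q x, ∃ y ∈ Q v, σ.le (y : V) q := by
  have hc : ∀ σ ∈ Φ, ∀ (v : ↥(Fᶜ)), ∀ q ∈ Q v, IsCandidate σ T v q :=
    fun σ hσ v q hq => (mem_candidates_iff hT hr).1 (hle v hq) σ hσ
  refine forall₂_congr fun σ hσ => forall₃_congr fun x v w => forall₃_congr fun _ hx hv => ?_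
  refine and_congr ?_ ?_
  · refine forall₂_congr fun q hq => exists_congr fun y => and_congr_right fun hy => ?_
    exact (hc σ hσ v q hq).dist_le_iff (hT σ hσ) hv (hc σ hσ x y hy) hx
  · refine forall₂_congr fun q hq => exists_congr fun y => and_congr_right fun hy => ?_
    exact (hc σ hσ v y hy).dist_le_iff (hT σ hσ) hv (hc σ hσ x q hq) hx

include hT hr in
theorem exists_le_of_mem_pathHull (hle : ∀ v, Q v ⊆ candidates Φ T v) {σ : LinearOrder V}
    (hσ : σ ∈ Φ) {v : ↥(Fᶜ)} {c : F} (hc : c ∈ pathHull T Q v) :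
    ∃ a ∈ Q v, ∃ b ∈ Q v, σ.le (a : V) c ∧ σ.le (c : V) b ∧ IsCandidate σ T v c := by
  obtain ⟨a, ha, b, hb, hc⟩ := hc
  have ha' := (mem_candidates_iff hT hr).1 (hle v ha) σ hσ
  have hb' := (mem_candidates_iff hT hr).1 (hle v hb) σ hσ
  rcases le_total (a : V) b with hab | hab
  · exact ⟨a, ha, b, hb, (ha'.mem_pathVertices_iff (hT σ hσ) hb' hab).1 hc⟩
  · rw [pathVertices_comm] at hc
    exact ⟨b, hb, a, ha, (hb'.mem_pathVertices_iff (hT σ hσ) ha' hab).1 hc⟩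

include hT hr in
-- The path hull is again a consistent family of candidates: a vertex on a path lies between the two
-- ends in each ordering, and the witness for the appropriate end also serves for it. Maximality of
-- the purified family does the rest.
theorem IsPurified.pathVertices_subset (h : IsPurified Φ T Q) {v : ↥(Fᶜ)} {a b : F}
    (ha : a ∈ Q v) (hb : b ∈ Q v) : pathVertices T a b ⊆ Q v := by
  have hle := h.le_candidates
  have hle' : ∀ v, pathHull T Q v ⊆ candidates Φ T v := by
    intro v c hc
    rw [mem_candidates_iff hT hr]
    intro σ hσ
    obtain ⟨_, _, _, _, _, _, h⟩ := exists_le_of_mem_pathHull hT hr hle hσ hc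
    exact h
  refine fun c hc => h.le_of_isConsistent ?_ hle' v ⟨a, ha, b, hb, hc⟩
  rw [isConsistent_iff_order hT hr hle']
  intro σ hσ x v w hxv hx hv
  have hcons := (isConsistent_iff_order hT hr hle).1 h.isConsistent σ hσ x v w hxv hx hv
  constructor
  · intro q hq
    obtain ⟨_, _, b, hb, _, hqb, _⟩ := exists_le_of_mem_pathHull hT hr hle hσ hq
    obtain ⟨y, hy, hby⟩ := hcons.1 b hb
    exact ⟨y, subset_pathHull T Q x hy, hqb.trans hby⟩
  · intro q hq
    obtain ⟨a, ha, _, _, haq, _, _⟩ := exists_le_of_mem_pathHull hT hr hle hσ hq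
    obtain ⟨y, hy, hya⟩ := hcons.2 a ha
    exact ⟨y, subset_pathHull T Q v hy, hya.trans haq⟩

end Nested

end Purification

/-! ## Attaching leaves -/

section Leaves

variable {V : Type u} {F : Set V} {T : SimpleGraph F}

theorem IsGuider.lt_iff {σ : LinearOrder V} {x v : V} {w : F} (hx : IsGuider σ x w)
    (hv : IsGuider σ v w) (y : F) : σ.lt y x ↔ σ.lt y v :=
  ⟨fun h => lt_of_le_of_lt (hx.2 y h) hv.1, fun h => lt_of_le_of_lt (hv.2 y h) hx.1⟩

/-- Being a candidate in `σ` depends only on which forced vertices precede the free vertex, and the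
guider determines these. -/
theorem IsCandidate.of_isGuider {σ : LinearOrder V} {x v : V} (hxF : x ∉ F) {w : F}
    (hx : IsGuider σ x w) (hv : IsGuider σ v w) {q : F} (h : IsCandidate σ T x q) :
    IsCandidate σ T v q := by
  have key := hx.lt_iff hv
  refine ⟨(key q).1 h.lt, fun p c hadj hpv hvc => h.parent_le p c hadj ((key p).2 hpv) ?_,
    fun p b hadj hqb hbv hpb => h.le_parent p b hadj hqb ((key b).2 hbv) hpb⟩
  rcases lt_trichotomy (c : V) x with h' | h' | h'
  · exact absurd ((key c).1 h') (lt_asymm hvc)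
  · exact absurd (h' ▸ c.2) hxF
  · exact h'

/-- Nesting of an edge from `p` to `c` over `b` splits by which of `b`, `c` are forced: both, use
`T`; only `c`, `parent_le`; only `b`, `le_parent`. Two free vertices need `hpair` only if no forced
vertex separates them. -/
theorem isNestedTree_of_leaves [Finite V] {σ : LinearOrder V}
    (hT : IsNestedTree (restrictOrder F σ) T) {r : F} (hr : IsFirst σ Set.univ (r : V))
    (par : ↥(Fᶜ) → F) (hpar : ∀ v : ↥(Fᶜ), IsCandidate σ T v (par v))
    (hpair : ∀ (x v : ↥(Fᶜ)) (w : F), σ.lt (x : V) v → IsGuider σ (x : V) w →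
      IsGuider σ (v : V) w → σ.le (par v : V) (par x))
    (R : SimpleGraph V) (hRF : ∀ a b : F, R.Adj a b ↔ T.Adj a b)
    (hRv : ∀ (a : V) (v : ↥(Fᶜ)), R.Adj a v ∧ σ.lt a v ↔ a = par v)
    (hRF' : ∀ (v : ↥(Fᶜ)) (b : F), R.Adj v b → σ.lt (b : V) v) : IsNestedTree σ R := by
  have hmem : ∀ (p : V) (b : F), R.Adj p b → σ.lt p b → p ∈ F := by
    intro p b hadj hlt
    by_contra hp
    exact lt_asymm hlt (hRF' ⟨p, hp⟩ b hadj)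
  refine ⟨fun a b hab => ?_, fun p q b hp hq hpa hqa => ?_, fun p b c hpb hbc hpc => ?_⟩
  · by_cases hb : b ∈ F
    · obtain ⟨p, hp, hadj⟩ := hT.exists_parent r ⟨b, hb⟩
        (show σ.lt (r : V) b from lt_of_le_of_lt (hr.2 a trivial) hab)
      exact ⟨p, hp, (hRF p ⟨b, hb⟩).2 hadj⟩
    · have h := (hRv (par ⟨b, hb⟩) ⟨b, hb⟩).2 rfl
      exact ⟨_, h.2, h.1⟩
  · by_cases hb : b ∈ F
    · have hpF := hmem p ⟨b, hb⟩ hpa hp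
      have hqF := hmem q ⟨b, hb⟩ hqa hq
      exact congrArg Subtype.val (hT.parent_unique ⟨p, hpF⟩ ⟨q, hqF⟩ ⟨b, hb⟩ hp hq
        ((hRF ⟨p, hpF⟩ ⟨b, hb⟩).1 hpa) ((hRF ⟨q, hqF⟩ ⟨b, hb⟩).1 hqa))
    · rw [(hRv p ⟨b, hb⟩).1 ⟨hpa, hp⟩, (hRv q ⟨b, hb⟩).1 ⟨hqa, hq⟩]
  · by_cases hc : c ∈ F
    · have hpF := hmem p ⟨c, hc⟩ hpc (lt_trans hpb hbc)
      have hpc' := (hRF ⟨p, hpF⟩ ⟨c, hc⟩).1 hpc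
      by_cases hb : b ∈ F
      · obtain ⟨q, h1, h2, h3⟩ := hT.nested ⟨p, hpF⟩ ⟨b, hb⟩ ⟨c, hc⟩ hpb hbc hpc'
        exact ⟨q, h1, h2, (hRF q ⟨b, hb⟩).2 h3⟩
      · have h := (hRv (par ⟨b, hb⟩) ⟨b, hb⟩).2 rfl
        exact ⟨_, (hpar ⟨b, hb⟩).parent_le ⟨p, hpF⟩ ⟨c, hc⟩ hpc' hpb hbc, h.2, h.1⟩
    · obtain rfl := (hRv p ⟨c, hc⟩).1 ⟨hpc, lt_trans hpb hbc⟩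
      by_cases hb : b ∈ F
      · obtain ⟨q, h1, h2⟩ := hT.exists_parent (par ⟨c, hc⟩) ⟨b, hb⟩ hpb
        exact ⟨q, (hpar ⟨c, hc⟩).le_parent q ⟨b, hb⟩ h2 hpb hbc h1, h1, (hRF q ⟨b, hb⟩).2 h2⟩
      · have h := (hRv (par ⟨b, hb⟩) ⟨b, hb⟩).2 rfl
        refine ⟨_, ?_, h.2, h.1⟩
        obtain ⟨g, hg⟩ := exists_isGuider (hpar ⟨b, hb⟩).lt
        by_cases hnext : ∃ x : F, σ.lt b x ∧ σ.lt (x : V) c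
        · obtain ⟨x', hx', hx'c⟩ := hnext
          obtain ⟨x, hx⟩ := exists_isNextForced hx'
          have hxc : σ.lt (x : V) c := lt_of_le_of_lt (hx.2 x' hx') hx'c
          obtain ⟨q, hqx, hadj⟩ := hT.exists_parent g x
            (show σ.lt (g : V) x from lt_trans hg.1 hx.1)
          have hqb := hx.lt_of_lt hb hqx
          exact ((hpar ⟨c, hc⟩).le_parent q x hadj (lt_trans hpb hx.1) hxc hqx).trans
            ((hpar ⟨b, hb⟩).parent_le q x hadj hqb hx.1)
        · refine hpair ⟨b, hb⟩ ⟨c, hc⟩ g hbc hg ⟨lt_trans hg.1 hbc, fun x hx => hg.2 x ?_⟩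
          rcases lt_trichotomy (x : V) b with h' | h' | h'
          · exact h'
          · exact absurd (h' ▸ x.2) hb
          · exact absurd ⟨x, h', hx⟩ hnext

/-- Attaching every free vertex to the best vertex of its purified candidate set yields a nested
tree. -/
theorem isNestedTree_assignParents [Finite V] {Φ : Set (LinearOrder V)}
    (hT : ∀ σ ∈ Φ, IsNestedTree (restrictOrder F σ) T)
    (hr : ∀ σ ∈ Φ, ∃ r : F, IsFirst σ Set.univ (r : V)) {Q : ↥(Fᶜ) → Set F}
    (hQ : IsPurified Φ T Q) (hne : ∀ v, (Q v).Nonempty) {n : ℕ} (f : V ≃ Fin n) :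
    ∀ σ ∈ Φ, IsNestedTree σ (assignParents T Q f) := by
  have hmin : ∀ v, ∃ y ∈ Q v, ∀ z ∈ Q v, f y ≤ f z := fun v =>
    Set.exists_min_image (Q v) (fun z => f z) (Set.toFinite _) (hne v)
  choose par hpar hparmin using hmin
  have huniq : ∀ v, ∀ y ∈ Q v, (∀ z ∈ Q v, f y ≤ f z) → y = par v := fun v y hy hymin =>
    Subtype.ext (f.injective (le_antisymm (hymin _ (hpar v)) (hparmin v y hy)))
  intro σ hσ
  obtain ⟨r, hr'⟩ := hr σ hσ
  have hcand : ∀ v, ∀ q ∈ Q v, IsCandidate σ T v q :=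
    fun v q hq => (mem_candidates_iff hT hr).1 (hQ.le_candidates v hq) σ hσ
  have hadj : ∀ a b, (assignParents T Q f).Adj a b ↔
      (∃ a' b' : F, T.Adj a' b' ∧ (a' : V) = a ∧ (b' : V) = b) ∨
      (∃ v : ↥(Fᶜ), (v : V) = a ∧ (par v : V) = b) ∨
      (∃ v : ↥(Fᶜ), (v : V) = b ∧ (par v : V) = a) := by
    intro a b
    have hatt : ∀ a b : V, (∃ (v' : ↥(Fᶜ)) (y' : F), (v' : V) = a ∧ (y' : V) = b ∧
        y' ∈ Q v' ∧ ∀ z ∈ Q v', f y' ≤ f z) ↔ ∃ v : ↥(Fᶜ), (v : V) = a ∧ (par v : V) = b := by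
      intro a b
      constructor
      · rintro ⟨v, y, rfl, rfl, hy, hymin⟩
        exact ⟨v, rfl, by rw [huniq v y hy hymin]⟩
      · rintro ⟨v, rfl, rfl⟩
        exact ⟨v, par v, rfl, rfl, hpar v, hparmin v⟩
    rw [assignParents, SimpleGraph.sup_adj, SimpleGraph.fromRel_adj, hatt, hatt]
    refine or_congr ?_ ?_
    · rw [SimpleGraph.map_adj]
      rfl
    · refine and_iff_right_of_imp ?_
      rintro (⟨v, rfl, rfl⟩ | ⟨v, rfl, rfl⟩)
      · exact fun h => v.2 (h ▸ (par v).2)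
      · exact fun h => v.2 (h ▸ (par v).2)
  refine isNestedTree_of_leaves (hT σ hσ) hr' par (fun v => hcand v _ (hpar v)) ?_ _ ?_ ?_ ?_
  · intro x v w hxv hx hv
    by_contra hlt
    rw [not_le] at hlt
    have hcons := (isConsistent_iff_order hT hr hQ.le_candidates).1 hQ.isConsistent
      σ hσ x v w hxv hx hv
    obtain ⟨y, hy, hyle⟩ := hcons.1 (par v) (hpar v)
    obtain ⟨z, hz, hzle⟩ := hcons.2 (par x) (hpar x)
    have hcx : ∀ q, IsCandidate σ T x q ↔ IsCandidate σ T v q := fun q =>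
      ⟨.of_isGuider x.2 hx hv, .of_isGuider v.2 hv hx⟩
    -- With `par x` before `par v`, consistency yields `z ≤ par x < par v ≤ y` for some `y ∈ Q x`
    -- and `z ∈ Q v`. Closure under paths then puts each parent into the other set, and minimality
    -- of `f` makes them equal.
    have h1 : par v ∈ Q x := hQ.pathVertices_subset hT hr (hpar x) hy
      (((hcand x _ (hpar x)).mem_pathVertices_iff (hT σ hσ) (hcand x y hy)
        (hlt.le.trans hyle)).2 ⟨hlt.le, hyle, (hcx _).2 (hcand v _ (hpar v))⟩)
    have h2 : par x ∈ Q v := hQ.pathVertices_subset hT hr hz (hpar v)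
      (((hcand v z hz).mem_pathVertices_iff (hT σ hσ) (hcand v _ (hpar v))
        (hzle.trans hlt.le)).2 ⟨hzle, hlt.le, (hcx _).1 (hcand x _ (hpar x))⟩)
    have h3 := f.injective (le_antisymm (hparmin x _ h1) (hparmin v _ h2))
    rw [h3] at hlt
    exact lt_irrefl _ hlt
  · intro a b
    rw [hadj]
    constructor
    · rintro (⟨a', b', h, ha, hb⟩ | ⟨v, hv, -⟩ | ⟨v, hv, -⟩)
      · rwa [← Subtype.ext ha, ← Subtype.ext hb]
      · exact absurd a.2 (hv ▸ v.2)
      · exact absurd b.2 (hv ▸ v.2)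
    · exact fun h => Or.inl ⟨a, b, h, rfl, rfl⟩
  · intro a v
    rw [hadj]
    constructor
    · rintro ⟨⟨a', b', h, ha, hb⟩ | ⟨x, rfl, hx⟩ | ⟨x, hx, rfl⟩, hlt⟩
      · exact absurd (hb ▸ b'.2) v.2
      · exact absurd (hx ▸ (par x).2) v.2
      · rw [Subtype.ext hx]
    · rintro rfl
      exact ⟨Or.inr (Or.inr ⟨v, rfl, rfl⟩), (hcand v _ (hpar v)).lt⟩
  · intro v b h
    rw [hadj] at h
    rcases h with ⟨a', b', h, ha, hb⟩ | ⟨x, hx, hb⟩ | ⟨x, hx, -⟩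
    · exact absurd (ha ▸ a'.2) v.2
    · rw [← hx, ← hb]
      exact (hcand x _ (hpar x)).lt
    · exact absurd b.2 (hx ▸ x.2)

end Leaves

/-! ## Candidates from a support -/

/-- `Anchor Φ T F v y`: the vertex `y` is the first vertex of `F` on the path of ancestors of `v`,
and the vertices on this path before `y` have the same parent in all orderings. -/
inductive Anchor {V : Type u} (Φ : Set (LinearOrder V)) (T : SimpleGraph V) (F : Set V) :
    V → V → Prop
  | base (u v : V) (hv : v ∉ F) (hu : u ∈ F) (hlt : ∀ σ ∈ Φ, σ.lt u v) (hadj : T.Adj u v) :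
      Anchor Φ T F v u
  | step (u v y : V) (hv : v ∉ F) (hu : u ∉ F) (hlt : ∀ σ ∈ Φ, σ.lt u v) (hadj : T.Adj u v)
      (h : Anchor Φ T F u y) : Anchor Φ T F v y

section Anchor

variable {V : Type u} {Φ : Set (LinearOrder V)} {T : SimpleGraph V} {F : Set V}

theorem Anchor.mem {v y : V} (h : Anchor Φ T F v y) : y ∈ F := by
  induction h with
  | base _ _ _ hu => exact hu
  | step _ _ _ _ _ _ _ _ ih => exact ih

theorem Anchor.lt {σ : LinearOrder V} (hσ : σ ∈ Φ) {v y : V} (h : Anchor Φ T F v y) :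
    σ.lt y v := by
  induction h with
  | base _ _ _ _ hlt => exact hlt σ hσ
  | step _ _ _ _ _ hlt _ _ ih => exact lt_trans ih (hlt σ hσ)

theorem IsNestedTree.parent_le_parent {σ : LinearOrder V} (hT : IsNestedTree σ T) {p q b c : V}
    (hpb : σ.lt p b) (hbc : σ.lt b c) (hpc : T.Adj p c) (hqb : σ.lt q b) (hadj : T.Adj q b) :
    σ.le p q := by
  obtain ⟨q', h1, h2, h3⟩ := hT.nested p b c hpb hbc hpc
  rwa [hT.parent_unique q q' b hqb h2 hadj h3]

/-- Induct along the chain of ancestors: vertices between `u` and its child `v` have parents at or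
after `u`, and those before `u` are covered by the induction hypothesis. -/
theorem Anchor.le_parent {σ : LinearOrder V} (hσ : σ ∈ Φ) (hT : IsNestedTree σ T) {v y : V}
    (h : Anchor Φ T F v y) : ∀ b p, σ.lt y b → σ.lt b v → σ.lt p b → T.Adj p b → σ.le y p := by
  induction h with
  | base u v hv hu hlt hadj =>
    intro b p hub hbv hpb hpadj
    exact hT.parent_le_parent hub hbv hadj hpb hpadj
  | step u v y hv hu hlt hadj h ih =>
    intro b p hyb hbv hpb hpadj
    rcases lt_trichotomy b u with hbu | rfl | hub
    · exact ih b p hyb hbu hpb hpadj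
    -- For `b = u` the parent `p` is the next vertex of the chain, which is the anchor itself or
    -- lies after it.
    · cases h with
      | base _ _ _ _ hlt' hadj' =>
        exact (hT.parent_unique y p b (hlt' σ hσ) hpb hadj' hpadj).le
      | step w _ _ _ _ hlt' hadj' h' =>
        obtain rfl := hT.parent_unique w p b (hlt' σ hσ) hpb hadj' hpadj
        exact (h'.lt hσ).le
    · exact (h.lt hσ).le.trans (hT.parent_le_parent hub hbv hadj hpb hpadj)

/-- A forced child has a forced parent `p`. Nesting gives `p ≤ u`, and `p ≠ u` because `u` is free,
so the edge also passes over `u` and the induction continues. -/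
theorem Anchor.parent_le {σ : LinearOrder V} (hσ : σ ∈ Φ) (hT : IsNestedTree σ T)
    (hF : ∀ u v, σ.lt u v → T.Adj u v → v ∈ F → u ∈ F) {v y : V}
    (h : Anchor Φ T F v y) : ∀ p c, c ∈ F → T.Adj p c → σ.lt p v → σ.lt v c → σ.le p y := by
  induction h with
  | base u v hv hu hlt hadj =>
    intro p c hc hpc hpv hvc
    exact hT.parent_le_parent hpv hvc hpc (hlt σ hσ) hadj
  | step u v y hv hu hlt hadj h ih =>
    intro p c hc hpc hpv hvc
    have h1 := hT.parent_le_parent hpv hvc hpc (hlt σ hσ) hadj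
    have hp : p ∈ F := hF p c (lt_trans hpv hvc) hpc hc
    have hpu : σ.lt p u := lt_of_le_of_ne h1 (fun h => hu (h ▸ hp))
    exact ih p c hc hpc hpu (lt_trans (hlt σ hσ) hvc)

/-- Climbing from `x`, which lies between `y` and `v`, parents never fall before `y`. A free parent
differs from the forced vertex `y`, so it again lies strictly after `y`. -/
theorem Anchor.le_anchor {σ : LinearOrder V} (hσ : σ ∈ Φ) (hT : IsNestedTree σ T) {x z v y : V}
    (hx : Anchor Φ T F x z) (hv : Anchor Φ T F v y) (hyx : σ.lt y x) (hxv : σ.lt x v) :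
    σ.le y z := by
  induction hx with
  | base u x hx hu hlt hadj => exact hv.le_parent hσ hT x u hyx hxv (hlt σ hσ) hadj
  | step u x z hx hu hlt hadj h ih =>
    have h1 := hv.le_parent hσ hT x u hyx hxv (hlt σ hσ) hadj
    exact ih (lt_of_le_of_ne h1 (fun h => hu (h ▸ hv.mem))) (lt_trans (hlt σ hσ) hxv)

theorem exists_anchor [Finite V] {σ : LinearOrder V} (hT : IsNestedTree σ T)
    (hfirst : ∀ v ∉ F, ∃ a, σ.lt a v)
    (hfree : ∀ τ ∈ Φ, ∀ u v, σ.lt u v → T.Adj u v → v ∉ F → τ.lt u v) (v : V) (hv : v ∉ F) :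
    ∃ y, Anchor Φ T F v y := by
  induction v using WellFoundedLT.induction with
  | ind v ih =>
    obtain ⟨a, ha⟩ := hfirst v hv
    obtain ⟨u, hu, hadj⟩ := hT.exists_parent a v ha
    have hlt : ∀ τ ∈ Φ, τ.lt u v := fun τ hτ => hfree τ hτ u v hu hadj hv
    by_cases huF : u ∈ F
    · exact ⟨u, .base u v hv huF hlt hadj⟩
    · obtain ⟨y, hy⟩ := ih u hu huF
      exact ⟨y, .step u v y hv huF hlt hadj hy⟩

end Anchor

theorem spanningCoe_induce_of_eq_univ {V : Type u} {G : SimpleGraph V} {F : Set V}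
    (hF : F = Set.univ) : (G.induce F).spanningCoe = G := by
  subst hF
  ext u v
  simp

section Correctness

variable {V : Type u} [Finite V] {Φ : Set (LinearOrder V)} {A : Set (V × V)}
  (hΦ : Φ.Nonempty) (hA : IsAttachmentDigraph Φ A)

include hΦ hA in
theorem exists_forced_isFirst [Nonempty V] : ∀ σ ∈ Φ, ∃ r : forced A, IsFirst σ Set.univ (r : V) := by
  intro σ hσ
  obtain ⟨r, hr⟩ := exists_isFirst_univ σ
  exact ⟨⟨r, hr.mem_forced hΦ hA hσ⟩, hr⟩

include hΦ hA in
-- The anchors form a consistent family of candidates, so the largest such family contains them.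
-- Each free vertex has an anchor because its parent is the same in all orderings.
theorem candidates_nonempty_of_support [Nonempty V] {T : SimpleGraph V} (hT : ∀ σ ∈ Φ, IsNestedTree σ T)
    {Q : ↥((forced A)ᶜ) → Set (forced A)} (hQ : IsPurified Φ (starTree A) Q)
    (v : ↥((forced A)ᶜ)) : (Q v).Nonempty := by
  have hstar := starTree_eq hΦ hT hA
  have hnest : ∀ σ ∈ Φ, IsNestedTree (restrictOrder (forced A) σ) (starTree A) :=
    fun σ hσ => isNestedTree_starTree hΦ hT hA hσ
  have hr := exists_forced_isFirst hΦ hA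
  have hex : ∀ v : ↥((forced A)ᶜ), ∃ y, Anchor Φ T (forced A) v y := by
    obtain ⟨σ, hσ⟩ := hΦ
    refine fun v => exists_anchor (hT σ hσ)
      (fun v hv => exists_lt_of_free ⟨σ, hσ⟩ hA hv hσ) (fun τ hτ u v huv hadj hv => ?_) v v.2
    exact lt_of_parent_of_free ⟨σ, hσ⟩ hT hA hσ hτ huv hadj hv
  have hle : ∀ v : ↥((forced A)ᶜ), {y : forced A | Anchor Φ T (forced A) v y} ⊆
      candidates Φ (starTree A) v := by
    intro v y hy
    rw [mem_candidates_iff hnest hr, hstar]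
    refine fun σ hσ => ⟨hy.lt hσ, fun p c hadj hpv hvc => ?_, fun p b hadj hyb hbv hpb => ?_⟩
    · exact hy.parent_le hσ (hT σ hσ)
        (fun u v huv hadj hv => mem_forced_of_parent hΦ hT hA hσ huv hadj hv) p c c.2 hadj hpv hvc
    · exact hy.le_parent hσ (hT σ hσ) b p hyb hbv hpb hadj
  obtain ⟨y, hy⟩ := hex v
  refine ⟨⟨y, hy.mem⟩, hQ.le_of_isConsistent ?_ hle v hy⟩
  rw [isConsistent_iff_order hnest hr hle]
  intro σ hσ x v w hxv hx hv
  have key : ∀ y z : forced A, Anchor Φ T (forced A) v y → Anchor Φ T (forced A) x z →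
      σ.le (y : V) z := fun y z hy hz => hz.le_anchor hσ (hT σ hσ) hy
    (lt_of_le_of_lt (hv.2 y (hy.lt hσ)) hx.1) hxv
  constructor
  · intro q hq
    obtain ⟨z, hz⟩ := hex x
    exact ⟨⟨z, hz.mem⟩, hz, key q ⟨z, hz.mem⟩ hq hz⟩
  · intro q hq
    obtain ⟨z, hz⟩ := hex v
    exact ⟨⟨z, hz.mem⟩, hz, key ⟨z, hz.mem⟩ q hz hq⟩

include hΦ hA in
theorem spanningCoe_starTree_eq {T : SimpleGraph V} (hT : ∀ σ ∈ Φ, IsNestedTree σ T)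
    (hF : forced A = Set.univ) : (starTree A).spanningCoe = T := by
  rw [starTree_eq hΦ hT hA, spanningCoe_induce_of_eq_univ hF]

include hΦ hA in
theorem restrict_isDFSTreeSupport_iff [Nonempty V] :
    IsDFSTreeSupport (restrictOrder (forced A) '' Φ) (starTree A) ↔
      ∀ σ ∈ Φ, IsNestedTree (restrictOrder (forced A) σ) (starTree A) := by
  have hne : Nonempty (forced A) := by
    obtain ⟨σ, hσ⟩ := hΦ
    obtain ⟨r, -⟩ := exists_forced_isFirst ⟨σ, hσ⟩ hA σ hσ
    exact ⟨r⟩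
  rw [isDFSTreeSupport_iff (hΦ.image _), Set.forall_mem_image]

end Correctness

theorem exists_dfsTreeAlgorithm {V : Type u} [Finite V] [Nonempty V] {Φ : Set (LinearOrder V)}
    (hΦ : Φ.Nonempty) : ∃ r, DFSTreeAlgorithm Φ r := by
  obtain ⟨A, hA⟩ := exists_isAttachmentDigraph hΦ
  by_cases hc : (underlyingGraph A).Connected
  swap
  · exact ⟨_, .disconnected A hA hc⟩
  by_cases hF : forced A = Set.univ
  · by_cases hT : ∀ σ ∈ Φ, IsDFSOrdering (starTree A).spanningCoe σ
    · exact ⟨_, .allForced A hA hc hF hT⟩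
    · exact ⟨_, .allForcedNo A hA hc hF hT⟩
  by_cases hR : IsDFSTreeSupport (restrictOrder (forced A) '' Φ) (starTree A)
  swap
  · exact ⟨_, .restrictionNo A hA hc hF hR⟩
  obtain ⟨Q, hQ⟩ := exists_isPurified Φ (starTree A)
  by_cases hE : ∃ v, Q v = ∅
  · exact ⟨_, .noCandidate A hA hc hF hR Q hQ hE⟩
  · refine ⟨_, .assigned A hA hc hF hR Q hQ (fun v => ?_) (Finite.equivFin V)⟩
    exact Set.nonempty_iff_ne_empty.2 (not_exists.1 hE v)

theorem isDFSTreeSupport_of_algorithm {V : Type u} [Finite V] [Nonempty V]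
    {Φ : Set (LinearOrder V)} (hΦ : Φ.Nonempty) {T : SimpleGraph V}
    (h : DFSTreeAlgorithm Φ (some T)) : IsDFSTreeSupport Φ T := by
  cases h with
  | allForced A hA hc hF hT =>
    refine ⟨?_, hT⟩
    have : (starTree A).spanningCoe = underlyingGraph A := by
      rw [starTree, spanningCoe_induce_of_eq_univ hF]
    rw [this]
    exact isTree_of_forced_eq_univ hΦ hA hc hF
  | assigned A hA hc hF hR Q hQ hE f =>
    rw [isDFSTreeSupport_iff hΦ]
    exact isNestedTree_assignParents ((restrict_isDFSTreeSupport_iff hΦ hA).1 hR)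
      (exists_forced_isFirst hΦ hA) hQ hE f

theorem not_algorithm_none {V : Type u} [Finite V] [Nonempty V] {Φ : Set (LinearOrder V)}
    (hΦ : Φ.Nonempty) {T : SimpleGraph V} (hT : IsDFSTreeSupport Φ T) :
    ¬ DFSTreeAlgorithm Φ none := by
  intro h
  have hT' := (isDFSTreeSupport_iff hΦ T).1 hT
  cases h with
  | disconnected A hA hc => exact hc (connected_underlyingGraph hΦ hT' hA)
  | allForcedNo A hA hc hF h =>
    rw [spanningCoe_starTree_eq hΦ hA hT' hF] at h
    exact h hT.2
  | restrictionNo A hA hc hF hR =>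
    exact hR ((restrict_isDFSTreeSupport_iff hΦ hA).2
      fun σ hσ => isNestedTree_starTree hΦ hT' hA hσ)
  | noCandidate A hA hc hF hR Q hQ hE =>
    obtain ⟨v, hv⟩ := hE
    exact (candidates_nonempty_of_support hΦ hA hT' hQ v).ne_empty hv

theorem isCorrectAnswer_of_algorithm {V : Type u} [Finite V] [Nonempty V]
    {Φ : Set (LinearOrder V)} (hΦ : Φ.Nonempty) {r : Option (SimpleGraph V)}
    (h : DFSTreeAlgorithm Φ r) : IsCorrectAnswer Φ r := by
  cases r with
  | none => exact ⟨fun ⟨T, hT⟩ => absurd h (not_algorithm_none hΦ hT), fun _ => rfl⟩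
  | some T =>
    have hT := isDFSTreeSupport_of_algorithm hΦ h
    exact ⟨fun _ => ⟨T, rfl, hT⟩, fun hno => absurd ⟨T, hT⟩ hno⟩

/-! ## Bounded loops of the random access machine -/

@[simp] theorem RAMState.setReg_reg (s : RAMState) (x k y : ℕ) :
    (s.setReg x k).reg y = if y = x then k else s.reg y := by
  simp [RAMState.setReg, Function.update_apply]

@[simp] theorem RAMState.setReg_arr (s : RAMState) (x k : ℕ) : (s.setReg x k).arr = s.arr := rfl

open Classical in
/-- The number `1` for true propositions, and `0` for false ones. -/
noncomputable def truthValue (P : Prop) : ℕ := if P then 1 else 0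

@[simp] theorem truthValue_true : truthValue True = 1 := if_pos trivial

@[simp] theorem truthValue_false : truthValue False = 0 := if_neg id

theorem truthValue_of {P : Prop} (h : P) : truthValue P = 1 := if_pos h

theorem truthValue_of_not {P : Prop} (h : ¬ P) : truthValue P = 0 := if_neg h

/-- `for X := 0 to reg b - 1 do c`, with `reg X = 0` at the end. -/
def forLoop (X b : ℕ) (c : RAMProgram) : RAMProgram :=
  .seq (.assign X (.const 0))
    (.seq (.loop (.sub (.reg b) (.reg X)) (.seq c (.assign X (.add (.reg X) (.const 1)))))
      (.assign X (.const 0)))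

/-- The invariant must tolerate arbitrary values of the counter `X` and fix the bound register. A
round pays 4 units for the test and 4 for the increment; the final 8 cover the failing test and the
two resets. -/
theorem exec_forLoop {X b K t₀ : ℕ} {c : RAMProgram} (I : ℕ → RAMState → Prop)
    (hI : ∀ k s j, I k s → I k (s.setReg X j)) (hb : ∀ k s, I k s → s.reg b = K)
    (step : ∀ k < K, ∀ s, I k s → s.reg X = k →
      ∃ s' t, c.Exec s s' t ∧ t ≤ t₀ ∧ s'.reg X = k ∧ I (k + 1) s')
    (s : RAMState) (h0 : I 0 s) :
    ∃ s' t, (forLoop X b c).Exec s s' t ∧ t ≤ K * (t₀ + 8) + 8 ∧ s'.reg X = 0 ∧ I K s' := by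
  have key : ∀ j k s, k + j = K → I k s → s.reg X = k →
      ∃ s' t, (RAMProgram.loop (.sub (.reg b) (.reg X))
        (.seq c (.assign X (.add (.reg X) (.const 1))))).Exec s s' t ∧
        t ≤ j * (t₀ + 8) + 4 ∧ I K s' := by
    intro j
    induction j with
    | zero =>
      intro k s hk hs hX
      refine ⟨s, _, .loopFalse _ _ s ?_, ?_, ?_⟩
      · simp [RAMExpr.eval, hb k s hs, hX]; omega
      · simp [RAMExpr.cost]
      · rwa [← show k = K by omega]
    | succ j ih =>
      intro k s hk hs hX
      obtain ⟨s₁, t₁, h1, h2, h3, h4⟩ := step k (by omega) s hs hX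
      obtain ⟨s₂, t₂, h5, h6, h7⟩ := ih (k + 1) (s₁.setReg X (k + 1)) (by omega) (hI _ _ _ h4)
        (by simp)
      have h8 := RAMProgram.Exec.assign X (.add (.reg X) (.const 1)) s₁
      simp only [RAMExpr.eval, h3] at h8
      refine ⟨s₂, _, .loopTrue _ _ _ _ _ _ _ ?_ (.seq _ _ _ _ _ _ _ h1 h8) h5, ?_, h7⟩
      · simp [RAMExpr.eval, hb k s hs, hX]; omega
      · simp only [RAMExpr.cost, Nat.add_mul]; omega
  have h1 := RAMProgram.Exec.assign X (.const 0) s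
  obtain ⟨s₂, t₂, h2, h3, h4⟩ := key K 0 _ (by omega) (hI _ _ 0 h0) (by simp)
  have h5 := RAMProgram.Exec.assign X (.const 0) s₂
  refine ⟨_, _, .seq _ _ _ _ _ _ _ h1 (.seq _ _ _ _ _ _ _ h2 h5), ?_, ?_, hI _ _ _ h4⟩
  · simp only [RAMExpr.cost]; omega
  · simp [RAMExpr.eval]

/-! ## First-order formulas on the random access machine -/

/-- First-order formulas about the vertices, the orderings and binary relations between vertices.
Variables for vertices and for orderings are numbered separately. -/
inductive Formula
  | vlt (u v : ℕ)
  | lt (i u v : ℕ)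
  | rel (a u v : ℕ)
  | neg (φ : Formula)
  | and (φ ψ : Formula)
  | exV (x : ℕ) (φ : Formula)
  | exO (x : ℕ) (φ : Formula)

/-- The truth of a formula, for orderings `σ`, relations `R`, and values `ρ` and `τ` of the
variables. -/
def Formula.Holds {n m : ℕ} (σ : Fin m → LinearOrder (Fin n)) (R : ℕ → Fin n → Fin n → Prop) :
    Formula → (ℕ → Fin n) → (ℕ → Fin m) → Prop
  | vlt u v, ρ, _ => ρ u < ρ v
  | lt i u v, ρ, τ => (σ (τ i)).lt (ρ u) (ρ v)
  | rel a u v, ρ, _ => R a (ρ u) (ρ v)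
  | neg φ, ρ, τ => ¬ φ.Holds σ R ρ τ
  | and φ ψ, ρ, τ => φ.Holds σ R ρ τ ∧ ψ.Holds σ R ρ τ
  | exV x φ, ρ, τ => ∃ v, φ.Holds σ R (Function.update ρ x v) τ
  | exO x φ, ρ, τ => ∃ i, φ.Holds σ R ρ (Function.update τ x i)

/-- The register for the vertex variable `x`. -/
def vReg (x : ℕ) : ℕ := 4 * x + 2

/-- The register for the ordering variable `x`. -/
def oReg (x : ℕ) : ℕ := 4 * x + 3

/-- The register for results at nesting depth `d`. -/
def resReg (d : ℕ) : ℕ := 4 * d + 4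

/-- The register for saved values at nesting depth `d`. -/
def savReg (d : ℕ) : ℕ := 4 * d + 5

/-- The expression with value `1` if `e₁ < e₂`, and `0` otherwise. -/
def ltExpr (e₁ e₂ : RAMExpr) : RAMExpr := .sub (.const 1) (.sub (.add e₁ (.const 1)) e₂)

/-- Register `resReg d` becomes `1` if the program `c`, which decides a property at depth `d + 1`,
yields `1` for some value of register `X` below the value of register `b`. -/
def searchLoop (d X b : ℕ) (c : RAMProgram) : RAMProgram :=
  .seq (.assign (savReg d) (.reg X))
    (.seq (.assign (resReg d) (.const 0))
      (.seq (forLoop X b (.seq c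
          (.ite (.reg (resReg (d + 1))) (.assign (resReg d) (.const 1)) .skip)))
        (.assign X (.reg (savReg d)))))

/-- A program that decides a formula. -/
def Formula.compile : ℕ → Formula → RAMProgram
  | d, vlt u v => .assign (resReg d) (ltExpr (.reg (vReg u)) (.reg (vReg v)))
  | d, lt i u v => .assign (resReg d) (ltExpr (.arr 0 (.reg (oReg i)) (.reg (vReg u)))
      (.arr 0 (.reg (oReg i)) (.reg (vReg v))))
  | d, rel a u v => .assign (resReg d) (.arr (a + 2) (.reg (vReg u)) (.reg (vReg v)))
  | d, neg φ => .seq (φ.compile d) (.assign (resReg d) (.sub (.const 1) (.reg (resReg d))))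
  | d, and φ ψ => .seq (φ.compile d) (.ite (.reg (resReg d)) (ψ.compile d) .skip)
  | d, exV x φ => searchLoop d (vReg x) 0 (φ.compile (d + 1))
  | d, exO x φ => searchLoop d (oReg x) 1 (φ.compile (d + 1))

open Polynomial in
/-- A bound for the running time of `φ.compile`. -/
noncomputable def Formula.time : Formula → ℕ[X]
  | vlt _ _ => 20
  | lt _ _ _ => 20
  | rel _ _ _ => 20
  | neg φ => φ.time + 20
  | and φ ψ => φ.time + ψ.time + 20
  | exV _ φ => X * (φ.time + 20) + 20
  | exO _ φ => X * (φ.time + 20) + 20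

/-- The memory `s` holds the orderings `σ`, the relations `R`, and the values `ρ` and `τ` of the
variables. -/
structure Models {n m : ℕ} (σ : Fin m → LinearOrder (Fin n)) (R : ℕ → Fin n → Fin n → Prop)
    (ρ : ℕ → Fin n) (τ : ℕ → Fin m) (s : RAMState) : Prop where
  reg_zero : s.reg 0 = n
  reg_one : s.reg 1 = m
  reg_vReg : ∀ x, s.reg (vReg x) = ρ x
  reg_oReg : ∀ x, s.reg (oReg x) = τ x
  arr_zero : ∀ (i : Fin m) (v : Fin n), s.arr 0 i v = pos (σ i) v
  arr_rel : ∀ (a : ℕ) (u v : Fin n), s.arr (a + 2) u v = truthValue (R a u v)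

/-- The registers that a program of depth `d` does not change. -/
def IsStable (d r : ℕ) : Prop := r < 4 * d + 4 ∨ 2 ≤ r % 4

/-- The changes from `s` to `s'` affect only the registers available at depth `d`. -/
def Frame (d : ℕ) (s s' : RAMState) : Prop :=
  s'.arr = s.arr ∧ ∀ r, IsStable d r → s'.reg r = s.reg r

theorem Frame.trans {d : ℕ} {s s' s'' : RAMState} (h : Frame d s s') (h' : Frame d s' s'') :
    Frame d s s'' :=
  ⟨h'.1.trans h.1, fun r hr => (h'.2 r hr).trans (h.2 r hr)⟩

theorem Frame.setReg {d : ℕ} {s s' : RAMState} (h : Frame d s s') {x : ℕ} (hx : ¬ IsStable d x)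
    (k : ℕ) : Frame d s (s'.setReg x k) := by
  refine ⟨h.1, fun r hr => ?_⟩
  rw [RAMState.setReg_reg, if_neg (fun hrx : r = x => hx (hrx ▸ hr))]
  exact h.2 r hr

theorem Frame.refl (d : ℕ) (s : RAMState) : Frame d s s := ⟨rfl, fun _ _ => rfl⟩

theorem not_isStable_resReg (d : ℕ) : ¬ IsStable d (resReg d) := by
  simp only [IsStable, resReg]; omega

theorem not_isStable_savReg (d : ℕ) : ¬ IsStable d (savReg d) := by
  simp only [IsStable, savReg]; omega

theorem isStable_vReg (d x : ℕ) : IsStable d (vReg x) := by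
  simp only [IsStable, vReg]; omega

theorem isStable_oReg (d x : ℕ) : IsStable d (oReg x) := by
  simp only [IsStable, oReg]; omega

theorem Models.of_frame {n m : ℕ} {σ : Fin m → LinearOrder (Fin n)}
    {R : ℕ → Fin n → Fin n → Prop} {ρ : ℕ → Fin n} {τ : ℕ → Fin m} {d : ℕ} {s s' : RAMState}
    (hs : Models σ R ρ τ s) (h : Frame d s s') : Models σ R ρ τ s' where
  reg_zero := (h.2 0 (Or.inl (by omega))).trans hs.reg_zero
  reg_one := (h.2 1 (Or.inl (by omega))).trans hs.reg_one
  reg_vReg x := (h.2 _ (isStable_vReg d x)).trans (hs.reg_vReg x)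
  reg_oReg x := (h.2 _ (isStable_oReg d x)).trans (hs.reg_oReg x)
  arr_zero i v := by rw [h.1]; exact hs.arr_zero i v
  arr_rel a u v := by rw [h.1]; exact hs.arr_rel a u v

/-- The searched variable may already be in use outside, so its register is saved and restored. The
body works at depth `d + 1` and leaves the result and save registers of depth `d` alone. -/
theorem exec_searchLoop {d X b K t₀ : ℕ} {c : RAMProgram} (P : ℕ → Prop) (hX : 2 ≤ X % 4)
    (hb : b < 2) (s₀ : RAMState) (hs₀ : s₀.reg b = K)
    (step : ∀ k < K, ∀ s, s.arr = s₀.arr → s.reg X = k →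
      (∀ r, r ≠ X → IsStable d r → s.reg r = s₀.reg r) →
      ∃ s' t, c.Exec s s' t ∧ t ≤ t₀ ∧ Frame (d + 1) s s' ∧
        s'.reg (resReg (d + 1)) = truthValue (P k)) :
    ∃ s' t, (searchLoop d X b c).Exec s₀ s' t ∧ t ≤ K * (t₀ + 20) + 20 ∧ Frame d s₀ s' ∧
      s'.reg (resReg d) = truthValue (∃ k < K, P k) := by
  have hXs : X ≠ savReg d := by simp only [savReg]; omega
  have hXr : X ≠ resReg d := by simp only [resReg]; omega
  have hsr : savReg d ≠ resReg d := by simp only [resReg, savReg]; omega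
  have hstep : ∀ r, IsStable d r ∨ r = resReg d ∨ r = savReg d → IsStable (d + 1) r := by
    intro r; simp only [IsStable, resReg, savReg]; omega
  let I : ℕ → RAMState → Prop := fun k s => s.arr = s₀.arr ∧
    (∀ r, r ≠ X → IsStable d r → s.reg r = s₀.reg r) ∧ s.reg (savReg d) = s₀.reg X ∧
    s.reg (resReg d) = truthValue (∃ j < k, P j)
  have hIset : ∀ k s j, I k s → I k (s.setReg X j) := by
    rintro k s j ⟨h1, h2, h3, h4⟩
    refine ⟨h1, fun r hr hr' => ?_, ?_, ?_⟩
    · rw [RAMState.setReg_reg, if_neg hr]; exact h2 r hr hr'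
    · rw [RAMState.setReg_reg, if_neg hXs.symm]; exact h3
    · rw [RAMState.setReg_reg, if_neg hXr.symm]; exact h4
  have hIb : ∀ k s, I k s → s.reg b = K := fun k s h =>
    (h.2.1 b (by rintro rfl; omega) (Or.inl (by omega))).trans hs₀
  have hIstep : ∀ k < K, ∀ s, I k s → s.reg X = k → ∃ s' t, (RAMProgram.seq c
      (.ite (.reg (resReg (d + 1))) (.assign (resReg d) (.const 1)) .skip)).Exec s s' t ∧
      t ≤ t₀ + 4 ∧ s'.reg X = k ∧ I (k + 1) s' := by
    rintro k hk s ⟨h1, h2, h3, h4⟩ hsX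
    obtain ⟨s', t, h5, h6, h7, h8⟩ := step k hk s h1 hsX h2
    have hX' : s'.reg X = k := (h7.2 X (Or.inr hX)).trans hsX
    have h2' : ∀ r, r ≠ X → IsStable d r → s'.reg r = s₀.reg r := fun r hr hr' =>
      (h7.2 r (hstep r (Or.inl hr'))).trans (h2 r hr hr')
    have h3' : s'.reg (savReg d) = s₀.reg X :=
      (h7.2 _ (hstep _ (Or.inr (Or.inr rfl)))).trans h3
    have h4' : s'.reg (resReg d) = truthValue (∃ j < k, P j) :=
      (h7.2 _ (hstep _ (Or.inr (Or.inl rfl)))).trans h4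
    by_cases hP : P k
    · rw [truthValue_of hP] at h8
      have h9 := RAMProgram.Exec.assign (resReg d) (.const 1) s'
      refine ⟨_, _, .seq _ _ _ _ _ _ _ h5 (.iteTrue _ _ _ _ _ _ ?_ h9), ?_, ?_,
        h7.1.trans h1, fun r hr hr' => ?_, ?_, ?_⟩
      · simp [RAMExpr.eval, h8]
      · simp only [RAMExpr.cost]; omega
      · rw [RAMState.setReg_reg, if_neg hXr]; exact hX'
      · rw [RAMState.setReg_reg, if_neg (fun h : r = resReg d => not_isStable_resReg d (h ▸ hr'))]
        exact h2' r hr hr'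
      · rw [RAMState.setReg_reg, if_neg hsr]; exact h3'
      · rw [RAMState.setReg_reg, if_pos rfl, truthValue_of ⟨k, by omega, hP⟩]; rfl
    · rw [truthValue_of_not hP] at h8
      refine ⟨_, _, .seq _ _ _ _ _ _ _ h5 (.iteFalse _ _ _ _ _ _ ?_ (.skip s')), ?_, hX',
        h7.1.trans h1, h2', h3', ?_⟩
      · simp [RAMExpr.eval, h8]
      · simp only [RAMExpr.cost]; omega
      · rw [h4']
        congr 1
        refine propext (exists_congr fun j => ⟨fun ⟨h, h'⟩ => ⟨by omega, h'⟩, fun ⟨h, h'⟩ => ?_⟩)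
        rcases Nat.lt_succ_iff_lt_or_eq.1 h with h | rfl
        · exact ⟨h, h'⟩
        · exact absurd h' hP
  have e1 := RAMProgram.Exec.assign (savReg d) (.reg X) s₀
  have e2 := RAMProgram.Exec.assign (resReg d) (.const 0) (s₀.setReg (savReg d) (s₀.reg X))
  have hI0 : I 0 ((s₀.setReg (savReg d) (s₀.reg X)).setReg (resReg d) 0) := by
    refine ⟨rfl, fun r _ hr => ?_, ?_, ?_⟩
    · rw [RAMState.setReg_reg, if_neg (fun h : r = resReg d => not_isStable_resReg d (h ▸ hr)),
        RAMState.setReg_reg, if_neg (fun h : r = savReg d => not_isStable_savReg d (h ▸ hr))]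
    · simp [hsr]
    · simp
  obtain ⟨s₁, t₁, e3, h1, h2, h3, h4, h5, h6⟩ := exec_forLoop I hIset hIb hIstep _ hI0
  have e4 := RAMProgram.Exec.assign X (.reg (savReg d)) s₁
  refine ⟨_, _, .seq _ _ _ _ _ _ _ e1 (.seq _ _ _ _ _ _ _ e2 (.seq _ _ _ _ _ _ _ e3 e4)),
    ?_, ⟨h3, fun r hr => ?_⟩, ?_⟩
  · simp only [RAMExpr.cost]
    have : K * (t₀ + 4 + 8) ≤ K * (t₀ + 20) := Nat.mul_le_mul_left _ (by omega)
    omega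
  · by_cases hrX : r = X
    · subst hrX
      simp [RAMExpr.eval, h5]
    · rw [RAMState.setReg_reg, if_neg hrX]
      exact h4 r hrX hr
  · rw [RAMState.setReg_reg, if_neg hXr.symm]
    exact h6

section Machine

variable {n m : ℕ} {σ : Fin m → LinearOrder (Fin n)} {R : ℕ → Fin n → Fin n → Prop} {N : ℕ}

theorem ltExpr_eval (s : RAMState) (e₁ e₂ : RAMExpr) :
    (ltExpr e₁ e₂).eval s = truthValue (e₁.eval s < e₂.eval s) := by
  simp only [ltExpr, RAMExpr.eval]
  by_cases h : e₁.eval s < e₂.eval s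
  · rw [truthValue_of h]; omega
  · rw [truthValue_of_not h]; omega

theorem Models.update_vReg {ρ : ℕ → Fin n} {τ : ℕ → Fin m} {s₀ s : RAMState}
    (h : Models σ R ρ τ s₀) {d x : ℕ} {v : Fin n} (harr : s.arr = s₀.arr)
    (hx : s.reg (vReg x) = v) (hreg : ∀ r, r ≠ vReg x → IsStable d r → s.reg r = s₀.reg r) :
    Models σ R (Function.update ρ x v) τ s where
  reg_zero := (hreg 0 (by simp only [vReg]; omega) (Or.inl (by omega))).trans h.reg_zero
  reg_one := (hreg 1 (by simp only [vReg]; omega) (Or.inl (by omega))).trans h.reg_one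
  reg_vReg y := by
    by_cases hy : y = x
    · subst hy; rw [Function.update_self]; exact hx
    · rw [Function.update_of_ne hy, ← h.reg_vReg]
      exact hreg _ (by simp only [vReg]; omega) (isStable_vReg d y)
  reg_oReg y := by
    rw [← h.reg_oReg]
    exact hreg _ (by simp only [vReg, oReg]; omega) (isStable_oReg d y)
  arr_zero i v := by rw [harr]; exact h.arr_zero i v
  arr_rel a u v := by rw [harr]; exact h.arr_rel a u v

theorem Models.update_oReg {ρ : ℕ → Fin n} {τ : ℕ → Fin m} {s₀ s : RAMState}
    (h : Models σ R ρ τ s₀) {d x : ℕ} {i : Fin m} (harr : s.arr = s₀.arr)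
    (hx : s.reg (oReg x) = i) (hreg : ∀ r, r ≠ oReg x → IsStable d r → s.reg r = s₀.reg r) :
    Models σ R ρ (Function.update τ x i) s where
  reg_zero := (hreg 0 (by simp only [oReg]; omega) (Or.inl (by omega))).trans h.reg_zero
  reg_one := (hreg 1 (by simp only [oReg]; omega) (Or.inl (by omega))).trans h.reg_one
  reg_vReg y := by
    rw [← h.reg_vReg]
    exact hreg _ (by simp only [vReg, oReg]; omega) (isStable_vReg d y)
  reg_oReg y := by
    by_cases hy : y = x
    · subst hy; rw [Function.update_self]; exact hx
    · rw [Function.update_of_ne hy, ← h.reg_oReg]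
      exact hreg _ (by simp only [oReg]; omega) (isStable_oReg d y)
  arr_zero i v := by rw [harr]; exact h.arr_zero i v
  arr_rel a u v := by rw [harr]; exact h.arr_rel a u v

theorem truthValue_congr {P Q : Prop} (h : P ↔ Q) : truthValue P = truthValue Q := by
  rw [propext h]

/-- The compiled program decides the formula. -/
theorem Formula.exec_compile (hn : n ≤ N) (hm : m ≤ N) (φ : Formula) (d : ℕ) (ρ : ℕ → Fin n)
    (τ : ℕ → Fin m) (s : RAMState) (hs : Models σ R ρ τ s) :
    ∃ s' t, (φ.compile d).Exec s s' t ∧ t ≤ φ.time.eval N ∧ Frame d s s' ∧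
      s'.reg (resReg d) = truthValue (φ.Holds σ R ρ τ) := by
  have hset : ∀ k, Frame d s (s.setReg (resReg d) k) := fun k =>
    (Frame.refl d s).setReg (not_isStable_resReg d) k
  induction φ generalizing d ρ τ s with
  | vlt u v =>
    refine ⟨_, _, .assign _ _ s, ?_, hset _, ?_⟩
    · simp [RAMExpr.cost, ltExpr, time]
    · rw [RAMState.setReg_reg, if_pos rfl, ltExpr_eval]
      refine truthValue_congr ?_
      simp only [RAMExpr.eval, hs.reg_vReg, Holds]
      rfl
  | lt i u v =>
    refine ⟨_, _, .assign _ _ s, ?_, hset _, ?_⟩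
    · simp [RAMExpr.cost, ltExpr, time]
    · rw [RAMState.setReg_reg, if_pos rfl, ltExpr_eval]
      refine truthValue_congr ?_
      simp only [RAMExpr.eval, hs.reg_vReg, hs.reg_oReg, hs.arr_zero, Holds]
      exact pos_lt_pos_iff _
  | rel a u v =>
    refine ⟨_, _, .assign _ _ s, ?_, hset _, ?_⟩
    · simp [RAMExpr.cost, time]
    · rw [RAMState.setReg_reg, if_pos rfl]
      simp only [RAMExpr.eval, hs.reg_vReg, hs.arr_rel, Holds]
  | neg φ ih =>
    obtain ⟨s₁, t₁, h1, h2, h3, h4⟩ := ih d ρ τ s hs hset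
    refine ⟨_, _, .seq _ _ _ _ _ _ _ h1 (.assign _ _ s₁), ?_,
      h3.setReg (not_isStable_resReg d) _, ?_⟩
    · simp [RAMExpr.cost, time]; omega
    · rw [RAMState.setReg_reg, if_pos rfl]
      simp only [RAMExpr.eval, h4, Holds]
      by_cases h : φ.Holds σ R ρ τ <;> simp [h]
  | and φ ψ ih ih' =>
    obtain ⟨s₁, t₁, h1, h2, h3, h4⟩ := ih d ρ τ s hs hset
    by_cases h : φ.Holds σ R ρ τ
    · obtain ⟨s₂, t₂, h5, h6, h7, h8⟩ := ih' d ρ τ s₁ (hs.of_frame h3)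
        (fun k => (Frame.refl d s₁).setReg (not_isStable_resReg d) k)
      refine ⟨_, _, .seq _ _ _ _ _ _ _ h1 (.iteTrue _ _ _ _ _ _ ?_ h5), ?_, h3.trans h7, ?_⟩
      · simp [RAMExpr.eval, h4, h]
      · simp [RAMExpr.cost, time]; omega
      · rw [h8]; exact truthValue_congr (by simp [Holds, h])
    -- When `φ` fails, the result register already holds the correct value `0`.
    · refine ⟨_, _, .seq _ _ _ _ _ _ _ h1 (.iteFalse _ _ _ _ _ _ ?_ (.skip s₁)), ?_, h3, ?_⟩
      · simp [RAMExpr.eval, h4, h]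
      · simp [RAMExpr.cost, time]; omega
      · rw [h4]; exact truthValue_congr (by simp [Holds, h])
  | exV x φ ih =>
    obtain ⟨s₁, t₁, h1, h2, h3, h4⟩ := exec_searchLoop (d := d) (X := vReg x) (b := 0) (K := n)
      (t₀ := φ.time.eval N) (c := φ.compile (d + 1))
      (fun k => ∃ h : k < n, φ.Holds σ R (Function.update ρ x ⟨k, h⟩) τ)
      (by simp only [vReg]; omega) (by omega) s hs.reg_zero (by
        intro k hk s' harr hX hreg
        obtain ⟨s₁, t₁, h1, h2, h3, h4⟩ := ih (d + 1) (Function.update ρ x ⟨k, hk⟩) τ s'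
          (hs.update_vReg (d := d) harr hX hreg)
          (fun k => (Frame.refl _ s').setReg (not_isStable_resReg _) k)
        exact ⟨s₁, t₁, h1, h2, h3, h4.trans (truthValue_congr (by simp [hk]))⟩)
    refine ⟨s₁, t₁, h1, h2.trans ?_, h3, h4.trans (truthValue_congr ?_)⟩
    · simp only [time, Polynomial.eval_add, Polynomial.eval_mul, Polynomial.eval_X,
        Polynomial.eval_ofNat]
      exact Nat.add_le_add_right (Nat.mul_le_mul_right _ hn) _
    · constructor
      · rintro ⟨k, hk, hk', h⟩
        exact ⟨⟨k, hk'⟩, h⟩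
      · rintro ⟨v, h⟩
        exact ⟨v, v.2, v.2, h⟩
  | exO x φ ih =>
    obtain ⟨s₁, t₁, h1, h2, h3, h4⟩ := exec_searchLoop (d := d) (X := oReg x) (b := 1) (K := m)
      (t₀ := φ.time.eval N) (c := φ.compile (d + 1))
      (fun k => ∃ h : k < m, φ.Holds σ R ρ (Function.update τ x ⟨k, h⟩))
      (by simp only [oReg]; omega) (by omega) s hs.reg_one (by
        intro k hk s' harr hX hreg
        obtain ⟨s₁, t₁, h1, h2, h3, h4⟩ := ih (d + 1) ρ (Function.update τ x ⟨k, hk⟩) s'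
          (hs.update_oReg (d := d) harr hX hreg)
          (fun k => (Frame.refl _ s').setReg (not_isStable_resReg _) k)
        exact ⟨s₁, t₁, h1, h2, h3, h4.trans (truthValue_congr (by simp [hk]))⟩)
    refine ⟨s₁, t₁, h1, h2.trans ?_, h3, h4.trans (truthValue_congr ?_)⟩
    · simp only [time, Polynomial.eval_add, Polynomial.eval_mul, Polynomial.eval_X,
        Polynomial.eval_ofNat]
      exact Nat.add_le_add_right (Nat.mul_le_mul_right _ hm) _
    · constructor
      · rintro ⟨k, hk, hk', h⟩
        exact ⟨⟨k, hk'⟩, h⟩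
      · rintro ⟨v, h⟩
        exact ⟨v, v.2, v.2, h⟩

end Machine

/-! ## Definitions of relations by formulas -/

/-- For all pairs of vertices, with the first one in register `vReg 0` and the second one in
register `vReg 1`. -/
def forPairs (c : RAMProgram) : RAMProgram := forLoop (vReg 0) 0 (forLoop (vReg 1) 0 c)

/-- Tabulate the relation that a formula defines in array `1`. -/
def tabulate (d : ℕ) (φ : Formula) : RAMProgram :=
  forPairs (.seq (φ.compile d) (.store 1 (.reg (vReg 0)) (.reg (vReg 1)) (.reg (resReg d))))

/-- Redefine the relation number `a` by a formula. -/
def defineRel (d a : ℕ) (φ : Formula) : RAMProgram :=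
  .seq (tabulate d φ) (forPairs (.store (a + 2) (.reg (vReg 0)) (.reg (vReg 1))
    (.arr 1 (.reg (vReg 0)) (.reg (vReg 1)))))

/-- Execute a program as often as there are vertices. -/
def repeatLoop (d : ℕ) (c : RAMProgram) : RAMProgram := forLoop (resReg d) 0 c

section Machine

variable {n m : ℕ} {σ : Fin m → LinearOrder (Fin n)} {N : ℕ}

/-- Filling an array by a loop over all pairs of vertices. -/
theorem exec_forPairs {d A t₀ : ℕ} {c : RAMProgram} (g : Fin n → Fin n → ℕ) (s₀ : RAMState)
    (hs₀ : s₀.reg 0 = n)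
    (step : ∀ (k l : Fin n) (s : RAMState), s.reg (vReg 0) = k → s.reg (vReg 1) = l →
      (∀ r, r ≠ vReg 0 → r ≠ vReg 1 → IsStable d r → s.reg r = s₀.reg r) →
      (∀ a, a ≠ A → s.arr a = s₀.arr a) →
      ∃ s' t, c.Exec s s' t ∧ t ≤ t₀ ∧ (∀ r, IsStable d r → s'.reg r = s.reg r) ∧
        s'.arr = (s.setArr A k l (g k l)).arr) :
    ∃ s' t, (forPairs c).Exec s₀ s' t ∧ t ≤ n * (n * (t₀ + 8) + 16) + 8 ∧
      (∀ r, r ≠ vReg 0 → r ≠ vReg 1 → IsStable d r → s'.reg r = s₀.reg r) ∧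
      s'.reg (vReg 0) = 0 ∧ (0 < n → s'.reg (vReg 1) = 0) ∧
      (∀ a, a ≠ A → s'.arr a = s₀.arr a) ∧ ∀ u v : Fin n, s'.arr A u v = g u v := by
  have h01 : vReg 0 ≠ vReg 1 := by simp [vReg]
  have h0 : (0 : ℕ) ≠ vReg 0 ∧ (0 : ℕ) ≠ vReg 1 := by simp [vReg]
  -- The entries lexicographically before `(k, l)` are filled; only the two counters and array `A`
  -- are allowed to change otherwise.
  let J : ℕ → ℕ → RAMState → Prop := fun k l s =>
    (∀ r, r ≠ vReg 0 → r ≠ vReg 1 → IsStable d r → s.reg r = s₀.reg r) ∧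
    (∀ a, a ≠ A → s.arr a = s₀.arr a) ∧
    ∀ u v : Fin n, ((u : ℕ) < k ∨ ((u : ℕ) = k ∧ (v : ℕ) < l)) → s.arr A u v = g u v
  have hJ0 : ∀ k l s j, J k l s → J k l (s.setReg (vReg 0) j) := by
    rintro k l s j ⟨h1, h2, h3⟩
    exact ⟨fun r hr hr' hr'' => by rw [RAMState.setReg_reg, if_neg hr]; exact h1 r hr hr' hr'',
      h2, h3⟩
  have hJ1 : ∀ k l s j, J k l s → J k l (s.setReg (vReg 1) j) := by
    rintro k l s j ⟨h1, h2, h3⟩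
    exact ⟨fun r hr hr' hr'' => by rw [RAMState.setReg_reg, if_neg hr']; exact h1 r hr hr' hr'',
      h2, h3⟩
  have hJn : ∀ k l s, J k l s → s.reg 0 = n := fun k l s h =>
    (h.1 0 h0.1 h0.2 (Or.inl (by omega))).trans hs₀
  -- The inner counter is known to be `0` only once the inner loop has run, hence the side condition
  -- `0 < k`.
  have inner : ∀ k < n, ∀ s, (J k 0 s ∧ (0 < k → s.reg (vReg 1) = 0)) → s.reg (vReg 0) = k →
      ∃ s' t, (forLoop (vReg 1) 0 c).Exec s s' t ∧ t ≤ n * (t₀ + 8) + 8 ∧ s'.reg (vReg 0) = k ∧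
        (J (k + 1) 0 s' ∧ (0 < k + 1 → s'.reg (vReg 1) = 0)) := by
    intro k hk s hs hsk
    obtain ⟨s', t, h1, h2, h3, h4⟩ := exec_forLoop (X := vReg 1) (b := 0) (K := n) (t₀ := t₀)
      (c := c) (fun l s => J k l s ∧ s.reg (vReg 0) = k)
      (fun l s j h => ⟨hJ1 _ _ _ _ h.1, by rw [RAMState.setReg_reg, if_neg h01]; exact h.2⟩)
      (fun l s h => hJn _ _ _ h.1)
      (by
        rintro l hl s ⟨⟨h1, h2, h3⟩, hsk⟩ hsl
        obtain ⟨s', t, h4, h5, h6, h7⟩ := step ⟨k, hk⟩ ⟨l, hl⟩ s hsk hsl h1 h2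
        refine ⟨s', t, h4, h5, (h6 _ (isStable_vReg d 1)).trans hsl,
          ⟨fun r hr hr' hr'' => (h6 r hr'').trans (h1 r hr hr' hr''), fun a ha => ?_,
            fun u v huv => ?_⟩, (h6 _ (isStable_vReg d 0)).trans hsk⟩
        · rw [h7, ← h2 a ha]
          funext i j
          simp [RAMState.setArr, ha]
        · rw [h7]
          simp only [RAMState.setArr, true_and]
          split_ifs with h
          · rw [show u = ⟨k, hk⟩ from Fin.ext h.1, show v = ⟨l, hl⟩ from Fin.ext h.2]
          · refine h3 u v ?_
            omega)
      s ⟨hs.1, hsk⟩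
    refine ⟨s', t, h1, h2, h4.2, ⟨h4.1.1, h4.1.2.1, fun u v huv => h4.1.2.2 u v ?_⟩, fun _ => h3⟩
    have := v.2
    omega
  obtain ⟨s', t, h1, h2, h3, h4⟩ := exec_forLoop (X := vReg 0) (b := 0) (K := n)
    (t₀ := n * (t₀ + 8) + 8) (c := forLoop (vReg 1) 0 c)
    (fun k s => J k 0 s ∧ (0 < k → s.reg (vReg 1) = 0))
    (fun l s j h => ⟨hJ0 _ _ _ _ h.1,
      fun hl => by rw [RAMState.setReg_reg, if_neg h01.symm]; exact h.2 hl⟩)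
    (fun l s h => hJn _ _ _ h.1) inner s₀
    ⟨⟨fun _ _ _ _ => rfl, fun _ _ => rfl, fun u v h => by omega⟩, fun h => by omega⟩
  exact ⟨s', t, h1, h2, h4.1.1, h3, h4.2, h4.1.2.1, fun u v => h4.1.2.2 u v (Or.inl u.2)⟩

/-- The memory holds the orderings `σ`, the relations `R`, and some values of the variables. -/
def Represents (σ : Fin m → LinearOrder (Fin n)) (R : ℕ → Fin n → Fin n → Prop) (s : RAMState) :
    Prop :=
  ∃ ρ τ, Models σ R ρ τ s

/-- The value of variables `0` and `1` after a loop over all pairs. -/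
theorem Models.reset {R R' : ℕ → Fin n → Fin n → Prop} {ρ : ℕ → Fin n} {τ : ℕ → Fin m}
    {s₀ s : RAMState} {d : ℕ} (h : Models σ R ρ τ s₀)
    (hreg : ∀ r, r ≠ vReg 0 → r ≠ vReg 1 → IsStable d r → s.reg r = s₀.reg r)
    (h0 : s.reg (vReg 0) = 0) (h1 : s.reg (vReg 1) = 0)
    (harr : ∀ (i : Fin m) (v : Fin n), s.arr 0 i v = s₀.arr 0 i v)
    (hR : ∀ (a : ℕ) (u v : Fin n), s.arr (a + 2) u v = truthValue (R' a u v)) :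
    Represents σ R' s := by
  have hn : 0 < n := (Nat.zero_le _).trans_lt (ρ 0).2
  refine ⟨fun x => if x < 2 then ⟨0, hn⟩ else ρ x, τ, ?_, ?_, fun x => ?_, fun x => ?_,
    fun i v => (harr i v).trans (h.arr_zero i v), hR⟩
  · exact (hreg 0 (by simp [vReg]) (by simp [vReg]) (Or.inl (by omega))).trans h.reg_zero
  · exact (hreg 1 (by simp [vReg]) (by simp [vReg]) (Or.inl (by omega))).trans h.reg_one
  · by_cases hx : x < 2
    · rw [if_pos hx]
      rcases (by omega : x = 0 ∨ x = 1) with rfl | rfl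
      · exact h0
      · exact h1
    · rw [if_neg hx, ← h.reg_vReg]
      exact hreg _ (by simp only [vReg]; omega) (by simp only [vReg]; omega) (isStable_vReg d x)
  · rw [← h.reg_oReg]
    exact hreg _ (by simp only [vReg, oReg]; omega) (by simp only [vReg, oReg]; omega)
      (isStable_oReg d x)

open Polynomial in
-- The loop counters are the registers of variables `0` and `1`, and by `hφ` the truth of the
-- formula depends on these alone, so leftover values of other variables are harmless.
theorem exec_tabulate (hn : n ≤ N) (hm : m ≤ N) {R : ℕ → Fin n → Fin n → Prop} (φ : Formula)
    (S : Fin n → Fin n → Prop) (hφ : ∀ ρ τ, φ.Holds σ R ρ τ ↔ S (ρ 0) (ρ 1)) (d : ℕ)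
    (s : RAMState) (hs : Represents σ R s) :
    ∃ s' t, (tabulate d φ).Exec s s' t ∧
      t ≤ (X * (X * (φ.time + 20) + 20) + 20 : ℕ[X]).eval N ∧ Represents σ R s' ∧
      (∀ k < d, s'.reg (resReg k) = s.reg (resReg k)) ∧
      ∀ u v : Fin n, s'.arr 1 u v = truthValue (S u v) := by
  obtain ⟨ρ, τ, hs⟩ := hs
  have hn0 : 0 < n := (Nat.zero_le _).trans_lt (ρ 0).2
  obtain ⟨s', t, h1, h2, h3, h4, h5, h6, h7⟩ := exec_forPairs (d := d) (A := 1)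
    (t₀ := φ.time.eval N + 4)
    (c := .seq (φ.compile d) (.store 1 (.reg (vReg 0)) (.reg (vReg 1)) (.reg (resReg d))))
    (fun u v => truthValue (S u v)) s hs.reg_zero (by
      intro k l s' hk hl hreg harr
      have hM : Models σ R (Function.update (Function.update ρ 0 k) 1 l) τ s' := by
        refine ⟨?_, ?_, fun x => ?_, fun x => ?_, fun i v => ?_, fun a u v => ?_⟩
        · exact (hreg 0 (by simp [vReg]) (by simp [vReg]) (Or.inl (by omega))).trans hs.reg_zero
        · exact (hreg 1 (by simp [vReg]) (by simp [vReg]) (Or.inl (by omega))).trans hs.reg_one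
        · simp only [Function.update_apply]
          split_ifs with hx1 hx0
          · rw [hx1]; exact hl
          · rw [hx0]; exact hk
          · rw [← hs.reg_vReg]
            exact hreg _ (by simp only [vReg]; omega) (by simp only [vReg]; omega)
              (isStable_vReg d x)
        · rw [← hs.reg_oReg]
          exact hreg _ (by simp only [vReg, oReg]; omega) (by simp only [vReg, oReg]; omega)
            (isStable_oReg d x)
        · rw [harr 0 (by omega)]; exact hs.arr_zero i v
        · rw [harr (a + 2) (by omega)]; exact hs.arr_rel a u v
      obtain ⟨s₁, t₁, h1, h2, h3, h4⟩ := φ.exec_compile hn hm d _ τ s' hM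
      refine ⟨_, _, .seq _ _ _ _ _ _ _ h1 (.store _ _ _ _ s₁), ?_, fun r hr => h3.2 r hr, ?_⟩
      · simp only [RAMExpr.cost]; omega
      · simp only [RAMExpr.eval, h4, h3.2 _ (isStable_vReg d _), hk, hl]
        rw [truthValue_congr (hφ _ _)]
        simp [RAMState.setArr, h3.1])
  refine ⟨s', t, h1, h2.trans ?_, hs.reset h3 h4 (h5 hn0) (fun i v => by rw [h6 0 (by omega)])
    (fun a u v => ?_), fun k hk => h3 _ ?_ ?_ ?_, h7⟩
  · simp only [eval_add, eval_mul, eval_X, eval_ofNat]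
    have : n * (φ.time.eval N + 4 + 8) ≤ N * (φ.time.eval N + 20) :=
      Nat.mul_le_mul hn (by omega)
    have := Nat.mul_le_mul hn (show n * (φ.time.eval N + 4 + 8) + 16 ≤
      N * (φ.time.eval N + 20) + 20 by omega)
    omega
  · rw [h6 (a + 2) (by omega)]; exact hs.arr_rel a u v
  · simp only [resReg, vReg]; omega
  · simp only [resReg, vReg]; omega
  · simp only [IsStable, resReg]; omega

/-- The program `c` of depth `d` transforms the relations as `f` does, within a time bounded by the
polynomial `p`. -/
def Implements (σ : Fin m → LinearOrder (Fin n)) (N d : ℕ) (c : RAMProgram)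
    (p : Polynomial ℕ) (f : (ℕ → Fin n → Fin n → Prop) → ℕ → Fin n → Fin n → Prop) : Prop :=
  ∀ R s, Represents σ R s → ∃ s' t, c.Exec s s' t ∧ t ≤ p.eval N ∧ Represents σ (f R) s' ∧
    ∀ k < d, s'.reg (resReg k) = s.reg (resReg k)

theorem Implements.seq {d : ℕ} {c c' : RAMProgram} {p p' : Polynomial ℕ}
    {f f' : (ℕ → Fin n → Fin n → Prop) → ℕ → Fin n → Fin n → Prop}
    (h : Implements σ N d c p f) (h' : Implements σ N d c' p' f') :
    Implements σ N d (.seq c c') (p + p') (fun R => f' (f R)) := by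
  intro R s hs
  obtain ⟨s₁, t₁, h1, h2, h3, h4⟩ := h R s hs
  obtain ⟨s₂, t₂, h5, h6, h7, h8⟩ := h' _ s₁ h3
  refine ⟨s₂, _, .seq _ _ _ _ _ _ _ h1 h5, ?_, h7, fun k hk => (h8 k hk).trans (h4 k hk)⟩
  rw [Polynomial.eval_add]
  omega

open Polynomial in
/-- A bound for the running time of `defineRel`. -/
noncomputable def Formula.defineTime (φ : Formula) : ℕ[X] :=
  (X * (X * (φ.time + 20) + 20) + 20) + (X * (X * 40 + 20) + 20)

open Polynomial in
theorem implements_defineRel (hn : n ≤ N) (hm : m ≤ N) (φ : Formula)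
    (S : (ℕ → Fin n → Fin n → Prop) → Fin n → Fin n → Prop)
    (hφ : ∀ R ρ τ, φ.Holds σ R ρ τ ↔ S R (ρ 0) (ρ 1)) (d a : ℕ) :
    Implements σ N d (defineRel d a φ) φ.defineTime (fun R => Function.update R a (S R)) := by
  intro R s hs
  obtain ⟨s₁, t₁, h1, h2, ⟨ρ, τ, h3⟩, h4, h5⟩ := exec_tabulate hn hm φ (S R) (hφ R) d s hs
  have hn0 : 0 < n := (Nat.zero_le _).trans_lt (ρ 0).2
  obtain ⟨s', t, e1, e2, e3, e4, e5, e6, e7⟩ := exec_forPairs (d := d) (A := a + 2)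
    (t₀ := 20) (c := (.store (a + 2) (.reg (vReg 0)) (.reg (vReg 1))
      (.arr 1 (.reg (vReg 0)) (.reg (vReg 1)))))
    (fun u v => truthValue (S R u v)) s₁ h3.reg_zero (by
      intro k l s hk hl _ harr
      refine ⟨_, _, .store _ _ _ _ s, ?_, fun r _ => rfl, ?_⟩
      · simp only [RAMExpr.cost]; omega
      · simp only [RAMExpr.eval, hk, hl, harr 1 (by omega), h5])
  refine ⟨s', _, .seq _ _ _ _ _ _ _ h1 e1, ?_, h3.reset e3 e4 (e5 hn0)
    (fun i v => by rw [e6 0 (by omega)]) (fun b u v => ?_), fun k hk => (e3 _ ?_ ?_ ?_).trans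
      (h4 k hk)⟩
  · have : n * (20 + 8) ≤ N * 40 := Nat.mul_le_mul hn (by omega)
    have := Nat.mul_le_mul hn (show n * (20 + 8) + 16 ≤ N * 40 + 20 by omega)
    rw [Formula.defineTime, eval_add]
    refine Nat.add_le_add h2 (e2.trans ?_)
    simp only [eval_add, eval_mul, eval_X, eval_ofNat]
    omega
  · dsimp only
    by_cases hb : b = a
    · subst hb; rw [e7, Function.update_self]
    · rw [e6 (b + 2) (by omega), Function.update_of_ne hb]; exact h3.arr_rel b u v
  · simp only [resReg, vReg]; omega
  · simp only [resReg, vReg]; omega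
  · simp only [IsStable, resReg]; omega

theorem Represents.setReg {R : ℕ → Fin n → Fin n → Prop} {s : RAMState} (h : Represents σ R s)
    (d k : ℕ) : Represents σ R (s.setReg (resReg d) k) := by
  obtain ⟨ρ, τ, h⟩ := h
  exact ⟨ρ, τ, h.of_frame ((Frame.refl d s).setReg (not_isStable_resReg d) k)⟩

theorem Represents.reg_zero {R : ℕ → Fin n → Fin n → Prop} {s : RAMState}
    (h : Represents σ R s) : s.reg 0 = n := by
  obtain ⟨ρ, τ, h⟩ := h
  exact h.reg_zero

open Polynomial in
-- The counter is a result register of depth `d`, which a body of depth `d + 1` preserves.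
theorem Implements.repeatLoop (hn : n ≤ N) {d : ℕ} {c : RAMProgram} {p : Polynomial ℕ}
    {f : (ℕ → Fin n → Fin n → Prop) → ℕ → Fin n → Fin n → Prop}
    (h : Implements σ N (d + 1) c p f) :
    Implements σ N d (repeatLoop d c) (X * (p + 8) + 8) (f^[n]) := by
  intro R s hs
  obtain ⟨s', t, h1, h2, h3, h4, h5⟩ := exec_forLoop (X := resReg d) (b := 0) (K := n)
    (t₀ := p.eval N) (c := c)
    (fun k s₁ => Represents σ (f^[k] R) s₁ ∧ ∀ k < d, s₁.reg (resReg k) = s.reg (resReg k))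
    (fun k s j hs => ⟨hs.1.setReg d j, fun i hi => by
      rw [RAMState.setReg_reg, if_neg (by simp only [resReg]; omega)]; exact hs.2 i hi⟩)
    (fun k s hs => hs.1.reg_zero)
    (by
      rintro k - s₁ ⟨h1, h2⟩ h3
      obtain ⟨s₂, t₂, h4, h5, h6, h7⟩ := h _ s₁ h1
      refine ⟨s₂, t₂, h4, h5, (h7 d (by omega)).trans h3, ?_,
        fun i hi => (h7 i (by omega)).trans (h2 i hi)⟩
      rw [Function.iterate_succ_apply']
      exact h6)
    s ⟨hs, fun _ _ => rfl⟩
  refine ⟨s', t, h1, h2.trans ?_, h4, h5⟩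
  simp only [eval_add, eval_mul, eval_X, eval_ofNat]
  exact Nat.add_le_add_right (Nat.mul_le_mul_right _ hn) _

end Machine

/-! ## The algorithm in terms of formulas

The relations are numbered: relation `0` is the working set `S` of the loop that builds the
attachment digraph (as a relation that depends on the first argument only), relation `1` the set of
its arcs, relation `2` the adjacency in `T⋆`, relation `3` the membership in the candidate sets, and
relation `4` the adjacency in the resulting graph. -/

namespace Formula

def or (φ ψ : Formula) : Formula := neg (and (neg φ) (neg ψ))

def imp (φ ψ : Formula) : Formula := neg (and φ (neg ψ))

def iff (φ ψ : Formula) : Formula := and (imp φ ψ) (imp ψ φ)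

def allV (x : ℕ) (φ : Formula) : Formula := neg (exV x (neg φ))

def allO (x : ℕ) (φ : Formula) : Formula := neg (exO x (neg φ))

def veq (u v : ℕ) : Formula := and (neg (vlt u v)) (neg (vlt v u))

def le (i u v : ℕ) : Formula := neg (lt i v u)

section Holds

variable {n m : ℕ} {σ : Fin m → LinearOrder (Fin n)} {R : ℕ → Fin n → Fin n → Prop}
  {ρ : ℕ → Fin n} {τ : ℕ → Fin m}

@[simp] theorem holds_vlt {u v : ℕ} : (vlt u v).Holds σ R ρ τ ↔ ρ u < ρ v := Iff.rfl

@[simp] theorem holds_lt {i u v : ℕ} :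
    (lt i u v).Holds σ R ρ τ ↔ (σ (τ i)).lt (ρ u) (ρ v) := Iff.rfl

@[simp] theorem holds_rel {a u v : ℕ} : (rel a u v).Holds σ R ρ τ ↔ R a (ρ u) (ρ v) := Iff.rfl

@[simp] theorem holds_neg {φ : Formula} : (neg φ).Holds σ R ρ τ ↔ ¬ φ.Holds σ R ρ τ := Iff.rfl

@[simp] theorem holds_and {φ ψ : Formula} :
    (and φ ψ).Holds σ R ρ τ ↔ φ.Holds σ R ρ τ ∧ ψ.Holds σ R ρ τ := Iff.rfl

@[simp] theorem holds_exV {x : ℕ} {φ : Formula} :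
    (exV x φ).Holds σ R ρ τ ↔ ∃ v, φ.Holds σ R (Function.update ρ x v) τ := Iff.rfl

@[simp] theorem holds_exO {x : ℕ} {φ : Formula} :
    (exO x φ).Holds σ R ρ τ ↔ ∃ i, φ.Holds σ R ρ (Function.update τ x i) := Iff.rfl

@[simp] theorem holds_or {φ ψ : Formula} :
    (or φ ψ).Holds σ R ρ τ ↔ φ.Holds σ R ρ τ ∨ ψ.Holds σ R ρ τ := by
  simp only [or, holds_neg, holds_and]; tauto

@[simp] theorem holds_imp {φ ψ : Formula} :
    (imp φ ψ).Holds σ R ρ τ ↔ (φ.Holds σ R ρ τ → ψ.Holds σ R ρ τ) := by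
  simp only [imp, holds_neg, holds_and]; tauto

@[simp] theorem holds_iff {φ ψ : Formula} :
    (iff φ ψ).Holds σ R ρ τ ↔ (φ.Holds σ R ρ τ ↔ ψ.Holds σ R ρ τ) := by
  rw [iff, holds_and, holds_imp, holds_imp]
  exact iff_def.symm

@[simp] theorem holds_allV {x : ℕ} {φ : Formula} :
    (allV x φ).Holds σ R ρ τ ↔ ∀ v, φ.Holds σ R (Function.update ρ x v) τ := by
  simp [allV]

@[simp] theorem holds_allO {x : ℕ} {φ : Formula} :
    (allO x φ).Holds σ R ρ τ ↔ ∀ i, φ.Holds σ R ρ (Function.update τ x i) := by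
  simp [allO]

@[simp] theorem holds_veq {u v : ℕ} : (veq u v).Holds σ R ρ τ ↔ ρ u = ρ v := by
  simp only [veq, holds_neg, holds_and, holds_vlt]; omega

@[simp] theorem holds_le {i u v : ℕ} :
    (le i u v).Holds σ R ρ τ ↔ (σ (τ i)).le (ρ u) (ρ v) :=
  @not_lt _ (σ (τ i)) _ _

end Holds

/-- The working set has at least three elements. -/
def big : Formula :=
  exV 2 (exV 3 (exV 4 (and (and (rel 0 2 2) (and (rel 0 3 3) (rel 0 4 4)))
    (and (neg (veq 2 3)) (and (neg (veq 2 4)) (neg (veq 3 4)))))))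

/-- Vertex `0` is first in the working set, in ordering `0`. -/
def first : Formula := and (rel 0 0 0) (allV 2 (imp (rel 0 2 2) (le 0 0 2)))

/-- Vertex `0` is last in the working set, in some ordering. -/
def bottom : Formula := exO 0 (and (rel 0 0 0) (allV 2 (imp (rel 0 2 2) (le 0 2 0))))

/-- Vertex `1` is a blocker of vertex `0`, in ordering `0`. -/
def block : Formula :=
  or (and first (and (and (rel 0 1 1) (neg (veq 1 0)))
      (allV 2 (imp (and (rel 0 2 2) (neg (veq 2 0))) (le 0 1 2)))))
    (and (neg first) (and (rel 0 1 1) (lt 0 1 0)))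

/-- The arcs after a pass of the loop. -/
def stepArc : Formula := or (rel 1 0 1) (and big (and bottom (allO 0 block)))

/-- The working set after a pass of the loop. -/
def stepWork : Formula := and (rel 0 0 0) (neg (and big bottom))

/-- The arcs after the loop. -/
def finalArc : Formula :=
  or (rel 1 0 1) (and (vlt 0 1) (allV 2 (iff (rel 0 2 2) (or (veq 2 0) (veq 2 1)))))

/-- Vertex `u` is forced. -/
def isForced (u : ℕ) : Formula :=
  allV 8 (imp (rel 1 u 8) (allV 9 (imp (rel 1 u 9) (veq 8 9))))

/-- Adjacency in the graph induced by the forced vertices. -/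
def starAdj : Formula :=
  and (and (neg (veq 0 1)) (or (rel 1 0 1) (rel 1 1 0))) (and (isForced 0) (isForced 1))

/-- Vertex `1` is a candidate of the free vertex `0`. -/
def candidate : Formula :=
  and (neg (isForced 0)) (and (isForced 1) (allO 0 (and (lt 0 1 0) (and
    (allV 2 (allV 3 (imp (rel 2 2 3) (imp (lt 0 2 0) (imp (lt 0 0 3) (le 0 2 1))))))
    (allV 2 (allV 3 (imp (rel 2 2 3) (imp (lt 0 1 3) (imp (lt 0 3 0)
      (imp (lt 0 2 3) (le 0 1 2)))))))))))

/-- The candidates after a pass of the purification loop. -/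
def purify : Formula :=
  and (rel 3 0 1) (allO 0 (allV 2 (imp (neg (isForced 2)) (imp
    (allV 3 (imp (isForced 3) (iff (lt 0 3 2) (lt 0 3 0))))
    (and (imp (lt 0 2 0) (exV 4 (and (rel 3 2 4) (le 0 1 4))))
      (imp (lt 0 0 2) (exV 4 (and (rel 3 2 4) (le 0 4 1)))))))))

/-- Vertex `v` is the smallest candidate of vertex `u`. -/
def smallest (u v : ℕ) : Formula := and (rel 3 u v) (allV 2 (imp (rel 3 u 2) (neg (vlt 2 v))))

/-- Adjacency in the resulting graph. -/
def resultAdj : Formula :=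
  and (neg (veq 0 1)) (or (or (rel 2 0 1) (smallest 0 1)) (or (rel 2 1 0) (smallest 1 0)))

/-- Relation `4` is a nested tree for all orderings. -/
def support : Formula :=
  allO 0 (and (allV 0 (allV 1 (imp (lt 0 0 1) (exV 2 (and (lt 0 2 1) (rel 4 2 1))))))
    (and (allV 0 (allV 1 (allV 2 (imp (lt 0 0 2) (imp (lt 0 1 2) (imp (rel 4 0 2)
        (imp (rel 4 1 2) (veq 0 1))))))))
      (allV 0 (allV 1 (allV 2 (imp (lt 0 0 1) (imp (lt 0 1 2) (imp (rel 4 0 2)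
        (exV 3 (and (le 0 0 3) (and (lt 0 3 1) (rel 4 3 1))))))))))))

end Formula

/-! ### Set-theoretic meaning of the formulas -/

section Semantics

variable {n m : ℕ} {σ : Fin m → LinearOrder (Fin n)} {R : ℕ → Fin n → Fin n → Prop}
  {ρ : ℕ → Fin n} {τ : ℕ → Fin m}

open Formula

/-- The working set. -/
def workSet (R : ℕ → Fin n → Fin n → Prop) : Set (Fin n) := {u | R 0 u u}

/-- The arcs. -/
def arcSet (R : ℕ → Fin n → Fin n → Prop) : Set (Fin n × Fin n) := {a | R 1 a.1 a.2}

theorem holds_big : big.Holds σ R ρ τ ↔ 3 ≤ (workSet R).ncard := by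
  rw [Nat.succ_le_iff, Set.two_lt_ncard_iff (Set.toFinite _)]
  simp [big, workSet, and_assoc]

theorem holds_first : first.Holds σ R ρ τ ↔ IsFirst (σ (τ 0)) (workSet R) (ρ 0) := by
  simp [first, workSet, IsFirst]

theorem holds_bottom : bottom.Holds σ R ρ τ ↔ ρ 0 ∈ bottoms (Set.range σ) (workSet R) := by
  simp [bottom, workSet, bottoms, IsLast]
  exact fun _ => Iff.rfl

theorem isSecond_iff {V : Type u} {σ : LinearOrder V} {S : Set V} {x y : V} (hx : IsFirst σ S x) :
    IsSecond σ S y ↔ IsFirst σ (S \ {x}) y :=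
  ⟨fun ⟨_, hz, h⟩ => hx.unique hz ▸ h, fun h => ⟨x, hx, h⟩⟩

theorem holds_block :
    block.Holds σ R ρ τ ↔ ρ 1 ∈ blockers (σ (τ 0)) (workSet R) (ρ 0) := by
  have h1 : ρ 1 ∈ blockers (σ (τ 0)) (workSet R) (ρ 0) ↔
      (IsFirst (σ (τ 0)) (workSet R) (ρ 0) ∧ IsFirst (σ (τ 0)) (workSet R \ {ρ 0}) (ρ 1)) ∨
      (¬ IsFirst (σ (τ 0)) (workSet R) (ρ 0) ∧ ρ 1 ∈ workSet R ∧ (σ (τ 0)).lt (ρ 1) (ρ 0)) :=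
    or_congr (and_congr_right fun h => isSecond_iff h) Iff.rfl
  rw [h1, block, holds_or, holds_and, holds_first, holds_and (φ := neg first), holds_neg, holds_first]
  refine or_congr (and_congr_right fun _ => ?_) ?_
  · simp [workSet, IsFirst]
  · simp [workSet]

theorem holds_stepArc : stepArc.Holds σ R ρ τ ↔ (R 1 (ρ 0) (ρ 1) ∨
    (3 ≤ (workSet R).ncard ∧ (ρ 0, ρ 1) ∈ newArcs (Set.range σ) (workSet R))) := by
  simp [stepArc, holds_big, holds_bottom, holds_block, newArcs]

theorem holds_stepWork : stepWork.Holds σ R ρ τ ↔ ρ 0 ∈ workSet R ∧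
    ¬ (3 ≤ (workSet R).ncard ∧ ρ 0 ∈ bottoms (Set.range σ) (workSet R)) := by
  rw [stepWork, holds_and, holds_neg, holds_and, holds_big, holds_bottom]
  rfl

theorem holds_finalArc : finalArc.Holds σ R ρ τ ↔ (R 1 (ρ 0) (ρ 1) ∨
    (ρ 0 < ρ 1 ∧ workSet R = {ρ 0, ρ 1})) := by
  simp [finalArc, workSet, Set.ext_iff]

/-- Variables `8` and `9` are bound in the formula; `u < 8` prevents capture. -/
theorem holds_isForced {u : ℕ} (hu : u < 8) :
    (isForced u).Holds σ R ρ τ ↔ ρ u ∈ forced (arcSet R) := by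
  have h8 : u ≠ 8 := by omega
  have h9 : u ≠ 9 := by omega
  simp [isForced, forced, arcSet, Set.Subsingleton, h8, h9]

/-- The adjacency in `T⋆`. -/
def StarAdj (A : Set (Fin n × Fin n)) (u v : Fin n) : Prop :=
  (underlyingGraph A).Adj u v ∧ u ∈ forced A ∧ v ∈ forced A

theorem holds_starAdj : starAdj.Holds σ R ρ τ ↔ StarAdj (arcSet R) (ρ 0) (ρ 1) := by
  simp [starAdj, StarAdj, holds_isForced, underlyingGraph, arcSet]

/-- The vertex `q` is a candidate of the free vertex `v`, where `F` is the set of forced vertices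
and `T` the adjacency in `T⋆`. -/
def CandidateRel (σ : Fin m → LinearOrder (Fin n)) (F : Set (Fin n)) (T : Fin n → Fin n → Prop)
    (v q : Fin n) : Prop :=
  v ∉ F ∧ q ∈ F ∧ ∀ i, (σ i).lt q v ∧
    (∀ p c, T p c → (σ i).lt p v → (σ i).lt v c → (σ i).le p q) ∧
    ∀ p b, T p b → (σ i).lt q b → (σ i).lt b v → (σ i).lt p b → (σ i).le q p

theorem holds_candidate :
    candidate.Holds σ R ρ τ ↔ CandidateRel σ (forced (arcSet R)) (R 2) (ρ 0) (ρ 1) := by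
  simp [candidate, CandidateRel, holds_isForced]
  exact fun _ _ => Iff.rfl

/-- The candidates that remain after a simultaneous application of the purification rule. -/
def PurifyRel (σ : Fin m → LinearOrder (Fin n)) (F : Set (Fin n)) (Q : Fin n → Fin n → Prop)
    (v q : Fin n) : Prop :=
  Q v q ∧ ∀ i x, x ∉ F → (∀ w, w ∈ F → ((σ i).lt w x ↔ (σ i).lt w v)) →
    ((σ i).lt x v → ∃ y, Q x y ∧ (σ i).le q y) ∧ ((σ i).lt v x → ∃ y, Q x y ∧ (σ i).le y q)

theorem holds_purify :
    purify.Holds σ R ρ τ ↔ PurifyRel σ (forced (arcSet R)) (R 3) (ρ 0) (ρ 1) := by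
  simp [purify, PurifyRel, holds_isForced]
  exact fun _ => Iff.rfl

/-- Forced vertices are adjacent according to `T`, and free vertices are attached to their smallest
candidates according to `Q`. -/
def resultGraph (T Q : Fin n → Fin n → Prop) : SimpleGraph (Fin n) :=
  SimpleGraph.fromRel fun u v => T u v ∨ (Q u v ∧ ∀ z, Q u z → v ≤ z)

theorem holds_resultAdj :
    resultAdj.Holds σ R ρ τ ↔ (resultGraph (R 2) (R 3)).Adj (ρ 0) (ρ 1) := by
  simp [resultAdj, resultGraph, smallest]

theorem holds_support {G : SimpleGraph (Fin n)} (hG : R 4 = G.Adj) :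
    support.Holds σ R ρ τ ↔ ∀ i, IsNestedTree (σ i) G := by
  have key : ∀ σ : LinearOrder (Fin n), IsNestedTree σ G ↔
      (∀ a b, σ.lt a b → ∃ p, σ.lt p b ∧ G.Adj p b) ∧
      (∀ p q b, σ.lt p b → σ.lt q b → G.Adj p b → G.Adj q b → p = q) ∧
      ∀ p b c, σ.lt p b → σ.lt b c → G.Adj p c → ∃ q, σ.le p q ∧ σ.lt q b ∧ G.Adj q b :=
    fun σ => ⟨fun h => ⟨h.1, h.2, h.3⟩, fun h => ⟨h.1, h.2.1, h.2.2⟩⟩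
  simp [support, key, hG]
  exact Iff.rfl

end Semantics

/-! ## Correctness of the relational algorithm -/

/-- Iterating a map that shrinks relations reaches a fixed point. -/
theorem iterate_isFixedPt {V : Type u} [Finite V] (g : (V → V → Prop) → V → V → Prop)
    (hg : ∀ Q v q, g Q v q → Q v q) (k : ℕ) (Q : V → V → Prop)
    (hk : {p : V × V | Q p.1 p.2}.ncard ≤ k) : g (g^[k] Q) = g^[k] Q := by
  induction k generalizing Q with
  | zero =>
    have hemp : {p : V × V | Q p.1 p.2} = ∅ := (Set.ncard_eq_zero (Set.toFinite _)).1 (by omega)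
    funext v q
    refine propext ⟨hg Q v q, fun h => ?_⟩
    exact absurd (show (v, q) ∈ {p : V × V | Q p.1 p.2} from h) (by simp [hemp])
  | succ k ih =>
    by_cases h : g Q = Q
    · rw [Function.iterate_fixed h, h]
    · rw [Function.iterate_succ_apply]
      refine ih (g Q) (Nat.lt_succ_iff.1 (lt_of_lt_of_le ?_ hk))
      refine Set.ncard_lt_ncard ⟨fun p hp => hg Q _ _ hp, fun hsub => h ?_⟩ (Set.toFinite _)
      funext v q
      exact propext ⟨hg Q v q, fun hq => hsub (show (v, q) ∈ {p : V × V | Q p.1 p.2} from hq)⟩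

theorem iterate_le {V : Type u} (g : (V → V → Prop) → V → V → Prop)
    (hg : ∀ Q v q, g Q v q → Q v q) (k : ℕ) (Q : V → V → Prop) (v q : V) (h : g^[k] Q v q) :
    Q v q := by
  induction k with
  | zero => exact h
  | succ k ih =>
    rw [Function.iterate_succ_apply'] at h
    exact ih (hg _ _ _ h)

section Fin

variable {n m : ℕ} {σ : Fin m → LinearOrder (Fin n)} {A : Set (Fin n × Fin n)}

/-- The family of purified candidate sets as a relation. -/
def PurifiedRel (σ : Fin m → LinearOrder (Fin n)) (A : Set (Fin n × Fin n)) :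
    Fin n → Fin n → Prop :=
  (PurifyRel σ (forced A))^[n * n] (CandidateRel σ (forced A) (StarAdj A))

/-- The graph that the relational algorithm returns. -/
def relationalResult (σ : Fin m → LinearOrder (Fin n)) (A : Set (Fin n × Fin n)) :
    SimpleGraph (Fin n) :=
  resultGraph (StarAdj A) (PurifiedRel σ A)

theorem purifiedRel_le {v q : Fin n} (h : PurifiedRel σ A v q) :
    CandidateRel σ (forced A) (StarAdj A) v q :=
  iterate_le _ (fun _ _ _ h => h.1) _ _ _ _ h

/-- There are at most `n * n` pairs and every round before stabilisation loses one. -/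
theorem purifyRel_purifiedRel :
    PurifyRel σ (forced A) (PurifiedRel σ A) = PurifiedRel σ A := by
  refine iterate_isFixedPt _ (fun _ _ _ h => h.1) _ _ ?_
  refine (Set.ncard_le_ncard (Set.subset_univ _) (Set.toFinite _)).trans ?_
  rw [Set.ncard_univ, Nat.card_prod, Nat.card_fin]

theorem starAdj_iff {u v : Fin n} (hu : u ∈ forced A) (hv : v ∈ forced A) :
    StarAdj A u v ↔ (starTree A).Adj ⟨u, hu⟩ ⟨v, hv⟩ :=
  ⟨fun h => h.1, fun h => ⟨h, hu, hv⟩⟩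

theorem relationalResult_eq_of_forced_eq_univ (hF : forced A = Set.univ) :
    relationalResult σ A = (starTree A).spanningCoe := by
  have hQ : ∀ u v, ¬ PurifiedRel σ A u v := fun u v h => (purifiedRel_le h).1 (hF ▸ trivial)
  rw [starTree, spanningCoe_induce_of_eq_univ hF]
  ext u v
  have hu : u ∈ forced A := hF ▸ Set.mem_univ u
  have hv : v ∈ forced A := hF ▸ Set.mem_univ v
  rw [relationalResult, resultGraph, SimpleGraph.fromRel_adj]
  simp only [hQ, StarAdj, hu, hv, false_and, or_false, and_true]
  exact ⟨fun h => h.2.elim id (fun h => h.symm), fun h => ⟨h.ne, Or.inl h⟩⟩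

section Nested

variable (hT : ∀ τ ∈ Set.range σ, IsNestedTree (restrictOrder (forced A) τ) (starTree A))
  (hr : ∀ τ ∈ Set.range σ, ∃ r : forced A, IsFirst τ Set.univ (r : Fin n))

include hT hr in
theorem candidateRel_iff (v : ↥((forced A)ᶜ)) (q : forced A) :
    CandidateRel σ (forced A) (StarAdj A) v q ↔ q ∈ candidates (Set.range σ) (starTree A) v := by
  rw [mem_candidates_iff hT hr, Set.forall_mem_range]
  constructor
  · rintro ⟨-, -, h⟩ i
    obtain ⟨h1, h2, h3⟩ := h i
    exact ⟨h1, fun p c hadj => h2 p c ((starAdj_iff p.2 c.2).2 hadj),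
      fun p b hadj => h3 p b ((starAdj_iff p.2 b.2).2 hadj)⟩
  · refine fun h => ⟨v.2, q.2, fun i => ⟨(h i).lt, fun p c hadj => ?_, fun p b hadj => ?_⟩⟩
    · exact (h i).parent_le ⟨p, hadj.2.1⟩ ⟨c, hadj.2.2⟩ hadj.1
    · exact (h i).le_parent ⟨p, hadj.2.1⟩ ⟨b, hadj.2.2⟩ hadj.1

include hT hr in
-- Simultaneous rounds need not be single applications of the rule, so the outcome is compared with
-- a family `Q` that is really obtained by them. The fixed point is consistent, hence contained in
-- `Q`; and `Q`, being consistent, survives every round.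
theorem isPurified_purifiedRel :
    IsPurified (Set.range σ) (starTree A)
      (fun v : ↥((forced A)ᶜ) => {q : forced A | PurifiedRel σ A v q}) := by
  obtain ⟨Q, hQ⟩ := exists_isPurified (Set.range σ) (starTree A)
  have hle : ∀ v : ↥((forced A)ᶜ), {q : forced A | PurifiedRel σ A v q} ⊆
      candidates (Set.range σ) (starTree A) v :=
    fun v q hq => (candidateRel_iff hT hr v q).1 (purifiedRel_le hq)
  have hcons : IsConsistent (Set.range σ) (starTree A)
      (fun v : ↥((forced A)ᶜ) => {q : forced A | PurifiedRel σ A v q}) := by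
    rw [isConsistent_iff_order hT hr hle, Set.forall_mem_range]
    intro i x v w hxv hx hv
    constructor
    · intro q hq
      have hq' : PurifiedRel σ A v q := hq
      rw [← purifyRel_purifiedRel] at hq'
      obtain ⟨y, hy, hqy⟩ := (hq'.2 i x x.2 (fun w hw => hx.lt_iff hv ⟨w, hw⟩)).1 hxv
      exact ⟨⟨y, (purifiedRel_le hy).2.1⟩, hy, hqy⟩
    · intro q hq
      have hq' : PurifiedRel σ A x q := hq
      rw [← purifyRel_purifiedRel] at hq'
      obtain ⟨y, hy, hqy⟩ := (hq'.2 i v v.2 (fun w hw => hv.lt_iff hx ⟨w, hw⟩)).2 hxv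
      exact ⟨⟨y, (purifiedRel_le hy).2.1⟩, hy, hqy⟩
  have key : ∀ k, ∀ (v : ↥((forced A)ᶜ)) (q : forced A), q ∈ Q v →
      (PurifyRel σ (forced A))^[k] (CandidateRel σ (forced A) (StarAdj A)) v q := by
    intro k
    induction k with
    | zero => exact fun v q hq => (candidateRel_iff hT hr v q).2 (hQ.le_candidates v hq)
    | succ k ih =>
      intro v q hq
      rw [Function.iterate_succ_apply']
      have hQc := (isConsistent_iff_order hT hr hQ.le_candidates).1 hQ.isConsistent
      refine ⟨ih v q hq, fun i x hxF hsame => ?_⟩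
      have hqv : (σ i).lt q v :=
        ((mem_candidates_iff hT hr).1 (hQ.le_candidates v hq) (σ i) ⟨i, rfl⟩).lt
      obtain ⟨w, hw⟩ := exists_isGuider hqv
      have hwx : IsGuider (σ i) x w :=
        ⟨(hsame w w.2).2 hw.1, fun y hy => hw.2 y ((hsame y y.2).1 hy)⟩
      constructor
      · intro hxv
        obtain ⟨y, hy, hqy⟩ := (hQc (σ i) ⟨i, rfl⟩ ⟨x, hxF⟩ v w hxv hwx hw).1 q hq
        exact ⟨y, ih ⟨x, hxF⟩ y hy, hqy⟩
      · intro hvx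
        obtain ⟨y, hy, hqy⟩ := (hQc (σ i) ⟨i, rfl⟩ v ⟨x, hxF⟩ w hvx hw hwx).2 q hq
        exact ⟨y, ih ⟨x, hxF⟩ y hy, hqy⟩
  have heq : (fun v : ↥((forced A)ᶜ) => {q : forced A | PurifiedRel σ A v q}) = Q := by
    funext v
    exact (hQ.le_of_isConsistent hcons hle v).antisymm (fun q hq => key _ v q hq)
  rw [heq]
  exact hQ

end Nested

/-- The numbering of the vertices themselves plays the role of `f`, up to the cast between `n` and
the cardinality of `Fin n`. -/
theorem relationalResult_eq_assignParents :
    relationalResult σ A = assignParents (starTree A)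
      (fun v : ↥((forced A)ᶜ) => {q : forced A | PurifiedRel σ A v q})
      (finCongr (Nat.card_fin n).symm) := by
  have hatt : ∀ u v : Fin n, (PurifiedRel σ A u v ∧ ∀ z, PurifiedRel σ A u z → v ≤ z) ↔
      ∃ (v' : ↥((forced A)ᶜ)) (y' : forced A), (v' : Fin n) = u ∧ (y' : Fin n) = v ∧
        PurifiedRel σ A v' y' ∧ ∀ z : forced A, PurifiedRel σ A v' z → (y' : Fin n) ≤ z := by
    intro u v
    constructor
    · rintro ⟨h, hmin⟩
      have hc := purifiedRel_le h
      exact ⟨⟨u, hc.1⟩, ⟨v, hc.2.1⟩, rfl, rfl, h, fun z hz => hmin z hz⟩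
    · rintro ⟨u', v', rfl, rfl, h, hmin⟩
      exact ⟨h, fun z hz => hmin ⟨z, (purifiedRel_le hz).2.1⟩ hz⟩
  have hstar : ∀ u v, (starTree A).spanningCoe.Adj u v ↔ StarAdj A u v := by
    intro u v
    rw [SimpleGraph.map_adj]
    constructor
    · rintro ⟨a, b, h, rfl, rfl⟩
      exact (starAdj_iff a.2 b.2).2 h
    · exact fun h => ⟨⟨u, h.2.1⟩, ⟨v, h.2.2⟩, h.1, rfl, rfl⟩
  ext u v
  rw [relationalResult, resultGraph, assignParents, SimpleGraph.sup_adj, SimpleGraph.fromRel_adj,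
    SimpleGraph.fromRel_adj, hstar, hatt, hatt]
  have hsymm : StarAdj A v u ↔ StarAdj A u v :=
    ⟨fun h => ⟨h.1.symm, h.2.2, h.2.1⟩, fun h => ⟨h.1.symm, h.2.2, h.2.1⟩⟩
  have hne : StarAdj A u v → u ≠ v := fun h => h.1.ne
  rw [hsymm]
  simp only [Set.mem_ofPred_eq, finCongr_apply, Fin.cast_le_cast]
  constructor
  · rintro ⟨h, (h1 | h1) | (h1 | h1)⟩
    · exact Or.inl h1
    · exact Or.inr ⟨h, Or.inl h1⟩
    · exact Or.inl h1
    · exact Or.inr ⟨h, Or.inr h1⟩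
  · rintro (h1 | ⟨h, h1 | h1⟩)
    · exact ⟨hne h1, Or.inl (Or.inl h1)⟩
    · exact ⟨h, Or.inl (Or.inr h1)⟩
    · exact ⟨h, Or.inr (Or.inr h1)⟩

/-- If there is a support, then the relational algorithm returns the result of an execution of the
algorithm. -/
theorem algorithm_relationalResult (hn : 0 < n) (hm : 0 < m)
    (hA : IsAttachmentDigraph (Set.range σ) A) {T : SimpleGraph (Fin n)}
    (hT : IsDFSTreeSupport (Set.range σ) T) :
    DFSTreeAlgorithm (Set.range σ) (some (relationalResult σ A)) := by
  have : Nonempty (Fin n) := ⟨⟨0, hn⟩⟩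
  have hΦ : (Set.range σ).Nonempty := ⟨σ ⟨0, hm⟩, ⟨_, rfl⟩⟩
  have hT' := (isDFSTreeSupport_iff hΦ T).1 hT
  have hc := connected_underlyingGraph hΦ hT' hA
  by_cases hF : forced A = Set.univ
  · rw [relationalResult_eq_of_forced_eq_univ hF]
    refine .allForced A hA hc hF ?_
    rw [spanningCoe_starTree_eq hΦ hA hT' hF]
    exact hT.2
  · have hnest : ∀ τ ∈ Set.range σ, IsNestedTree (restrictOrder (forced A) τ) (starTree A) :=
      fun τ hτ => isNestedTree_starTree hΦ hT' hA hτ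
    have hQ := isPurified_purifiedRel hnest (exists_forced_isFirst hΦ hA)
    rw [relationalResult_eq_assignParents]
    exact .assigned A hA hc hF ((restrict_isDFSTreeSupport_iff hΦ hA).2 hnest) _ hQ
      (candidates_nonempty_of_support hΦ hA hT' hQ) _

/-! ## The program -/

/-- A pass of the loop that builds the attachment digraph. -/
def attachStep (σ : Fin m → LinearOrder (Fin n)) (R : ℕ → Fin n → Fin n → Prop) :
    ℕ → Fin n → Fin n → Prop :=
  Function.update (Function.update R 1 fun u v => R 1 u v ∨
    (3 ≤ (workSet R).ncard ∧ (u, v) ∈ newArcs (Set.range σ) (workSet R))) 0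
    fun u _ => u ∈ workSet R ∧ ¬ (3 ≤ (workSet R).ncard ∧ u ∈ bottoms (Set.range σ) (workSet R))

/-- The arcs after the loop. -/
def attachFinal (R : ℕ → Fin n → Fin n → Prop) : ℕ → Fin n → Fin n → Prop :=
  Function.update R 1 fun u v => R 1 u v ∨ (u < v ∧ workSet R = {u, v})

theorem workSet_attachStep (R : ℕ → Fin n → Fin n → Prop) : workSet (attachStep σ R) =
    {u ∈ workSet R | ¬ (3 ≤ (workSet R).ncard ∧ u ∈ bottoms (Set.range σ) (workSet R))} := by
  simp [workSet, attachStep]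

theorem arcSet_attachStep (R : ℕ → Fin n → Fin n → Prop) : arcSet (attachStep σ R) =
    arcSet R ∪ {a | 3 ≤ (workSet R).ncard ∧ a ∈ newArcs (Set.range σ) (workSet R)} := by
  ext ⟨u, v⟩
  simp [arcSet, attachStep]

theorem arcSet_attachFinal (R : ℕ → Fin n → Fin n → Prop) : arcSet (attachFinal R) =
    arcSet R ∪ {a | a.1 < a.2 ∧ workSet R = {a.1, a.2}} := by
  ext ⟨u, v⟩
  simp [arcSet, attachFinal]

/-- The final arc is directed from the smaller to the larger index. The same set is empty if at most
one vertex remains, so one formula covers both ways in which the loop ends. -/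
theorem attach_finalArcs {Φ : Set (LinearOrder (Fin n))} {S : Set (Fin n)} (h3 : ¬ 3 ≤ S.ncard) :
    Attach Φ S {a | a.1 < a.2 ∧ S = {a.1, a.2}} := by
  by_cases h2 : S.ncard = 2
  · obtain ⟨a, b, hab, rfl⟩ : ∃ a b, a < b ∧ S = {a, b} := by
      obtain ⟨a, b, hab, hS⟩ := Set.ncard_eq_two.1 h2
      rcases lt_or_gt_of_ne hab with h | h
      · exact ⟨a, b, h, hS⟩
      · exact ⟨b, a, h, hS.trans (Set.pair_comm a b)⟩
    convert Attach.last (Φ := Φ) a b hab.ne using 1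
    ext ⟨u, v⟩
    simp only [Set.mem_ofPred_eq, Set.mem_singleton_iff, Prod.mk.injEq]
    constructor
    · rintro ⟨huv, h⟩
      rcases Set.pair_eq_pair_iff.1 h with ⟨rfl, rfl⟩ | ⟨rfl, rfl⟩
      · exact ⟨rfl, rfl⟩
      · exact absurd huv (lt_asymm hab)
    · rintro ⟨rfl, rfl⟩
      exact ⟨hab, rfl⟩
  · convert Attach.done (Φ := Φ) S (by omega) using 1
    refine Set.eq_empty_of_forall_notMem ?_
    rintro ⟨u, v⟩ ⟨huv, h⟩
    exact h2 (h ▸ Set.ncard_pair huv.ne)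

theorem attachStep_iterate_of_small (k : ℕ) (R : ℕ → Fin n → Fin n → Prop)
    (h3 : ¬ 3 ≤ (workSet R).ncard) : workSet ((attachStep σ)^[k] R) = workSet R ∧
      arcSet ((attachStep σ)^[k] R) = arcSet R := by
  induction k with
  | zero => exact ⟨rfl, rfl⟩
  | succ k ih =>
    rw [Function.iterate_succ_apply', workSet_attachStep, arcSet_attachStep, ih.1, ih.2]
    simp [h3]

/-- A fixed number of passes suffices: each pass with three or more vertices removes at least one,
and the surplus passes are idle. -/
theorem exists_attach_iterate (hm : 0 < m) (k : ℕ) (R : ℕ → Fin n → Fin n → Prop)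
    (hk : (workSet R).ncard ≤ k) :
    ∃ X, Attach (Set.range σ) (workSet R) X ∧
      arcSet (attachFinal ((attachStep σ)^[k] R)) = arcSet R ∪ X := by
  have hΦ : (Set.range σ).Nonempty := ⟨σ ⟨0, hm⟩, ⟨_, rfl⟩⟩
  induction k generalizing R with
  | zero =>
    exact ⟨_, attach_finalArcs (by omega), arcSet_attachFinal R⟩
  | succ k ih =>
    by_cases h3 : 3 ≤ (workSet R).ncard
    · have hne : (workSet R).Nonempty := Set.nonempty_of_ncard_ne_zero (by omega)
      have hlt := ncard_diff_bottoms_lt hΦ hne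
      have hW : workSet (attachStep σ R) = workSet R \ bottoms (Set.range σ) (workSet R) := by
        rw [workSet_attachStep]
        ext u
        simp [h3]
      obtain ⟨X, hX, h⟩ := ih (attachStep σ R) (by rw [hW]; omega)
      rw [hW] at hX
      refine ⟨_, .step _ X h3 hX, ?_⟩
      rw [Function.iterate_succ_apply, h, arcSet_attachStep, ← Set.union_assoc]
      simp [h3]
    · have h := attachStep_iterate_of_small (σ := σ) (k + 1) R h3
      exact ⟨_, attach_finalArcs h3, by rw [arcSet_attachFinal, h.1, h.2]⟩

/-- A pass of the purification loop. -/
def purifyStepRel (σ : Fin m → LinearOrder (Fin n)) (R : ℕ → Fin n → Fin n → Prop) :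
    ℕ → Fin n → Fin n → Prop :=
  Function.update R 3 (PurifyRel σ (forced (arcSet R)) (R 3))

/-- Purification leaves the arcs untouched, so the set of forced vertices stays constant through the
iteration. -/
theorem purifyStepRel_iterate (k : ℕ) (R : ℕ → Fin n → Fin n → Prop) :
    (purifyStepRel σ)^[k] R =
      Function.update R 3 ((PurifyRel σ (forced (arcSet R)))^[k] (R 3)) := by
  induction k with
  | zero => simp
  | succ k ih =>
    rw [Function.iterate_succ_apply', ih, Function.iterate_succ_apply']
    simp [purifyStepRel, arcSet]

/-- The relations after the computation. -/
def finalRel (σ : Fin m → LinearOrder (Fin n)) (R : ℕ → Fin n → Fin n → Prop) :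
    ℕ → Fin n → Fin n → Prop :=
  let R₁ := attachFinal ((attachStep σ)^[n] (Function.update R 0 fun _ _ => True))
  let R₂ := Function.update R₁ 2 (StarAdj (arcSet R₁))
  let R₃ := Function.update R₂ 3 (CandidateRel σ (forced (arcSet R₂)) (R₂ 2))
  let R₄ := ((purifyStepRel σ)^[n])^[n] R₃
  Function.update R₄ 4 (resultGraph (R₄ 2) (R₄ 3)).Adj

theorem finalRel_four (hm : 0 < m) :
    ∃ A, IsAttachmentDigraph (Set.range σ) A ∧
      finalRel σ (fun _ _ _ => False) 4 = (relationalResult σ A).Adj := by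
  obtain ⟨X, hX, h⟩ := exists_attach_iterate (σ := σ) hm n
    (Function.update (fun _ _ _ => False) 0 fun _ _ => True)
    ((Set.ncard_le_card _).trans (by simp))
  refine ⟨X, isAttachmentDigraph_iff.2 ?_, ?_⟩
  · convert hX using 1
    simp [workSet]
  · have h' : arcSet (attachFinal ((attachStep σ)^[n]
        (Function.update (fun _ _ _ => False) 0 fun _ _ => True))) = X := by
      rw [h]; simp [arcSet]
    simp only [finalRel, ← Function.iterate_mul, purifyStepRel_iterate]
    simp only [arcSet] at h' ⊢
    simp [h', relationalResult, PurifiedRel]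

/-- The program of the relational algorithm. -/
def relationalProgram : RAMProgram :=
  .seq (defineRel 0 0 (Formula.veq 0 0))
    (.seq (repeatLoop 0 (.seq (defineRel 1 1 Formula.stepArc) (defineRel 1 0 Formula.stepWork)))
      (.seq (defineRel 0 1 Formula.finalArc)
        (.seq (defineRel 0 2 Formula.starAdj)
          (.seq (defineRel 0 3 Formula.candidate)
            (.seq (repeatLoop 0 (repeatLoop 1 (defineRel 2 3 Formula.purify)))
              (defineRel 0 4 Formula.resultAdj))))))

/-- The program: compute the result, store its adjacency matrix, and check that it is a support. -/
def mainProgram : RAMProgram :=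
  .seq relationalProgram
    (.seq (tabulate 0 (Formula.rel 4 0 1))
      (.seq (Formula.support.compile 0) (.assign 0 (.reg (resReg 0)))))

end Fin

open Polynomial in
/-- A bound for the running time of `relationalProgram`. -/
noncomputable def relationalTime : ℕ[X] :=
  (Formula.veq 0 0).defineTime +
    (X * ((Formula.stepArc.defineTime + Formula.stepWork.defineTime) + 8) + 8 +
      (Formula.finalArc.defineTime +
        (Formula.starAdj.defineTime +
          (Formula.candidate.defineTime +
            (X * (X * (Formula.purify.defineTime + 8) + 8 + 8) + 8 +
              Formula.resultAdj.defineTime)))))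

theorem implements_relationalProgram {n m N : ℕ} (σ : Fin m → LinearOrder (Fin n)) (hn : n ≤ N)
    (hm : m ≤ N) : Implements σ N 0 relationalProgram relationalTime (finalRel σ) := by
  -- The formula is always true, which initialises the working set to all vertices.
  have h1 := implements_defineRel (σ := σ) hn hm (Formula.veq 0 0) (fun _ _ _ => True)
    (fun R ρ τ => by simp) 0 0
  have h2 := implements_defineRel (σ := σ) hn hm Formula.stepArc (fun R u v => R 1 u v ∨
    (3 ≤ (workSet R).ncard ∧ (u, v) ∈ newArcs (Set.range σ) (workSet R))) (fun R ρ τ => holds_stepArc) 1 1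
  have h3 := implements_defineRel (σ := σ) hn hm Formula.stepWork (fun R u _ => u ∈ workSet R ∧
    ¬ (3 ≤ (workSet R).ncard ∧ u ∈ bottoms (Set.range σ) (workSet R)))
    (fun R ρ τ => holds_stepWork) 1 0
  have h4 := implements_defineRel (σ := σ) hn hm Formula.finalArc
    (fun R u v => R 1 u v ∨ (u < v ∧ workSet R = {u, v})) (fun R ρ τ => holds_finalArc) 0 1
  have h5 := implements_defineRel (σ := σ) hn hm Formula.starAdj
    (fun R => StarAdj (arcSet R)) (fun R ρ τ => holds_starAdj) 0 2
  have h6 := implements_defineRel (σ := σ) hn hm Formula.candidate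
    (fun R => CandidateRel σ (forced (arcSet R)) (R 2)) (fun R ρ τ => holds_candidate) 0 3
  have h7 := implements_defineRel (σ := σ) hn hm Formula.purify
    (fun R => PurifyRel σ (forced (arcSet R)) (R 3)) (fun R ρ τ => holds_purify) 2 3
  have h8 := implements_defineRel (σ := σ) hn hm Formula.resultAdj
    (fun R => (resultGraph (R 2) (R 3)).Adj) (fun R ρ τ => holds_resultAdj) 0 4
  have h := h1.seq (((h2.seq h3).repeatLoop hn).seq (h4.seq (h5.seq (h6.seq
    (((h7.repeatLoop hn).repeatLoop hn).seq h8)))))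
  exact h

open Polynomial in
/-- A bound for the running time of `mainProgram`. -/
noncomputable def mainTime : ℕ[X] :=
  relationalTime + (X * (X * ((Formula.rel 4 0 1).time + 20) + 20) + 20) +
    Formula.support.time + 2

theorem represents_inputState {n m : ℕ} (σ : Fin m → LinearOrder (Fin n)) (hn : 0 < n)
    (hm : 0 < m) : Represents σ (fun _ _ _ => False) (inputState σ) := by
  refine ⟨fun _ => ⟨0, hn⟩, fun _ => ⟨0, hm⟩, rfl, rfl, fun x => ?_, fun x => ?_, fun i v => ?_,
    fun a u v => ?_⟩
  · have h0 : vReg x ≠ 0 := by simp only [vReg]; omega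
    have h1 : vReg x ≠ 1 := by simp only [vReg]; omega
    simp [inputState, h0, h1]
  · have h0 : oReg x ≠ 0 := by simp only [oReg]; omega
    have h1 : oReg x ≠ 1 := by simp only [oReg]; omega
    simp [inputState, h0, h1]
  · simp [inputState]
  · simp [inputState]

/-- The program computes the result of the relational algorithm, and checks it. -/
theorem exec_mainProgram {n m N : ℕ} (σ : Fin m → LinearOrder (Fin n)) (hn : 0 < n) (hm : 0 < m)
    (hnN : n ≤ N) (hmN : m ≤ N) :
    ∃ (A : Set (Fin n × Fin n)) (s : RAMState) (t : ℕ), IsAttachmentDigraph (Set.range σ) A ∧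
      mainProgram.Exec (inputState σ) s t ∧ t ≤ mainTime.eval N ∧
      s.reg 0 = truthValue (∀ i, IsNestedTree (σ i) (relationalResult σ A)) ∧
      ∀ u v : Fin n, s.arr 1 u v = truthValue ((relationalResult σ A).Adj u v) := by
  obtain ⟨A, hA, hR⟩ := finalRel_four (σ := σ) hm
  obtain ⟨s₁, t₁, h1, h2, h3, -⟩ := implements_relationalProgram σ hnN hmN _ _
    (represents_inputState σ hn hm)
  obtain ⟨s₂, t₂, h4, h5, ⟨ρ, τ, h6⟩, -, h7⟩ := exec_tabulate hnN hmN (Formula.rel 4 0 1)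
    (relationalResult σ A).Adj (fun ρ τ => by rw [Formula.holds_rel, hR]) 0 s₁ h3
  obtain ⟨s₃, t₃, h8, h9, h10, h11⟩ := Formula.support.exec_compile hnN hmN 0 ρ τ s₂ h6
  refine ⟨A, _, _, hA, .seq _ _ _ _ _ _ _ h1 (.seq _ _ _ _ _ _ _ h4
    (.seq _ _ _ _ _ _ _ h8 (.assign 0 _ s₃))), ?_, ?_, fun u v => ?_⟩
  · simp only [mainTime, Polynomial.eval_add, RAMExpr.cost, Polynomial.eval_ofNat] at h5 ⊢
    omega
  · rw [RAMState.setReg_reg, if_pos rfl]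
    exact h11.trans (truthValue_congr (holds_support hR))
  -- Checking the result changes registers only, so the stored adjacency matrix is intact.
  · rw [RAMState.setReg_arr, h10.1, h7]

/-- The program returns the result of an execution of the algorithm, in polynomial time. -/
theorem exists_algorithm_exec {n m N : ℕ} (σ : Fin m → LinearOrder (Fin n)) (hn : 0 < n)
    (hm : 0 < m) (hnN : n ≤ N) (hmN : m ≤ N) :
    ∃ (s : RAMState) (t : ℕ) (r : Option (SimpleGraph (Fin n))),
      mainProgram.Exec (inputState σ) s t ∧ t ≤ mainTime.eval N ∧ OutputState s r ∧
        DFSTreeAlgorithm (Set.range σ) r := by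
  have : Nonempty (Fin n) := ⟨⟨0, hn⟩⟩
  have hΦ : (Set.range σ).Nonempty := ⟨σ ⟨0, hm⟩, ⟨_, rfl⟩⟩
  obtain ⟨A, s, t, hA, h1, h2, h3, h4⟩ := exec_mainProgram σ hn hm hnN hmN
  by_cases h : ∀ i, IsNestedTree (σ i) (relationalResult σ A)
  · refine ⟨s, t, some (relationalResult σ A), h1, h2, ⟨?_, fun u v => ⟨fun huv => ?_,
      fun huv => ?_⟩⟩, algorithm_relationalResult hn hm hA
        ((isDFSTreeSupport_iff hΦ _).2 (Set.forall_mem_range.2 h))⟩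
    · rw [h3, truthValue_of h]
    · rw [h4, truthValue_of huv]
    · rw [h4, truthValue_of_not huv]
  -- If a support existed, the computed graph would be the output of an execution, hence a support,
  -- and the check would have succeeded.
  · have hno : ¬ ∃ T, IsDFSTreeSupport (Set.range σ) T := by
      rintro ⟨T, hT⟩
      have hres := isDFSTreeSupport_of_algorithm hΦ (algorithm_relationalResult hn hm hA hT)
      exact h (Set.forall_mem_range.1 ((isDFSTreeSupport_iff hΦ _).1 hres))
    -- Some execution terminates, and without a support correctness forces its answer to be "no",
    -- matching the `0` in register `0`.
    obtain ⟨r, hr⟩ := exists_dfsTreeAlgorithm hΦ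
    obtain rfl := (isCorrectAnswer_of_algorithm hΦ hr).2 hno
    exact ⟨s, t, none, h1, h2, h3.trans (truthValue_of_not h), hr⟩

end GraphSearch

theorem mainTheorem1 :
    -- Correctness, for all choices that the algorithm leaves open.
    (∀ (V : Type u) [Finite V] [Nonempty V] (Φ : Set (LinearOrder V)), Φ.Nonempty →
      (∃ r, GraphSearch.DFSTreeAlgorithm Φ r) ∧
      (∀ r, GraphSearch.DFSTreeAlgorithm Φ r → GraphSearch.IsCorrectAnswer Φ r) ∧
      -- The purification rule can be applied at most `|V| ^ 2` times, in whatever order.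
      (∀ A : Set (V × V), GraphSearch.IsAttachmentDigraph Φ A →
        ∀ (k : ℕ) (Q : ℕ → ↥((GraphSearch.forced A)ᶜ) → Set (GraphSearch.forced A)),
          Q 0 = GraphSearch.candidates Φ (GraphSearch.starTree A) →
          (∀ i < k, GraphSearch.PurifyStep Φ (GraphSearch.starTree A) (Q i) (Q (i + 1))) →
          k ≤ Nat.card V ^ 2)) ∧
    -- Polynomial running time: one program runs the algorithm on all instances.
    (∃ (P : GraphSearch.RAMProgram) (p : Polynomial ℕ),
      ∀ (n m : ℕ) (σ : Fin m → LinearOrder (Fin n)), 0 < n → 0 < m →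
        ∃ (s : GraphSearch.RAMState) (t : ℕ) (r : Option (SimpleGraph (Fin n))),
          P.Exec (GraphSearch.inputState σ) s t ∧ t ≤ p.eval (n * m) ∧
          GraphSearch.OutputState s r ∧
          GraphSearch.DFSTreeAlgorithm (Set.range σ) r ∧
          GraphSearch.IsCorrectAnswer (Set.range σ) r) := by
  refine ⟨fun V _ _ Φ hΦ => ⟨GraphSearch.exists_dfsTreeAlgorithm hΦ,
    fun r hr => GraphSearch.isCorrectAnswer_of_algorithm hΦ hr,
    fun A _ k Q _ hQ => GraphSearch.purifyStep_count_le k Q hQ⟩,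
    GraphSearch.mainProgram, GraphSearch.mainTime, fun n m σ hn hm => ?_⟩
  have : Nonempty (Fin n) := ⟨⟨0, hn⟩⟩
  have hΦ : (Set.range σ).Nonempty := ⟨σ ⟨0, hm⟩, ⟨_, rfl⟩⟩
  -- As `n` and `m` are positive, `n * m` bounds both and can be the argument of the time bound.
  obtain ⟨s, t, r, h1, h2, h3, h4⟩ := GraphSearch.exists_algorithm_exec σ hn hm
    (Nat.le_mul_of_pos_right n hm) (Nat.le_mul_of_pos_left m hn)
  exact ⟨s, t, r, h1, h2, h3, h4, GraphSearch.isCorrectAnswer_of_algorithm hΦ h4⟩
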